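/- **Lemma (Query complexity of QLS-Chebyshev).** Let $A\in\mathbb{C}^{N\times N}$ be an invertible Hermitian matrix with $\|A\|=1$ that is $d$-sparse (at most $d\le N$ nonzero entries in each row and column) and has condition number $|\lambda_{\max}|/|\lambda_{\min}|\le\kappa$, let $b\in\mathbb{C}^N$ with $\|b\|=1$, let $x=A^{-1}b$ and $0<\varepsilon<1/2$. Put $$s=\Big\lceil (d\kappa)^2\log_2\tfrac{d\kappa}{\varepsilon}\Big\rceil,\qquad j_0=\Big\lceil\sqrt{s\,\log_2(4s/\varepsilon)}\Big\rceil,\qquad \alpha=\frac{4}{d\,2^{2s}}\sum_{j=0}^{j_0}\sum_{i=j+1}^{s}\binom{2s}{s+i},$$ $$p_0=\frac1{\alpha^2},\qquad p=\frac{\|x\|^2}{\alpha^2}.$$ *Oracles.* The entries of $A$ are given exactly by bit strings (distinct strings denote distinct numbers). Access to $A$ is through $\mathcal{P}_A$, which consists of $\mathcal{O}_F|j,l\rangle=|j,f(j,l)\rangle$, where $f(j,0),\dots,f(j,d-1)$ are $d$ distinct columns containing all nonzero entries of row $j$, and $\mathcal{O}_A|j,k,z\rangle=|j,k,z\oplus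 A_{jk}\rangle$. Inverses may be used. Queries to $\mathcal{O}_F$ and queries to $\mathcal{O}_A$ are counted separately, and one query to $\mathcal{P}_A$ is one query to each. A unitary $\mathcal{P}_b$ with $\mathcal{P}_b|0\rangle=|b\rangle$ is given and not counted. *Algorithm.* On $\mathbb{C}^{2N}\otimes\mathbb{C}^{2N}$, together with a register for the bit string of an entry, let $T|j\rangle=|\psi_j\rangle=|j\rangle\otimes\frac1{\sqrt d}\sum_k\big(\sqrt{A_{jk}^*}\,|k\rangle+\sqrt{1-|A_{jk}|}\,|k+N\rangle\big)\otimes|A_{jk}\rangle$, with $k$ running over the $d$ columns listed for row $j$ and with principal square roots. Let $S$ swap $j$ and $k$ and conjugate the entry stored in the bit register, with a sign $-1$ on the labels $j,k<N$ whose stored entry is real and negative. Let $W=S(2TT^\dagger-I)$, and let $T_U$ be the circuit for $T$ that uses $\mathcal{O}_F$ and $\mathcal{O}_A$ once each. With $\alpha_j=\frac{4}{d\,2^{2s}}\sum_{i=j+1}^{s}\binom{2s}{s+i}$ and a unitary $V$ with $V|0\rangle=\alpha^{-1/2}\sum_{j\le j_0}\sqrt{\alpha_j}|j\rangle$, let $$\mathcal{A}=V^\dagger\,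 U\, V\,\mathcal{P}_b,\qquad U=\sum_j|j\rangle\langle j|\otimes(-1)^j\,T_U^\dagger W^{2j+1}T_U,$$ where $W^{2j}$ is applied as a product of powers $W^{2\cdot2^i}$ controlled by the bits $i$ of $j$. A run of $\mathcal{A}$ succeeds if all ancillas are measured to be $0$; let $p'$ be the probability of this. *Amplification.* For a constant $1<c<2$, round $k=1,2,\dots$ runs $\mathcal{A}$ on $|0\rangle$, draws $j$ uniformly from $\{0,\dots,m_k\}$ with $m_k=\lfloor\min(c^k,\sqrt{1/p_0})\rfloor$, applies $Q^j$ with $Q=\mathcal{A}S_0\mathcal{A}^\dagger S_f$ (where $S_0$ flips the sign of the initial basis state and $S_f$ that of the states with all ancillas $0$), measures the ancillas, and stops upon success. For $0<q=\sin^2\theta<1$ put $$n_{\mathrm{QAA}}(q)=\sum_{k=1}^\infty m_k\prod_{l=1}^{k-1}\Big(\frac12+\frac{\sin(4(m_l+1)\theta)}{4(m_l+1)\sin 2\theta}\Big).$$ Then there is a constant $C$, depending only on $c$, such that the following holds for all such data. 1. The oracle-free gates of $\mathcal{A}$ are unitary, and one run of $\mathcal{A}$ makes $8\cdot 2^{\lfloor\log_2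 j_0\rfloor}\le 8j_0$ queries to $\mathcal{P}_A$ (with equality if $j_0$ is a power of $2$). 2. $0<p_0\le p<1$ and $0<p'<1$, and $p$ estimates the success probability $p'$ in the sense that $|\sqrt{p'}-\sqrt p|\le\varepsilon/\alpha$. 3. The amplification stops with probability one, and for every $j$ with a nonzero success probability the state that results from a success is, up to a global phase, within $\varepsilon$ of $x/\|x\|$. 4. The series $n_{\mathrm{QAA}}(p')$ and $n_{\mathrm{QAA}}(p)$ converge, and $|n_{\mathrm{QAA}}(p')-n_{\mathrm{QAA}}(p)|\le C\varepsilon\, n_{\mathrm{QAA}}(p)$. 5. The expected number of queries to $\mathcal{P}_A$ made by the amplification iterates $Q^j$ equals $8\cdot 2^{\lfloor\log_2 j_0\rfloor}\,n_{\mathrm{QAA}}(p')$. Hence it is at most $8j_0\,n_{\mathrm{QAA}}(p')$ and at most $8j_0\,(1+C\varepsilon)\,n_{\mathrm{QAA}}(p)$. The expected number of all queries to $\mathcal{P}_A$, with the initial run of $\mathcal{A}$ in each round included, is at most $16j_0\,n_{\mathrm{QAA}}(p')$. -/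

import Mathlib

open scoped Matrix ComplexConjugate

noncomputable section

namespace QLSChebyshev

/-! Parameters of the solver -/

/-- `s = ⌈(dκ)² log₂(dκ/ε)⌉`. -/
def sParam (d : ℕ) (κ ε : ℝ) : ℕ :=
  ⌈((d : ℝ) * κ) ^ 2 * Real.logb 2 ((d : ℝ) * κ / ε)⌉₊

/-- `j₀ = ⌈√(s log₂(4 s / ε))⌉`. -/
def jZero (d : ℕ) (κ ε : ℝ) : ℕ :=
  ⌈Real.sqrt ((sParam d κ ε : ℝ) * Real.logb 2 (4 / ε * (sParam d κ ε : ℝ)))⌉₊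

/-- `Σ_{i=j+1}^s C(2s, s+i)`. -/
def binomTail (s j : ℕ) : ℝ := ∑ i ∈ Finset.Icc (j + 1) s, ((2 * s).choose (s + i) : ℝ)

/-- `α = 4 / (d 2^{2s}) Σ_{j=0}^{j₀} Σ_{i=j+1}^s C(2s, s+i)`. -/
def alpha (d : ℕ) (κ ε : ℝ) : ℝ :=
  4 / ((d : ℝ) * 2 ^ (2 * sParam d κ ε)) *
    ∑ j ∈ Finset.range (jZero d κ ε + 1), binomTail (sParam d κ ε) j

/-- The coefficient `α_j` of the linear combination of unitaries; it is `0` for `j > j₀`. -/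
def coeff (d : ℕ) (κ ε : ℝ) (j : ℕ) : ℝ :=
  if j ≤ jZero d κ ε then 4 / (d : ℝ) * (binomTail (sParam d κ ε) j / 2 ^ (2 * sParam d κ ε))
  else 0

/-- Number of qubits of the control register, `⌈log₂(j₀+1)⌉ = ⌊log₂ j₀⌋ + 1`. -/
def ctrlQubits (d : ℕ) (κ ε : ℝ) : ℕ := Nat.log 2 (jZero d κ ε) + 1

/-! The overhead of amplitude amplification, as an explicit series -/

/-- `m_k = ⌊min(c^k, √(1/p₀))⌋`. -/
def mSeq (c p₀ : ℝ) (k : ℕ) : ℕ := ⌊min (c ^ k) (Real.sqrt (1 / p₀))⌋₊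

/-- `⟨p⟩ = 1/2 - sin(4(m+1)θ) / (4(m+1) sin(2θ))`, where `p = sin² θ`. -/
def avgProb (p : ℝ) (m : ℕ) : ℝ :=
  1 / 2 - Real.sin (4 * ((m : ℝ) + 1) * Real.arcsin (Real.sqrt p)) /
    (4 * ((m : ℝ) + 1) * Real.sin (2 * Real.arcsin (Real.sqrt p)))

/-- The `(k+1)`-st summand of `n_QAA`: `m_{k+1} ∏_{l=1}^{k} (1 - ⟨p_{j_l}⟩)`. -/
def nQAATerm (c p p₀ : ℝ) (k : ℕ) : ℝ :=
  (mSeq c p₀ (k + 1) : ℝ) * ∏ l ∈ Finset.range k, (1 - avgProb p (mSeq c p₀ (l + 1)))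

/-- `n_QAA = Σ_{k≥1} m_k ∏_{l=1}^{k-1} (1 - ⟨p_{j_l}⟩)`. -/
def nQAA (c p p₀ : ℝ) : ℝ := ∑' k : ℕ, nQAATerm c p p₀ k

/-! Linear systems -/

/-- The condition number `|λ_max| / |λ_min|` of a Hermitian matrix. -/
def condNumber {N : ℕ} {A : Matrix (Fin N) (Fin N) ℂ} (hA : A.IsHermitian) : ℝ :=
  (⨆ i, |hA.eigenvalues i|) / (⨅ i, |hA.eigenvalues i|)

/-- At most `d` nonzero entries in each row and in each column. -/
def IsSparse {N : ℕ} (A : Matrix (Fin N) (Fin N) ℂ) (d : ℕ) : Prop :=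
  (∀ j, {k | A j k ≠ 0}.ncard ≤ d) ∧ (∀ k, {j | A j k ≠ 0}.ncard ≤ d)

/-- The quantum state proportional to the vector `v`. -/
def normalized {N : ℕ} (v : EuclideanSpace ℂ (Fin N)) : EuclideanSpace ℂ (Fin N) :=
  ((‖v‖⁻¹ : ℝ) : ℂ) • v

/-! Registers, oracles and circuits -/

/-- Bit strings of length `w`. -/
abbrev Bits (w : ℕ) := Fin w → Bool

/-- Computational basis labels `(c, (j, u), (k, v), z)`: an `m`-qubit control register `c`; the two
registers `ℂ^{2N} ⊗ ℂ^{2N}` of the quantum walk, where `(k, false)` is the label `k` and `(k, true)`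
is the label `k + N`; and a register `z` for the bit string of a matrix entry. -/
abbrev Reg (m N w : ℕ) := Fin (2 ^ m) × (Fin N × Bool) × (Fin N × Bool) × Bits w

/-- Operators on the whole register. -/
abbrev Op (m N w : ℕ) := Matrix (Reg m N w) (Reg m N w) ℂ

/-- The data behind the three oracles: `f j l` is the column index of the `l`-th nonzero entry of
row `j`, `bits j k` is the bit string of the entry `(j, k)`, and `prep` is a unitary that prepares
the right-hand side. -/
structure Oracles (N w : ℕ) where
  f : Fin N → Equiv.Perm (Fin N)
  bits : Fin N → Fin N → Bits w
  prep : Matrix (Fin N) (Fin N) ℂ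

/-- The oracles specify `A` (with sparsity `d`, entries being encoded by `decode`) and `b`: the
nonzero entries of row `j` are among the `d` columns `f j 0, …, f j (d-1)`, the list being filled up
with zero entries if there are fewer than `d` nonzero ones. -/
structure Oracles.Specifies {N w : ℕ} [NeZero N] (O : Oracles N w) (decode : Bits w → ℂ)
    (d : ℕ) (A : Matrix (Fin N) (Fin N) ℂ) (b : EuclideanSpace ℂ (Fin N)) : Prop where
  columns : ∀ j k, A j k ≠ 0 → ((O.f j).symm k : ℕ) < d
  entries : ∀ j k, decode (O.bits j k) = A j k
  prep_unitary : O.prep ∈ Matrix.unitaryGroup (Fin N) ℂ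
  prep_zero : ∀ j, O.prep j 0 = b j

/-- One step of a circuit: a gate that does not involve the oracles, the oracle
`O_F |j, l⟩ = |j, f(j, l)⟩` or its inverse, the oracle `O_A |j, k, z⟩ = |j, k, z ⊕ A_{jk}⟩`
(its own inverse), or the preparation of `b` or its inverse. -/
inductive Instr (m N w : ℕ) where
  | gate (U : Op m N w)
  | oracleF (inverse : Bool)
  | oracleA
  | prepB (inverse : Bool)

/-- A circuit is a list of instructions, the first one being executed first. -/
abbrev Circuit (m N w : ℕ) := List (Instr m N w)

/-- The operator `|r⟩ ↦ φ(r) |σ(r)⟩`. -/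
def labelOp {m N w : ℕ} (σ : Reg m N w → Reg m N w) (φ : Reg m N w → ℂ) : Op m N w :=
  Matrix.of fun r r' => if r = σ r' then φ r' else 0

/-- `O_F |j, l⟩ = |j, f(j, l)⟩`. -/
def oracleFOp {m N w : ℕ} (O : Oracles N w) : Op m N w :=
  labelOp (fun r => (r.1, r.2.1, (O.f r.2.1.1 r.2.2.1.1, r.2.2.1.2), r.2.2.2)) fun _ => 1

/-- `O_A |j, k, z⟩ = |j, k, z ⊕ A_{jk}⟩`. -/
def oracleAOp {m N w : ℕ} (O : Oracles N w) : Op m N w :=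
  labelOp (fun r => (r.1, r.2.1, r.2.2.1,
    fun i => xor (r.2.2.2 i) (O.bits r.2.1.1 r.2.2.1.1 i))) fun _ => 1

/-- An operator on the control register. -/
def onCtrl {m N w : ℕ} (U : Matrix (Fin (2 ^ m)) (Fin (2 ^ m)) ℂ) : Op m N w :=
  Matrix.of fun r r' => if r.2 = r'.2 then U r.1 r'.1 else 0

/-- An operator on the index `j` of the first walk register. -/
def onSystem {m N w : ℕ} (U : Matrix (Fin N) (Fin N) ℂ) : Op m N w :=
  Matrix.of fun r r' =>
    if r.1 = r'.1 ∧ r.2.1.2 = r'.2.1.2 ∧ r.2.2 = r'.2.2 then U r.2.1.1 r'.2.1.1 else 0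

/-- An operator on the index `k` of the second walk register. -/
def onIndex {m N w : ℕ} (U : Matrix (Fin N) (Fin N) ℂ) : Op m N w :=
  Matrix.of fun r r' =>
    if r.1 = r'.1 ∧ r.2.1 = r'.2.1 ∧ r.2.2.1.2 = r'.2.2.1.2 ∧ r.2.2.2 = r'.2.2.2 then
      U r.2.2.1.1 r'.2.2.1.1 else 0

/-- An operator on the flag of the second walk register, controlled by the bit string `z`. -/
def onFlag {m N w : ℕ} (U : Bits w → Matrix Bool Bool ℂ) : Op m N w :=
  Matrix.of fun r r' =>
    if r.1 = r'.1 ∧ r.2.1 = r'.2.1 ∧ r.2.2.1.1 = r'.2.2.1.1 ∧ r.2.2.2 = r'.2.2.2 then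
      U r'.2.2.2 r.2.2.1.2 r'.2.2.1.2 else 0

/-- The operator carried out by an instruction. -/
def Instr.eval {m N w : ℕ} (O : Oracles N w) : Instr m N w → Op m N w
  | .gate U => U
  | .oracleF false => oracleFOp O
  | .oracleF true => (oracleFOp O)ᴴ
  | .oracleA => oracleAOp O
  | .prepB false => onSystem O.prep
  | .prepB true => (onSystem O.prep)ᴴ

/-- The inverse instruction. -/
def Instr.inv {m N w : ℕ} : Instr m N w → Instr m N w
  | .gate U => .gate Uᴴ
  | .oracleF i => .oracleF (!i)
  | .oracleA => .oracleA
  | .prepB i => .prepB (!i)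

def Instr.isOracleF {m N w : ℕ} : Instr m N w → Bool
  | .oracleF _ => true
  | _ => false

def Instr.isOracleA {m N w : ℕ} : Instr m N w → Bool
  | .oracleA => true
  | _ => false

/-- Every gate of the circuit that is not an oracle is unitary. -/
def Circuit.IsUnitary {m N w : ℕ} (𝒞 : Circuit m N w) : Prop :=
  ∀ U, Instr.gate U ∈ 𝒞 → U ∈ Matrix.unitaryGroup (Reg m N w) ℂ

/-- The operator carried out by a circuit. -/
def Circuit.eval {m N w : ℕ} (O : Oracles N w) : Circuit m N w → Op m N w
  | [] => 1
  | g :: 𝒞 => Circuit.eval O 𝒞 * g.eval O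

/-- The inverse circuit. -/
def Circuit.inv {m N w : ℕ} (𝒞 : Circuit m N w) : Circuit m N w := (𝒞.map Instr.inv).reverse

/-- Number of uses of `O_F` and its inverse. -/
def Circuit.queriesF {m N w : ℕ} (𝒞 : Circuit m N w) : ℕ := 𝒞.countP Instr.isOracleF

/-- Number of uses of `O_A`. -/
def Circuit.queriesA {m N w : ℕ} (𝒞 : Circuit m N w) : ℕ := 𝒞.countP Instr.isOracleA

/-- The label of the initial state `|0⟩` of all registers. -/
def start (m N w : ℕ) [NeZero N] : Reg m N w := (0, (0, false), (0, false), fun _ => false)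

/-- The walk ancillas (both flags, the second index, the bit string) are all `0`. -/
def walkAncZero {m N w : ℕ} [NeZero N] (r : Reg m N w) : Prop :=
  r.2.1.2 = false ∧ r.2.2 = ((0, false), fun _ => false)

/-- All ancillas (control and walk) are `0`: the outcome that signals success. -/
def ancZero {m N w : ℕ} [NeZero N] (r : Reg m N w) : Prop := r.1 = 0 ∧ walkAncZero r

/-! The circuit: linear combination of unitaries with a quantum walk -/

/-- The reflection that exchanges the basis vector `i₀` with the real unit vector `v`; it is used as
the unitary that prepares `v` from `i₀`. -/
def prepReal {ι : Type} [Fintype ι] [DecidableEq ι] (i₀ : ι) (v : ι → ℝ) : Matrix ι ι ℂ :=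
  let u : ι → ℝ := fun i => (if i = i₀ then 1 else 0) - v i
  Matrix.of fun i j => (((if i = j then 1 else 0) - 2 * u i * u j / ∑ l, u l ^ 2 : ℝ) : ℂ)

/-- The map `V` with `V |0⟩ = α^{-1/2} Σ_j √α_j |j⟩`. -/
def ctrlPrep (m d : ℕ) (κ ε : ℝ) : Matrix (Fin (2 ^ m)) (Fin (2 ^ m)) ℂ :=
  prepReal 0 fun j => Real.sqrt (coeff d κ ε j / alpha d κ ε)

/-- A unitary with `|0⟩ ↦ d^{-1/2} Σ_{l<d} |l⟩`. -/
def uniformPrep (N d : ℕ) [NeZero N] : Matrix (Fin N) (Fin N) ℂ :=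
  prepReal 0 fun l => if (l : ℕ) < d then 1 / Real.sqrt d else 0

/-- The rotation `|0⟩ ↦ √(a^*) |0⟩ + √(1-|a|) |1⟩` for an entry `a` of modulus at most one. -/
def entryRotation (a : ℂ) : Matrix Bool Bool ℂ :=
  if ‖a‖ ≤ 1 then
    Matrix.of fun x y =>
      match x, y with
      | false, false => (conj a) ^ (1 / 2 : ℂ)
      | true, false => (Real.sqrt (1 - ‖a‖) : ℂ)
      | false, true => -(Real.sqrt (1 - ‖a‖) : ℂ)
      | true, true => conj ((conj a) ^ (1 / 2 : ℂ))
  else 1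

open Classical in
/-- The bit string of the complex conjugate entry (the string itself, if there is none). -/
def conjBits {w : ℕ} (decode : Bits w → ℂ) (z : Bits w) : Bits w :=
  if h : ∃ z', decode z' = conj (decode z) then h.choose else z

/-- The swap `|j, k⟩ ↦ |k, j⟩` of the two walk registers, where the bit string of `A_{jk}` becomes
that of `A_{kj} = A_{jk}^*`, applied for those values of the control register that are `active`.
The sign fixes the square roots: the principal roots satisfy `(√(a^*))^* √a = a` unless `a` is real
and negative, where the product is `-a`. -/
def swapOp {m N w : ℕ} (decode : Bits w → ℂ) (active : Fin (2 ^ m) → Bool) : Op m N w :=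
  labelOp
    (fun r => if active r.1 then (r.1, r.2.2.1, r.2.1, conjBits decode r.2.2.2) else r)
    (fun r =>
      if active r.1 ∧ r.2.1.2 = false ∧ r.2.2.1.2 = false ∧
        (decode r.2.2.2).im = 0 ∧ (decode r.2.2.2).re < 0 then -1 else 1)

open Classical in
/-- `2 |0⟩⟨0| - 1` on the walk ancillas, applied for the `active` values of the control. -/
def reflectOp {m N w : ℕ} [NeZero N] (active : Fin (2 ^ m) → Bool) : Op m N w :=
  labelOp id fun r => if active r.1 ∧ ¬ walkAncZero r then -1 else 1

/-- The circuit `T_U` with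
`|j⟩|0⟩ ↦ |ψ_j⟩ = |j⟩ d^{-1/2} Σ_k (√(A_{jk}^*) |k⟩ + √(1-|A_{jk}|) |k+N⟩) |A_{jk}⟩`,
the sum being over the `d` columns `k` listed by `O_F` for row `j`. -/
def isometryCircuit (m N w d : ℕ) [NeZero N] (decode : Bits w → ℂ) : Circuit m N w :=
  [.gate (onIndex (uniformPrep N d)), .oracleF false, .oracleA,
    .gate (onFlag fun z => entryRotation (decode z))]

/-- The (controlled) walk operator `W = S (2 T T† - 1)`. -/
def walkCircuit (m N w d : ℕ) [NeZero N] (decode : Bits w → ℂ) (active : Fin (2 ^ m) → Bool) :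
    Circuit m N w :=
  Circuit.inv (isometryCircuit m N w d decode) ++ [.gate (reflectOp active)] ++
    isometryCircuit m N w d decode ++ [.gate (swapOp decode active)]

/-- `Σ_j |j⟩⟨j| ⊗ (W²)^j`, as a product over the bits `i` of `j` of controlled `W^{2·2^i}`. -/
def controlledPowers (m N w d : ℕ) [NeZero N] (decode : Bits w → ℂ) : Circuit m N w :=
  (List.range m).flatMap fun i =>
    (List.replicate (2 ^ (i + 1))
      (walkCircuit m N w d decode fun j => (j : ℕ).testBit i)).flatten

/-- The circuit `V† U V P_b`, where `U = Σ_j |j⟩⟨j| ⊗ (-1)^j T_U† W^{2j+1} T_U`. -/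
def stepCircuit (N w d : ℕ) [NeZero N] (κ ε : ℝ) (decode : Bits w → ℂ) :
    Circuit (ctrlQubits d κ ε) N w :=
  [.prepB false, .gate (onCtrl (ctrlPrep _ d κ ε))] ++
    isometryCircuit _ N w d decode ++
    controlledPowers _ N w d decode ++
    walkCircuit _ N w d decode (fun _ => true) ++
    Circuit.inv (isometryCircuit _ N w d decode) ++
    [.gate (labelOp id fun r => (-1) ^ (r.1 : ℕ)), .gate (onCtrl (ctrlPrep _ d κ ε)ᴴ)]

/-! Amplitude amplification with an unknown success probability -/

open Classical in
/-- `Q = 𝒜 S₀ 𝒜† S_f`. -/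
def amplifier {m N w : ℕ} [NeZero N] (𝒜 : Circuit m N w) : Circuit m N w :=
  [.gate (labelOp id fun r => if ancZero r then -1 else 1)] ++ Circuit.inv 𝒜 ++
    [.gate (labelOp id fun r => if r = start m N w then -1 else 1)] ++ 𝒜

/-- The circuit of `Q^j`. -/
def amplifierPow {m N w : ℕ} [NeZero N] (𝒜 : Circuit m N w) (j : ℕ) : Circuit m N w :=
  (List.replicate j (amplifier 𝒜)).flatten

/-- The system part of the projection of `Q^j 𝒜 |0⟩` to the good subspace. Up to normalization it is
the state after the measurement has signalled success. -/
def goodPart {m N w : ℕ} [NeZero N] (O : Oracles N w) (𝒜 : Circuit m N w) (j : ℕ) :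
    EuclideanSpace ℂ (Fin N) :=
  WithLp.toLp 2 fun i =>
    Circuit.eval O (𝒜 ++ amplifierPow 𝒜 j) (0, (i, false), (0, false), fun _ => false) (start m N w)

/-- Probability that the measurement of `Q^j 𝒜 |0⟩` signals success. -/
def successProb {m N w : ℕ} [NeZero N] (O : Oracles N w) (𝒜 : Circuit m N w) (j : ℕ) : ℝ :=
  ‖goodPart O 𝒜 j‖ ^ 2

/-- Average of `q` over `j` drawn uniformly from `{0, …, M}`. -/
def uniformMean (M : ℕ) (q : ℕ → ℝ) : ℝ := (∑ j ∈ Finset.range (M + 1), q j) / ((M : ℝ) + 1)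

/-- Probability that rounds `1, …, k` of the amplification loop all fail; in round `l` the circuit
`𝒜` and then `Q^j` are run, `j` being drawn uniformly from `{0, …, m_l}`, and the flag is measured. -/
def reachProb {m N w : ℕ} [NeZero N] (O : Oracles N w) (𝒜 : Circuit m N w) (c p₀ : ℝ) (k : ℕ) : ℝ :=
  ∏ l ∈ Finset.range k, (1 - uniformMean (mSeq c p₀ (l + 1)) (successProb O 𝒜))

/-- Expectation of the sum, over the rounds that are carried out until the first success, of a
quantity that is `q j` in a round in which `j` was drawn. -/
def expectedSum {m N w : ℕ} [NeZero N] (O : Oracles N w) (𝒜 : Circuit m N w) (c p₀ : ℝ)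
    (q : ℕ → ℕ) : ENNReal :=
  ∑' k : ℕ, ENNReal.ofReal (reachProb O 𝒜 c p₀ k) *
    ENNReal.ofReal (uniformMean (mSeq c p₀ (k + 1)) fun j => (q j : ℝ))

end QLSChebyshev

end

namespace QLSChebyshev

/-! ### Perturbation of series of the form `∑ mₖ ∏_{l<k} rₗ` -/

/-! The quantum part is exact. For the isometry `T` one has `T†ST = A/d` (`compression_apply`), and
because `S² = 1` the compressions `T†WⁿT` satisfy the Chebyshev recursion
(`compression_pow_add_two`). On an eigenvector of `A` with eigenvalue `λ = d cos θ` they act as `cos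
nθ`. Sandwiching `U` between `V†` and `V` averages them with weights `α_j/α`. One run therefore
multiplies the eigencoefficients of `b` by `h(λ)/α`, where `h(λ) = Σ_{j≤j₀} (-1)^j α_j cos((2j+1)θ)`
(`specCoeff_goodPart_zero`).

The approximation `h(λ) ≈ 1/λ` is classical. Without truncation, `d h(λ)` equals `(1 - sin^{2s}
θ)/cos θ` (`cos_mul_chebyshev_sum`). The choice of `s` makes the term with `sin^{2s} θ` at most
`0.45 ε` (`mul_one_sub_pow_le`), and a Chernoff bound makes the truncation error at most `0.05 ε`
(`truncation_le`). So `α` times the good part of one run is within `ε/2` of `x`. A lower bound for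
central binomial coefficients gives `α ≥ (10/9) κ` (`le_mul_alpha`), which keeps the amplitudes `√p`
and `√p'` below `9/10`.

Amplification is a rotation of a plane (`goodPart_eq_smul`). Hence `Q^j` only rescales the good part
by a real number, the accuracy does not depend on `j`, and the mean failure probability of a round
is the factor in `n_QAA`. One `Q` contains two runs and `j` has mean `m_k/2`, so the expected cost
of the iterates is the cost of one run times `n_QAA(p')`.

It remains to compare `n_QAA(p')` with `n_QAA(p)` (`nQAA_perturbation`). Since `α √p = ‖x‖ ≥ 1`, the
amplitude `σ = √p` is perturbed by a relative error of order `ε`. This changes the failure rate of a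
round with `m` iterations by `O(ε min((m+1)σ, 1))`. A change made in one round is multiplied by the
expected cost of the later rounds, which is `O(max(m, 1/σ))`: rounds shorter than a multiple of
`1/σ` may all fail but cost a geometric sum, and longer rounds fail with a rate below `1/c`, or at
most `9/10` once their length is capped. The product is `O(ε m)`, that is, `ε` times the cost of the
round itself, and summation gives a relative error. -/

theorem abs_prod_sub_prod_succ_le (r r' e : ℕ → ℝ) (hr : ∀ k, 0 ≤ r k) (hr' : ∀ k, 0 ≤ r' k)
    (he : ∀ k, |r' k - r k| ≤ e k) (k : ℕ) :
    |∏ l ∈ Finset.range (k + 1), r' l - ∏ l ∈ Finset.range (k + 1), r l| ≤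
      |∏ l ∈ Finset.range k, r' l - ∏ l ∈ Finset.range k, r l| * r' k +
        (∏ l ∈ Finset.range k, r l) * e k := by
  rw [Finset.prod_range_succ, Finset.prod_range_succ]
  set R := ∏ l ∈ Finset.range k, r l
  set R' := ∏ l ∈ Finset.range k, r' l
  have hR : 0 ≤ R := Finset.prod_nonneg fun l _ => hr l
  calc |R' * r' k - R * r k| = |(R' - R) * r' k + R * (r' k - r k)| := by ring_nf
    _ ≤ |(R' - R) * r' k| + |R * (r' k - r k)| := abs_add_le _ _
    _ = |R' - R| * r' k + R * |r' k - r k| := by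
      rw [abs_mul, abs_mul, abs_of_nonneg (hr' k), abs_of_nonneg hR]
    _ ≤ _ := by gcongr; exact he k

/-- The inequality `hΦ` makes `Φ k` an upper bound for the cost from round `k` on under the rates
`r'`. A discrepancy created in round `k` has the unperturbed weight `∏ r` times `e k`; afterwards it
is transported by `r'`, so its total future cost is at most `Φ (k + 1)`. The boundary term with `Φ
K` is what closes the induction. -/
theorem sum_mul_abs_prod_sub_le (m r r' e Φ : ℕ → ℝ) (hr : ∀ k, 0 ≤ r k) (hr' : ∀ k, 0 ≤ r' k)
    (he : ∀ k, |r' k - r k| ≤ e k) (hΦ₀ : ∀ k, 0 ≤ Φ k)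
    (hΦ : ∀ k, m k + r' k * Φ (k + 1) ≤ Φ k) (K : ℕ) :
    ∑ k ∈ Finset.range K, m k * |∏ l ∈ Finset.range k, r' l - ∏ l ∈ Finset.range k, r l| +
      |∏ l ∈ Finset.range K, r' l - ∏ l ∈ Finset.range K, r l| * Φ K ≤
      ∑ k ∈ Finset.range K, (∏ l ∈ Finset.range k, r l) * (e k * Φ (k + 1)) := by
  induction K with
  | zero => simp
  | succ K ih =>
    rw [Finset.sum_range_succ, Finset.sum_range_succ (n := K) (f := fun k =>
      (∏ l ∈ Finset.range k, r l) * (e k * Φ (k + 1)))]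
    have h1 := mul_le_mul_of_nonneg_right (abs_prod_sub_prod_succ_le r r' e hr hr' he K)
      (hΦ₀ (K + 1))
    have h2 := mul_le_mul_of_nonneg_left (hΦ K)
      (abs_nonneg (∏ l ∈ Finset.range K, r' l - ∏ l ∈ Finset.range K, r l))
    linarith

theorem sum_mul_prod_le (m r Φ : ℕ → ℝ) (hr : ∀ k, 0 ≤ r k) (hΦ₀ : ∀ k, 0 ≤ Φ k)
    (hΦ : ∀ k, m k + r k * Φ (k + 1) ≤ Φ k) (K : ℕ) :
    ∑ k ∈ Finset.range K, m k * ∏ l ∈ Finset.range k, r l ≤ Φ 0 := by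
  -- The cost so far plus the bound for the remaining cost never increases with `K`.
  suffices h : ∑ k ∈ Finset.range K, m k * ∏ l ∈ Finset.range k, r l +
      (∏ l ∈ Finset.range K, r l) * Φ K ≤ Φ 0 by
    have := mul_nonneg (Finset.prod_nonneg (s := Finset.range K) fun l _ => hr l) (hΦ₀ K)
    linarith
  induction K with
  | zero => simp
  | succ K ih =>
    rw [Finset.sum_range_succ, Finset.prod_range_succ]
    have h2 := mul_le_mul_of_nonneg_left (hΦ K)
      (Finset.prod_nonneg (s := Finset.range K) fun l _ => hr l)
    linarith

theorem summable_mul_prod (m r Φ : ℕ → ℝ) (hm : ∀ k, 0 ≤ m k) (hr : ∀ k, 0 ≤ r k)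
    (hΦ₀ : ∀ k, 0 ≤ Φ k) (hΦ : ∀ k, m k + r k * Φ (k + 1) ≤ Φ k) :
    Summable fun k => m k * ∏ l ∈ Finset.range k, r l :=
  summable_of_sum_range_le (fun k => mul_nonneg (hm k) (Finset.prod_nonneg fun l _ => hr l))
    (sum_mul_prod_le m r Φ hr hΦ₀ hΦ)

/-- The condition `heΦ` compares the damage done by the perturbation in a round with the cost of the
same round, which converts an absolute error into a relative one. The potential `Ψ` for the rates
`r` serves only for summability. -/
theorem abs_tsum_mul_prod_sub_le (m r r' e Φ Ψ : ℕ → ℝ) (B : ℝ) (hm : ∀ k, 0 ≤ m k)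
    (hr : ∀ k, 0 ≤ r k) (hr' : ∀ k, 0 ≤ r' k) (he : ∀ k, |r' k - r k| ≤ e k)
    (hΦ₀ : ∀ k, 0 ≤ Φ k) (hΦ : ∀ k, m k + r' k * Φ (k + 1) ≤ Φ k)
    (hΨ₀ : ∀ k, 0 ≤ Ψ k) (hΨ : ∀ k, m k + r k * Ψ (k + 1) ≤ Ψ k)
    (heΦ : ∀ k, e k * Φ (k + 1) ≤ B * m k) (hB : 0 ≤ B) :
    |∑' k, m k * ∏ l ∈ Finset.range k, r' l - ∑' k, m k * ∏ l ∈ Finset.range k, r l| ≤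
      B * ∑' k, m k * ∏ l ∈ Finset.range k, r l := by
  have s1 := summable_mul_prod m r Ψ hm hr hΨ₀ hΨ
  have s2 := summable_mul_prod m r' Φ hm hr' hΦ₀ hΦ
  have hpos : ∀ k, 0 ≤ m k * ∏ l ∈ Finset.range k, r l := fun k =>
    mul_nonneg (hm k) (Finset.prod_nonneg fun l _ => hr l)
  have key : ∀ K, ∑ k ∈ Finset.range K,
      |m k * ∏ l ∈ Finset.range k, r' l - m k * ∏ l ∈ Finset.range k, r l| ≤
        B * ∑' k, m k * ∏ l ∈ Finset.range k, r l := by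
    intro K
    calc _ = ∑ k ∈ Finset.range K,
          m k * |∏ l ∈ Finset.range k, r' l - ∏ l ∈ Finset.range k, r l| := by
          refine Finset.sum_congr rfl fun k _ => ?_
          rw [← mul_sub, abs_mul, abs_of_nonneg (hm k)]
      _ ≤ ∑ k ∈ Finset.range K, (∏ l ∈ Finset.range k, r l) * (e k * Φ (k + 1)) := by
          have h1 := sum_mul_abs_prod_sub_le m r r' e Φ hr hr' he hΦ₀ hΦ K
          have h2 := mul_nonneg
            (abs_nonneg (∏ l ∈ Finset.range K, r' l - ∏ l ∈ Finset.range K, r l)) (hΦ₀ K)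
          linarith
      _ ≤ ∑ k ∈ Finset.range K, B * (m k * ∏ l ∈ Finset.range k, r l) := by
          refine Finset.sum_le_sum fun k _ => ?_
          have := mul_le_mul_of_nonneg_left (heΦ k)
            (Finset.prod_nonneg (s := Finset.range k) fun l _ => hr l)
          linarith
      _ = B * ∑ k ∈ Finset.range K, m k * ∏ l ∈ Finset.range k, r l := by rw [Finset.mul_sum]
      _ ≤ _ := by
          gcongr
          exact s1.sum_le_tsum _ fun k _ => hpos k
  have s3 := summable_of_sum_range_le (fun k => abs_nonneg _) key
  rw [← s2.tsum_sub s1]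
  refine (norm_tsum_le_tsum_norm (f := fun k => m k * ∏ l ∈ Finset.range k, r' l - m k * ∏ l ∈ Finset.range k, r l) s3).trans ?_
  exact Real.tsum_le_of_sum_range_le (fun k => abs_nonneg _) key

/-! ### The potential for geometrically growing, capped numbers of iterations -/

/-- A bound for the expected number of iterations from round `k + 1` on, if rounds with `c^k ≤ Y`
may all fail. -/
noncomputable def potential (c α Y P : ℝ) (k : ℕ) : ℝ :=
  if c ^ (k + 1) ≤ Y then P * c * Y + (c * Y - c ^ (k + 1)) / (c - 1)
  else P * min (c ^ (k + 1)) α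

theorem potential_nonneg {c α Y P : ℝ} (hc : 1 < c) (hα : 1 ≤ α) (hP : 0 ≤ P) (hY : 0 ≤ Y)
    (k : ℕ) : 0 ≤ potential c α Y P k := by
  unfold potential
  have hk : 0 < c ^ (k + 1) := by positivity
  split_ifs with h
  · have : 0 ≤ c * Y - c ^ (k + 1) := by nlinarith
    have : 0 < c - 1 := by linarith
    positivity
  · positivity

/-- While `c ^ (k + 1) ≤ Y` only `r k ≤ 1` is used: the quotient in `potential` dominates the
geometric sum of the remaining powers up to `Y`, and the first power beyond `Y` is at most `c * Y`,
so that the late phase starts with a cost of at most `P * c * Y`. Beyond `Y` the assumption `hr` is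
the claim itself. -/
theorem potential_step {c α Y P : ℝ} {r : ℕ → ℝ} (hc : 1 < c) (hP : 0 ≤ P) (hα : 0 ≤ α)
    (hYα : Y ≤ α) (hY₀ : 0 ≤ Y) (hr₁ : ∀ k, r k ≤ 1)
    (hr : ∀ k, Y < c ^ (k + 1) →
      min (c ^ (k + 1)) α + r k * (P * min (c ^ (k + 2)) α) ≤ P * min (c ^ (k + 1)) α) (k : ℕ) :
    min (c ^ (k + 1)) α + r k * potential c α Y P (k + 1) ≤ potential c α Y P k := by
  have hpos : ∀ k, 0 < c ^ k := fun k => by positivity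
  have hc1 : 0 < c - 1 := by linarith
  have hsucc : c ^ (k + 2) = c * c ^ (k + 1) := by ring
  have hlt : c ^ (k + 1) < c ^ (k + 2) := by rw [hsucc]; nlinarith [hpos (k + 1)]
  by_cases h1 : c ^ (k + 1) ≤ Y
  · have hmin : min (c ^ (k + 1)) α = c ^ (k + 1) := min_eq_left (h1.trans hYα)
    have hx : c ^ (k + 1) = (c * c ^ (k + 1) - c ^ (k + 1)) / (c - 1) := by
      field_simp
    rw [hmin]
    by_cases h2 : c ^ (k + 2) ≤ Y
    · simp only [potential, if_pos h1, if_pos h2]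
      have h3 : 0 ≤ P * c * Y + (c * Y - c ^ (k + 2)) / (c - 1) := by
        have : 0 ≤ c * Y - c ^ (k + 2) := by nlinarith
        positivity
      have h4 := mul_le_mul_of_nonneg_right (hr₁ k) h3
      have h5 : (c * Y - c ^ (k + 1)) / (c - 1) = (c * Y - c ^ (k + 2)) / (c - 1) +
          (c * c ^ (k + 1) - c ^ (k + 1)) / (c - 1) := by rw [hsucc]; ring
      rw [h5, ← hx]
      linarith
    · simp only [potential, if_pos h1, if_neg h2]
      have h3 : P * min (c ^ (k + 2)) α ≤ P * c * Y := by
        rw [mul_assoc]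
        gcongr
        exact (min_le_left _ _).trans (by rw [hsucc]; gcongr)
      have h4 : r k * (P * min (c ^ (k + 2)) α) ≤ P * min (c ^ (k + 2)) α :=
        mul_le_of_le_one_left (mul_nonneg hP (le_min (hpos _).le hα)) (hr₁ k)
      have h5 : c ^ (k + 1) ≤ (c * Y - c ^ (k + 1)) / (c - 1) := by
        rw [le_div_iff₀ hc1]; nlinarith
      linarith
  · have h2 : ¬ c ^ (k + 2) ≤ Y := fun h => h1 (hlt.le.trans h)
    simp only [potential, if_neg h1, if_neg h2]
    exact hr k (not_le.mp h1)

/-- With `X` a multiple of `1 / σ`, this maximum is compensated by the factor `min ((m + 1) σ) 1` in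
the change of the failure rate. -/
theorem potential_le {c α X P : ℝ} (hc : 1 < c) (hP : 0 ≤ P) (hα : 0 ≤ α) (k : ℕ) :
    potential c α (min X α) P k ≤
      (P * c + c / (c - 1)) * max (min (c ^ (k + 1)) α) X := by
  have hc1 : 0 < c - 1 := by linarith
  have hpos : 0 < c ^ (k + 1) := by positivity
  unfold potential
  split_ifs with h
  · calc P * c * min X α + (c * min X α - c ^ (k + 1)) / (c - 1)
        ≤ P * c * min X α + (c * min X α) / (c - 1) := by gcongr; linarith
      _ = (P * c + c / (c - 1)) * min X α := by ring
      _ ≤ _ := by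
        gcongr
        exact (min_le_left _ _).trans (le_max_right _ _)
  · have h0 : 0 ≤ min (c ^ (k + 1)) α := le_min hpos.le hα
    have : P ≤ P * c + c / (c - 1) := by
      have : 0 ≤ c / (c - 1) := by positivity
      nlinarith
    calc P * min (c ^ (k + 1)) α ≤ (P * c + c / (c - 1)) * min (c ^ (k + 1)) α := by gcongr
      _ ≤ _ := by gcongr; exact le_max_left _ _

/-! ### The average failure probability of a round -/

/-- The probability that a round fails, `sin² θ` being the success probability of one run. -/
noncomputable def failRate (θ : ℝ) (m : ℕ) : ℝ :=
  1 / 2 + Real.sin (4 * ((m : ℝ) + 1) * θ) / (4 * ((m : ℝ) + 1) * Real.sin (2 * θ))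

theorem one_sub_avgProb (p : ℝ) (m : ℕ) :
    1 - avgProb p m = failRate (Real.arcsin (Real.sqrt p)) m := by
  unfold avgProb failRate; ring

/-- Telescoping: after halving the square, `2 sin 2θ cos((4j+2)θ) = sin(4(j+1)θ) - sin(4jθ)`. -/
theorem sum_cos_sq_mul_sin (θ : ℝ) (n : ℕ) :
    (∑ j ∈ Finset.range n, Real.cos ((2 * (j : ℝ) + 1) * θ) ^ 2) * (4 * Real.sin (2 * θ)) =
      2 * n * Real.sin (2 * θ) + Real.sin (4 * n * θ) := by
  induction n with
  | zero => simp
  | succ n ih =>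
    rw [Finset.sum_range_succ, add_mul, ih]
    push_cast
    have h1 : Real.cos ((2 * (n : ℝ) + 1) * θ) ^ 2 =
        1 / 2 + Real.cos (4 * n * θ + 2 * θ) / 2 := by
      rw [Real.cos_sq]; ring_nf
    have h2 : Real.sin (4 * (n + 1) * θ) = Real.sin ((4 * n * θ + 2 * θ) + 2 * θ) := by ring_nf
    have h3 : Real.sin (4 * n * θ) = Real.sin ((4 * n * θ + 2 * θ) - 2 * θ) := by ring_nf
    rw [h1, h2, h3, Real.sin_add, Real.sin_sub]
    ring

/-- After `j` amplification steps the failure probability is `cos²((2j+1)θ)`. Writing the closed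
form as a mean makes its range and its dependence on `θ` evident. -/
theorem failRate_eq_mean {θ : ℝ} (h : Real.sin (2 * θ) ≠ 0) (m : ℕ) :
    failRate θ m =
      (∑ j ∈ Finset.range (m + 1), Real.cos ((2 * (j : ℝ) + 1) * θ) ^ 2) / ((m : ℝ) + 1) := by
  have h1 := sum_cos_sq_mul_sin θ (m + 1)
  push_cast at h1
  have hm : (m : ℝ) + 1 ≠ 0 := by positivity
  unfold failRate
  rw [eq_div_iff hm]
  generalize ∑ j ∈ Finset.range (m + 1), Real.cos ((2 * (j : ℝ) + 1) * θ) ^ 2 = S at h1 ⊢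
  field_simp
  linarith

theorem failRate_nonneg {θ : ℝ} (h : Real.sin (2 * θ) ≠ 0) (m : ℕ) : 0 ≤ failRate θ m := by
  rw [failRate_eq_mean h]
  positivity

theorem failRate_le_one {θ : ℝ} (h : Real.sin (2 * θ) ≠ 0) (m : ℕ) : failRate θ m ≤ 1 := by
  rw [failRate_eq_mean h, div_le_one (by positivity)]
  calc _ ≤ ∑ j ∈ Finset.range (m + 1), (1 : ℝ) :=
        Finset.sum_le_sum fun j _ => Real.cos_sq_le_one _
    _ = _ := by simp

theorem failRate_le {θ : ℝ} (h : 0 < Real.sin (2 * θ)) (m : ℕ) :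
    failRate θ m ≤ 1 / 2 + 1 / (4 * ((m : ℝ) + 1) * Real.sin (2 * θ)) := by
  unfold failRate
  gcongr
  exact Real.sin_le_one _

theorem abs_cos_sq_sub_le (a b : ℝ) : |Real.cos a ^ 2 - Real.cos b ^ 2| ≤ |a - b| := by
  have h : Real.cos a ^ 2 - Real.cos b ^ 2 = -(Real.sin (a + b) * Real.sin (a - b)) := by
    rw [Real.sin_add, Real.sin_sub]
    nlinarith [Real.sin_sq_add_cos_sq a, Real.sin_sq_add_cos_sq b]
  rw [h, abs_neg, abs_mul]
  calc _ ≤ 1 * |a - b| := mul_le_mul (Real.abs_sin_le_one _) Real.abs_sin_le_abs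
        (abs_nonneg _) zero_le_one
    _ = _ := one_mul _

theorem sum_odd (n : ℕ) : ∑ j ∈ Finset.range n, (2 * (j : ℝ) + 1) = (n : ℝ) ^ 2 := by
  induction n with
  | zero => simp
  | succ n ih => rw [Finset.sum_range_succ, ih]; push_cast; ring

/-- Each `cos²(nθ)` is `n`-Lipschitz in `θ`, and the first `m + 1` odd numbers have mean `m + 1`.
This is the estimate for short rounds. -/
theorem abs_failRate_sub_le_mul {θ θ' : ℝ} (h : Real.sin (2 * θ) ≠ 0)
    (h' : Real.sin (2 * θ') ≠ 0) (m : ℕ) :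
    |failRate θ' m - failRate θ m| ≤ ((m : ℝ) + 1) * |θ' - θ| := by
  have hm : 0 < (m : ℝ) + 1 := by positivity
  rw [failRate_eq_mean h, failRate_eq_mean h', ← sub_div, abs_div, abs_of_pos hm,
    div_le_iff₀ hm, ← Finset.sum_sub_distrib]
  calc _ ≤ ∑ j ∈ Finset.range (m + 1), (2 * (j : ℝ) + 1) * |θ' - θ| := by
        refine (Finset.abs_sum_le_sum_abs _ _).trans (Finset.sum_le_sum fun j _ => ?_)
        refine (abs_cos_sq_sub_le _ _).trans_eq ?_
        rw [← mul_sub, abs_mul, abs_of_nonneg (by positivity)]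
    _ = _ := by rw [← Finset.sum_mul, sum_odd]; push_cast; ring

theorem abs_sin_nat_mul_le (n : ℕ) (x : ℝ) : |Real.sin (n * x)| ≤ n * |Real.sin x| := by
  induction n with
  | zero => simp
  | succ n ih =>
    push_cast
    rw [add_mul, one_mul, Real.sin_add]
    refine (abs_add_le _ _).trans ?_
    rw [abs_mul, abs_mul]
    have h1 := Real.abs_cos_le_one x
    have h2 := Real.abs_cos_le_one (n * x)
    have h3 := mul_le_mul ih h1 (abs_nonneg _) (by positivity)
    have h4 := mul_le_mul_of_nonneg_right h2 (abs_nonneg (Real.sin x))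
    linarith

theorem abs_sin_sub_sin_le (a b : ℝ) : |Real.sin a - Real.sin b| ≤ |a - b| := by
  rw [Real.sin_sub_sin, abs_mul, abs_mul, abs_two]
  have h1 : |Real.sin ((a - b) / 2)| ≤ |(a - b) / 2| := Real.abs_sin_le_abs
  rw [abs_div, abs_two] at h1
  have h2 := Real.abs_cos_le_one ((a + b) / 2)
  have := mul_le_mul h1 h2 (abs_nonneg _) (by positivity)
  linarith

/-- The estimate for long rounds, uniform in `m`. Numerator and denominator of the closed form are
varied separately, each contributing half of the bound. -/
theorem abs_failRate_sub_le_div {θ θ' : ℝ} (h : 0 < Real.sin (2 * θ))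
    (h' : 0 < Real.sin (2 * θ')) (m : ℕ) :
    |failRate θ' m - failRate θ m| ≤ 2 * |θ' - θ| / Real.sin (2 * θ') := by
  set n : ℝ := (m : ℝ) + 1 with hn
  have hn0 : 0 < n := by positivity
  have e : failRate θ' m - failRate θ m =
      (Real.sin (4 * n * θ') - Real.sin (4 * n * θ)) / (4 * n * Real.sin (2 * θ')) +
      (Real.sin (4 * n * θ) / (4 * n * Real.sin (2 * θ))) *
        ((Real.sin (2 * θ) - Real.sin (2 * θ')) / Real.sin (2 * θ')) := by
    unfold failRate
    rw [← hn]
    field_simp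
    ring
  have a1 : |(Real.sin (4 * n * θ') - Real.sin (4 * n * θ)) / (4 * n * Real.sin (2 * θ'))| ≤
      |θ' - θ| / Real.sin (2 * θ') := by
    rw [abs_div, abs_of_pos (a := 4 * n * Real.sin (2 * θ')) (by positivity),
      div_le_div_iff₀ (by positivity) h']
    have h3 := abs_sin_sub_sin_le (4 * n * θ') (4 * n * θ)
    rw [← mul_sub, abs_mul, abs_of_pos (a := 4 * n) (by positivity)] at h3
    nlinarith
  -- Here `|sin(2n x)| ≤ 2n |sin x|` at `x = 2θ` removes the small denominator.
  have a2 : |Real.sin (4 * n * θ) / (4 * n * Real.sin (2 * θ))| ≤ 1 / 2 := by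
    have h3 := abs_sin_nat_mul_le (2 * (m + 1)) (2 * θ)
    push_cast at h3
    rw [← hn, abs_of_pos h, show 2 * n * (2 * θ) = 4 * n * θ by ring] at h3
    rw [abs_div, abs_of_pos (a := 4 * n * Real.sin (2 * θ)) (by positivity),
      div_le_iff₀ (by positivity)]
    linarith
  have a3 : |(Real.sin (2 * θ) - Real.sin (2 * θ')) / Real.sin (2 * θ')| ≤
      2 * |θ' - θ| / Real.sin (2 * θ') := by
    rw [abs_div, abs_of_pos h']
    gcongr
    have h3 := abs_sin_sub_sin_le (2 * θ) (2 * θ')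
    rwa [← mul_sub, abs_mul, abs_two, abs_sub_comm θ θ'] at h3
  rw [e]
  refine (abs_add_le _ _).trans ?_
  rw [abs_mul]
  have a4 := mul_le_mul a2 a3 (abs_nonneg _) (by norm_num)
  have : 1 / 2 * (2 * |θ' - θ| / Real.sin (2 * θ')) = |θ' - θ| / Real.sin (2 * θ') := by ring
  have : 2 * |θ' - θ| / Real.sin (2 * θ') =
    |θ' - θ| / Real.sin (2 * θ') + |θ' - θ| / Real.sin (2 * θ') := by ring
  linarith

/-! ### Angles of amplitudes bounded away from `1` -/

/-- The constant is a lower bound for `√(1 - 0.81)`. -/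
theorem cos_arcsin_ge {σ : ℝ} (h₀ : 0 ≤ σ) (h : σ ≤ 9 / 10) :
    43 / 100 ≤ Real.cos (Real.arcsin σ) := by
  rw [Real.cos_arcsin]
  apply Real.le_sqrt_of_sq_le
  nlinarith

theorem sin_two_mul_arcsin_ge {σ : ℝ} (h₀ : 0 ≤ σ) (h : σ ≤ 9 / 10) :
    43 / 50 * σ ≤ Real.sin (2 * Real.arcsin σ) := by
  rw [Real.sin_two_mul, Real.sin_arcsin (by linarith) (by linarith)]
  nlinarith [cos_arcsin_ge h₀ h]

/-- By `sin θ' - sin θ = 2 sin((θ'-θ)/2) cos((θ'+θ)/2)`. Jordan's inequality gives the factor `2/π ≥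
6/10`, the cosine is at least `43/100`, and the product exceeds `1/4`. -/
theorem abs_arcsin_sub_le {σ σ' : ℝ} (h₀ : 0 ≤ σ) (h : σ ≤ 9 / 10) (h₀' : 0 ≤ σ')
    (h' : σ' ≤ 9 / 10) : |Real.arcsin σ' - Real.arcsin σ| ≤ 4 * |σ' - σ| := by
  wlog hle : σ ≤ σ' generalizing σ σ'
  · rw [abs_sub_comm, abs_sub_comm σ']
    exact this h₀' h' h₀ h (by linarith)
  have hmono := Real.monotone_arcsin hle
  rw [abs_of_nonneg (by linarith), abs_of_nonneg (by linarith)]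
  set θ := Real.arcsin σ
  set θ' := Real.arcsin σ' with hθ'
  have hθ0 : 0 ≤ θ := Real.arcsin_nonneg.2 h₀
  have hθ2 : θ' ≤ Real.pi / 2 := Real.arcsin_le_pi_div_two _
  have e1 : σ' - σ = Real.sin θ' - Real.sin θ := by
    rw [Real.sin_arcsin (by linarith) (by linarith), Real.sin_arcsin (by linarith) (by linarith)]
  have hc : 43 / 100 ≤ Real.cos ((θ' + θ) / 2) :=
    (cos_arcsin_ge h₀' h').trans (Real.cos_le_cos_of_nonneg_of_le_pi (by linarith)
      (by linarith [Real.pi_pos]) (by linarith))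
  have hs : 2 / Real.pi * ((θ' - θ) / 2) ≤ Real.sin ((θ' - θ) / 2) :=
    Real.mul_le_sin (by linarith) (by linarith)
  have hs' : (θ' - θ) * (6 / 10) ≤ 2 * Real.sin ((θ' - θ) / 2) := by
    have : 6 / 10 ≤ 2 / Real.pi := by
      rw [le_div_iff₀ Real.pi_pos]; linarith [Real.pi_lt_d2]
    nlinarith
  rw [e1, Real.sin_sub_sin]
  nlinarith [mul_le_mul hs' hc (by norm_num) (by linarith)]

/-- Since `43/50 · 3/4 ≥ 5/8`, one bound in terms of `σ₀` serves both the exact and the perturbed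
amplitude. It equals `9/10` when `(m + 1) σ₀ = 1`. -/
theorem failRate_arcsin_le {σ σ₀ : ℝ} (h₀ : 0 < σ₀) (hσ : 3 / 4 * σ₀ ≤ σ) (h : σ ≤ 9 / 10) (m : ℕ) :
    failRate (Real.arcsin σ) m ≤ 1 / 2 + 2 / (5 * (((m : ℝ) + 1) * σ₀)) := by
  have h1 := sin_two_mul_arcsin_ge (by linarith) h
  have h2 : 5 / 8 * σ₀ ≤ Real.sin (2 * Real.arcsin σ) := by linarith
  refine (failRate_le (by linarith) m).trans ?_
  have : 2 / (5 * (((m : ℝ) + 1) * σ₀)) = 1 / (4 * ((m : ℝ) + 1) * (5 / 8 * σ₀)) := by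
    field_simp; norm_num
  rw [this]
  gcongr

theorem mSeq_le {c α : ℝ} (hc : 0 ≤ c) (hα : 0 ≤ α) (k : ℕ) :
    (mSeq c (1 / α ^ 2) k : ℝ) ≤ min (c ^ k) α := by
  unfold mSeq
  rw [one_div_one_div, Real.sqrt_sq hα]
  exact Nat.floor_le (le_min (by positivity) hα)

theorem lt_mSeq_add_one {c α : ℝ} (hα : 0 ≤ α) (k : ℕ) :
    min (c ^ k) α < (mSeq c (1 / α ^ 2) k : ℝ) + 1 := by
  unfold mSeq
  rw [one_div_one_div, Real.sqrt_sq hα]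
  exact Nat.lt_floor_add_one _

theorem one_le_mSeq {c α : ℝ} (hc : 1 ≤ c) (hα : 1 ≤ α) (k : ℕ) : 1 ≤ mSeq c (1 / α ^ 2) k := by
  unfold mSeq
  rw [one_div_one_div, Real.sqrt_sq (by linarith)]
  exact Nat.le_floor (by simpa using ⟨one_le_pow₀ hc, hα⟩)

/-- Rounds with many iterations fail with probability at most `9 / 10`, and with a probability below
`1 / c` if the number of iterations still grows. -/
theorem potential_late {c α σ P : ℝ} {r : ℕ → ℝ} (hc₁ : 1 < c) (hc₂ : c < 2) (hα : 1 ≤ α)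
    (hσ₀ : 0 < σ) (hσ : 1 ≤ α * σ) (hP : P = 10 / (2 - c))
    (hr : ∀ k, r k ≤ 1 / 2 + 2 / (5 * (((mSeq c (1 / α ^ 2) (k + 1) : ℝ) + 1) * σ))) (k : ℕ)
    (hk : min (4 / (2 - c) / σ) α < c ^ (k + 1)) :
    min (c ^ (k + 1)) α + r k * (P * min (c ^ (k + 2)) α) ≤ P * min (c ^ (k + 1)) α := by
  have h2c : 0 < 2 - c := by linarith
  have hP0 : 0 < P := by rw [hP]; positivity
  have hn := lt_mSeq_add_one (c := c) (zero_le_one.trans hα) (k + 1)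
  specialize hr k
  set n : ℝ := (mSeq c (1 / α ^ 2) (k + 1) : ℝ) + 1
  set x := min (c ^ (k + 1)) α
  have hsucc : c ^ (k + 2) = c * c ^ (k + 1) := by ring
  have hx0 : 0 < x := lt_min (by positivity) (by linarith)
  have hn0 : 0 < n := hx0.trans hn
  -- If the cap `α` comes first, the number of iterations no longer grows, and a failure rate of
  -- `9/10` is paid for by `P ≥ 10`.
  rcases le_total α (4 / (2 - c) / σ) with hX | hX
  · rw [min_eq_right hX] at hk
    have hxα : x = α := min_eq_right hk.le
    have hnσ : 1 ≤ n * σ := hσ.trans (by gcongr; exact hxα ▸ hn.le)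
    have h1 : r k ≤ 9 / 10 := by
      refine hr.trans ?_
      have : 2 / (5 * (n * σ)) ≤ 2 / (5 * 1) := by gcongr
      linarith
    have h2 : P * min (c ^ (k + 2)) α ≤ P * x := by
      rw [hxα]; gcongr; exact min_le_right _ _
    have h3 : 10 ≤ P := by rw [hP, le_div_iff₀ h2c]; linarith
    have h4 : 0 ≤ P * min (c ^ (k + 2)) α :=
      mul_nonneg hP0.le (le_min (by positivity) (by linarith))
    nlinarith [mul_le_mul_of_nonneg_right h1 h4]
  · rw [min_eq_left hX] at hk
    have hxX : 4 / (2 - c) / σ ≤ x := le_min hk.le hX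
    have hnσ : 4 / (2 - c) ≤ n * σ := by
      rw [← div_le_iff₀ hσ₀]; linarith
    -- If the iterations still grow by the factor `c`, then `c * r k ≤ (c + 2) / 4 = 1 - (2 - c) /
    -- 4`, and the gain `P (2 - c) / 4 = 10 / 4` covers the cost of the round.
    have h1 : r k ≤ (c + 2) / (4 * c) := by
      refine hr.trans ?_
      have h3 : 2 / (5 * (n * σ)) ≤ 2 / (5 * (4 / (2 - c))) := by gcongr
      have h4 : 2 / (5 * (4 / (2 - c))) = (2 - c) / 10 := by field_simp; norm_num
      have h5 : 1 / 2 + (2 - c) / 10 ≤ (c + 2) / (4 * c) := by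
        rw [le_div_iff₀ (by positivity)]; nlinarith
      linarith
    have h2 : P * min (c ^ (k + 2)) α ≤ P * (c * x) := by
      gcongr
      rw [hsucc, mul_min_of_nonneg _ _ (by linarith)]
      exact min_le_min le_rfl (le_mul_of_one_le_left (by linarith) hc₁.le)
    have h4 : 0 ≤ P * min (c ^ (k + 2)) α :=
      mul_nonneg hP0.le (le_min (by positivity) (by linarith))
    have h5 : r k * (P * min (c ^ (k + 2)) α) ≤ (c + 2) / (4 * c) * (P * (c * x)) :=
      mul_le_mul h1 h2 h4 (by positivity)
    have h6 : (c + 2) / (4 * c) * (P * (c * x)) = P * x - 10 / 4 * x := by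
      rw [hP]; field_simp; ring
    linarith

theorem nQAATerm_eq (c p α : ℝ) (k : ℕ) :
    nQAATerm c p (1 / α ^ 2) k = (mSeq c (1 / α ^ 2) (k + 1) : ℝ) *
      ∏ l ∈ Finset.range k,
        failRate (Real.arcsin (Real.sqrt p)) (mSeq c (1 / α ^ 2) (l + 1)) := by
  simp only [nQAATerm, one_sub_avgProb]

/-- The overhead of amplitude amplification depends on the amplitude in a relatively Lipschitz way. -/
theorem nQAA_perturbation (c : ℝ) (hc₁ : 1 < c) (hc₂ : c < 2) :
    ∃ C : ℝ, 0 ≤ C ∧ ∀ α σ σ' ε : ℝ, 1 ≤ α → 0 < ε → ε < 1 / 2 → 1 ≤ α * σ → σ ≤ 9 / 10 →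
      σ' ≤ 9 / 10 → |σ' - σ| ≤ ε / 2 / α →
      Summable (nQAATerm c (σ' ^ 2) (1 / α ^ 2)) ∧ Summable (nQAATerm c (σ ^ 2) (1 / α ^ 2)) ∧
      |nQAA c (σ' ^ 2) (1 / α ^ 2) - nQAA c (σ ^ 2) (1 / α ^ 2)| ≤
        C * ε * nQAA c (σ ^ 2) (1 / α ^ 2) := by
  have h2c : 0 < 2 - c := by linarith
  have h1c : 0 < c - 1 := by linarith
  set P : ℝ := 10 / (2 - c) with hP
  set K : ℝ := 4 / (2 - c) with hK
  set C₁ : ℝ := (P * c + c / (c - 1)) * K with hC₁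
  have hK1 : 1 ≤ K := by rw [hK, le_div_iff₀ h2c]; linarith
  have hP0 : 0 < P := by positivity
  have hC₁0 : 0 < C₁ := by positivity
  refine ⟨28 * C₁, by positivity, ?_⟩
  intro α σ σ' ε hα hε hε2 hασ hσ9 hσ9' hσσ'
  have hα0 : 0 < α := by linarith
  have hσ0 : 0 < σ := pos_of_mul_pos_right (by linarith : 0 < α * σ) hα0.le
  -- The lower bound `1 ≤ α * σ` turns the absolute error into a relative one.
  have hdiff : |σ' - σ| ≤ ε / 2 * σ := hσσ'.trans (by
    rw [div_le_iff₀ hα0]; nlinarith)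
  have hσ' : 3 / 4 * σ ≤ σ' := by
    have := (abs_le.1 hdiff).1
    nlinarith
  have hσ0' : 0 < σ' := by linarith
  set θ := Real.arcsin σ with hθ
  set θ' := Real.arcsin σ' with hθ'
  have hsin : 0 < Real.sin (2 * θ) := by linarith [sin_two_mul_arcsin_ge hσ0.le hσ9]
  have hsin2 : 5 / 8 * σ ≤ Real.sin (2 * θ') := by
    linarith [sin_two_mul_arcsin_ge hσ0'.le hσ9']
  have hsin' : 0 < Real.sin (2 * θ') := by linarith
  have hθθ' : |θ' - θ| ≤ 2 * ε * σ := by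
    linarith [abs_arcsin_sub_le hσ0.le hσ9 hσ0'.le hσ9']
  set m : ℕ → ℕ := fun k => mSeq c (1 / α ^ 2) (k + 1) with hm
  set r : ℕ → ℝ := fun k => failRate θ (m k) with hr
  set r' : ℕ → ℝ := fun k => failRate θ' (m k) with hr'
  have hT : nQAATerm c (σ ^ 2) (1 / α ^ 2) =
      fun k => (m k : ℝ) * ∏ l ∈ Finset.range k, r l := by
    funext k; rw [nQAATerm_eq, Real.sqrt_sq hσ0.le]
  have hT' : nQAATerm c (σ' ^ 2) (1 / α ^ 2) =
      fun k => (m k : ℝ) * ∏ l ∈ Finset.range k, r' l := by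
    funext k; rw [nQAATerm_eq, Real.sqrt_sq hσ0'.le]
  set Φ : ℕ → ℝ := potential c α (min (K / σ) α) P with hΦdef
  have hY0 : 0 ≤ min (K / σ) α := le_min (by positivity) hα0.le
  have hΦ0 : ∀ k, 0 ≤ Φ k := potential_nonneg hc₁ hα hP0.le hY0
  -- One potential, built from `σ` alone, is a supersolution for both sequences of failure rates.
  have hΦ : ∀ q : ℕ → ℝ, (∀ k, 0 ≤ q k) → (∀ k, q k ≤ 1) →
      (∀ k, q k ≤ 1 / 2 + 2 / (5 * (((m k : ℝ) + 1) * σ))) →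
      ∀ k, (m k : ℝ) + q k * Φ (k + 1) ≤ Φ k := by
    intro q hq0 hq1 hq k
    refine le_trans (add_le_add (mSeq_le (by linarith) hα0.le (k + 1)) le_rfl) ?_
    exact potential_step hc₁ hP0.le hα0.le (min_le_right _ _) hY0 hq1
      (potential_late hc₁ hc₂ hα hσ0 hασ hP hq) k
  have hr0 : ∀ k, 0 ≤ r k := fun k => failRate_nonneg hsin.ne' _
  have hr0' : ∀ k, 0 ≤ r' k := fun k => failRate_nonneg hsin'.ne' _
  have hΦr := hΦ r hr0 (fun k => failRate_le_one hsin.ne' _)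
    fun k => failRate_arcsin_le hσ0 (by linarith) hσ9 _
  have hΦr' := hΦ r' hr0' (fun k => failRate_le_one hsin'.ne' _)
    fun k => failRate_arcsin_le hσ0 hσ' hσ9' _
  have hm0 : ∀ k, (0 : ℝ) ≤ m k := fun k => by positivity
  -- The short-round estimate gives the constant `2`, the long-round estimate `4 / (5/8) = 32/5`;
  -- both are below `7`.
  have he : ∀ k, |r' k - r k| ≤ 7 * ε * min (((m k : ℝ) + 1) * σ) 1 := by
    intro k
    rw [mul_min_of_nonneg _ _ (by positivity)]
    refine le_min ?_ ?_
    · refine (abs_failRate_sub_le_mul hsin.ne' hsin'.ne' _).trans ?_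
      have : 0 ≤ ((m k : ℝ) + 1) := by positivity
      calc ((m k : ℝ) + 1) * |θ' - θ| ≤ ((m k : ℝ) + 1) * (2 * ε * σ) := by gcongr
        _ = 2 * ε * (((m k : ℝ) + 1) * σ) := by ring
        _ ≤ _ := by gcongr; norm_num
    · refine (abs_failRate_sub_le_div hsin hsin' _).trans ?_
      rw [div_le_iff₀ hsin']
      nlinarith [mul_le_mul_of_nonneg_left hsin2 hε.le]
  have heΦ : ∀ k, 7 * ε * min (((m k : ℝ) + 1) * σ) 1 * Φ (k + 1) ≤ 28 * C₁ * ε * m k := by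
    intro k
    have hm1 : (1 : ℝ) ≤ m k := by exact_mod_cast one_le_mSeq hc₁.le hα (k + 1)
    set n : ℝ := (m k : ℝ) + 1 with hn
    have hx : min (c ^ (k + 1 + 1)) α ≤ 2 * n := by
      have h1 := lt_mSeq_add_one (c := c) hα0.le (k + 1)
      have h2 : min (c ^ (k + 1 + 1)) α ≤ c * min (c ^ (k + 1)) α := by
        rw [mul_min_of_nonneg _ _ (by linarith), pow_succ' c (k + 1)]
        exact min_le_min le_rfl (le_mul_of_one_le_left (by linarith) hc₁.le)
      have h3 : 0 ≤ min (c ^ (k + 1)) α := le_min (by positivity) hα0.le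
      change min (c ^ (k + 1)) α < n at h1
      nlinarith
    have h1 : Φ (k + 1) ≤ C₁ * max (2 * n) (1 / σ) := by
      refine (potential_le hc₁ hP0.le hα0.le (k + 1)).trans ?_
      rw [hC₁, mul_assoc _ K]
      gcongr
      rw [mul_max_of_nonneg _ _ (by linarith)]
      refine max_le_max (hx.trans ?_) (by rw [mul_one_div])
      exact le_mul_of_one_le_left (by linarith) hK1
    -- The two bounds switch at lengths of the order `1 / σ`, so the product never exceeds a
    -- multiple of `n`. With `n ≤ 2 * m k` the constant becomes `7 · 2 · 2 = 28`.
    have h2 : min (n * σ) 1 * max (2 * n) (1 / σ) ≤ 2 * n := by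
      rcases le_total (2 * n) (1 / σ) with h | h
      · rw [max_eq_right h]
        calc _ ≤ n * σ * (1 / σ) := by gcongr; exact min_le_left _ _
          _ = n := by field_simp
          _ ≤ _ := by linarith
      · rw [max_eq_left h]
        exact mul_le_of_le_one_left (by linarith) (min_le_right _ _)
    calc 7 * ε * min (n * σ) 1 * Φ (k + 1)
        ≤ 7 * ε * min (n * σ) 1 * (C₁ * max (2 * n) (1 / σ)) := by
          gcongr
      _ = 7 * ε * C₁ * (min (n * σ) 1 * max (2 * n) (1 / σ)) := by ring
      _ ≤ 7 * ε * C₁ * (2 * n) := by gcongr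
      _ ≤ 7 * ε * C₁ * (2 * (2 * m k)) := by gcongr; linarith
      _ = _ := by ring
  refine ⟨?_, ?_, ?_⟩
  · rw [hT']; exact summable_mul_prod _ r' Φ hm0 hr0' hΦ0 hΦr'
  · rw [hT]; exact summable_mul_prod _ r Φ hm0 hr0 hΦ0 hΦr
  · unfold nQAA
    rw [hT, hT']
    exact abs_tsum_mul_prod_sub_le _ r r' _ Φ Φ _ hm0 hr0 hr0' he hΦ0 hΦr' hΦ0 hΦr heΦ
      (by positivity)

/-! ### Tails of the binomial distribution -/

theorem binomTail_nonneg (s j : ℕ) : 0 ≤ binomTail s j :=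
  Finset.sum_nonneg fun _ _ => by positivity

theorem binomTail_eq_zero {s j : ℕ} (h : s ≤ j) : binomTail s j = 0 := by
  rw [binomTail, Finset.Icc_eq_empty (by omega), Finset.sum_empty]

theorem binomTail_eq_add {s j : ℕ} (h : j < s) :
    binomTail s j = ((2 * s).choose (s + (j + 1)) : ℝ) + binomTail s (j + 1) := by
  rw [binomTail, binomTail, ← Finset.sum_Ioc_add_eq_sum_Icc (by omega : j + 1 ≤ s), add_comm]
  congr 1
  exact Finset.sum_congr (by ext; simp) fun _ _ => rfl

theorem sum_choose_reflect (s : ℕ) (f : ℕ → ℝ) :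
    ∑ k ∈ Finset.range s, ((2 * s).choose k : ℝ) * f k =
      ∑ i ∈ Finset.Icc 1 s, ((2 * s).choose (s + i) : ℝ) * f (s - i) := by
  refine Finset.sum_bij' (fun k _ => s - k) (fun i _ => s - i) ?_ ?_ ?_ ?_ ?_
  · intro k hk; simp only [Finset.mem_range, Finset.mem_Icc] at *; omega
  · intro k hk; simp only [Finset.mem_range, Finset.mem_Icc] at *; omega
  · intro k hk; simp only [Finset.mem_range] at *; omega
  · intro k hk; simp only [Finset.mem_Icc] at *; omega
  · intro k hk
    simp only [Finset.mem_range] at hk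
    rw [show s - (s - k) = k by omega, ← Nat.choose_symm (by omega : s + (s - k) ≤ 2 * s)]
    congr 3
    omega

theorem sum_choose_upper (s : ℕ) (f : ℕ → ℝ) :
    ∑ k ∈ Finset.Icc (s + 1) (2 * s), ((2 * s).choose k : ℝ) * f k =
      ∑ i ∈ Finset.Icc 1 s, ((2 * s).choose (s + i) : ℝ) * f (s + i) := by
  refine Finset.sum_bij' (fun k _ => k - s) (fun i _ => s + i) ?_ ?_ ?_ ?_ ?_
  · intro k hk; simp only [Finset.mem_Icc] at *; omega
  · intro k hk; simp only [Finset.mem_Icc] at *; omega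
  · intro k hk; simp only [Finset.mem_Icc] at *; omega
  · intro k hk; simp only [Finset.mem_Icc] at *; omega
  · intro k hk
    simp only [Finset.mem_Icc] at hk
    rw [show s + (k - s) = k by omega]

/-- Pairing `s - i` with `s + i` by the symmetry of the binomial coefficients serves the total mass,
the exponential moment and the expansion of `sin^{2s}` alike. -/
theorem sum_range_choose_split (s : ℕ) (f : ℕ → ℝ) :
    ∑ k ∈ Finset.range (2 * s + 1), ((2 * s).choose k : ℝ) * f k =
      ((2 * s).choose s : ℝ) * f s +
        ∑ i ∈ Finset.Icc 1 s, ((2 * s).choose (s + i) : ℝ) * (f (s - i) + f (s + i)) := by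
  simp only [mul_add, Finset.sum_add_distrib]
  rw [← sum_choose_reflect, ← sum_choose_upper,
    ← Finset.sum_range_add_sum_Ico _ (by omega : s ≤ 2 * s + 1),
    Finset.sum_eq_sum_Ico_succ_bot (by omega)]
  have : Finset.Ico (s + 1) (2 * s + 1) = Finset.Icc (s + 1) (2 * s) := by ext; simp
  rw [this]
  ring

theorem two_mul_binomTail_zero (s : ℕ) :
    2 * binomTail s 0 = 4 ^ s - ((2 * s).choose s : ℝ) := by
  have h := sum_range_choose_split s fun _ => 1
  simp only [mul_one] at h
  rw [← Nat.cast_sum, Nat.sum_range_choose, pow_mul] at h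
  rw [← Finset.sum_mul] at h
  push_cast at h
  rw [binomTail]
  norm_num at h ⊢
  linarith

/-- Chernoff's bound: the exponential moment is `(e^l + e^{-l})^{2s} ≤ 4^s e^{s l²}` by `cosh l ≤
e^{l²/2}`, and `l = (j + 1)/s` minimizes `s l² - 2 l (j + 1)`. -/
theorem binomTail_le (s j : ℕ) (hs : 0 < s) :
    binomTail s j / 2 ^ (2 * s) ≤ Real.exp (-((j : ℝ) + 1) ^ 2 / s) := by
  have hs' : (0 : ℝ) < s := by exact_mod_cast hs
  set l : ℝ := ((j : ℝ) + 1) / s with hl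
  have hl0 : 0 ≤ l := by positivity
  have h1 : binomTail s j * Real.exp (2 * l * (j + 1)) ≤
      (Real.exp l + Real.exp (-l)) ^ (2 * s) := by
    have hb := add_pow (Real.exp l) (Real.exp (-l)) (2 * s)
    have h2 : ∀ k ∈ Finset.range (2 * s + 1),
        Real.exp l ^ k * Real.exp (-l) ^ (2 * s - k) * ((2 * s).choose k : ℝ) =
        ((2 * s).choose k : ℝ) * Real.exp (2 * l * ((k : ℝ) - s)) := by
      intro k hk
      rw [← Real.exp_nat_mul, ← Real.exp_nat_mul, ← Real.exp_add, mul_comm]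
      congr 2
      rw [Nat.cast_sub (by simp at hk; omega)]
      push_cast; ring
    rw [Finset.sum_congr rfl h2, sum_range_choose_split] at hb
    rw [hb, binomTail, Finset.sum_mul]
    have h3 : ∑ i ∈ Finset.Icc (j + 1) s,
        ((2 * s).choose (s + i) : ℝ) * Real.exp (2 * l * (j + 1)) ≤
        ∑ i ∈ Finset.Icc (j + 1) s,
        ((2 * s).choose (s + i) : ℝ) * (Real.exp (2 * l * (((s - i : ℕ) : ℝ) - s)) +
          Real.exp (2 * l * (((s + i : ℕ) : ℝ) - s))) := by
      refine Finset.sum_le_sum fun i hi => ?_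
      have hi' : ((j : ℝ) + 1) ≤ i := by
        have := (Finset.mem_Icc.1 hi).1
        exact_mod_cast this
      have h4 : Real.exp (2 * l * (j + 1)) ≤ Real.exp (2 * l * (((s + i : ℕ) : ℝ) - s)) := by
        rw [Real.exp_le_exp]
        push_cast
        nlinarith
      have h5 := Real.exp_pos (2 * l * (((s - i : ℕ) : ℝ) - s))
      gcongr
      linarith
    refine h3.trans ?_
    have h6 : ∑ i ∈ Finset.Icc (j + 1) s,
        ((2 * s).choose (s + i) : ℝ) * (Real.exp (2 * l * (((s - i : ℕ) : ℝ) - s)) +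
          Real.exp (2 * l * (((s + i : ℕ) : ℝ) - s))) ≤ ∑ i ∈ Finset.Icc 1 s,
        ((2 * s).choose (s + i) : ℝ) * (Real.exp (2 * l * (((s - i : ℕ) : ℝ) - s)) +
          Real.exp (2 * l * (((s + i : ℕ) : ℝ) - s))) :=
      Finset.sum_le_sum_of_subset_of_nonneg (Finset.Icc_subset_Icc_left (by omega))
        fun _ _ _ => by positivity
    refine h6.trans (le_add_of_nonneg_left (by positivity))
  have h2 : (Real.exp l + Real.exp (-l)) ^ (2 * s) ≤ 2 ^ (2 * s) * Real.exp (s * l ^ 2) := by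
    have h3 : Real.exp l + Real.exp (-l) ≤ 2 * Real.exp (l ^ 2 / 2) := by
      have := Real.cosh_le_exp_half_sq l
      rw [Real.cosh_eq] at this
      linarith
    calc _ ≤ (2 * Real.exp (l ^ 2 / 2)) ^ (2 * s) := by gcongr
      _ = _ := by
        rw [mul_pow, ← Real.exp_nat_mul]; congr 2; push_cast; ring
  have h3 : Real.exp (-((j : ℝ) + 1) ^ 2 / s) * Real.exp (2 * l * (j + 1)) =
      Real.exp (s * l ^ 2) := by
    rw [← Real.exp_add]; congr 1; rw [hl]; field_simp; ring
  rw [div_le_iff₀ (by positivity)]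
  refine le_of_mul_le_mul_right ?_ (Real.exp_pos (2 * l * (j + 1)))
  calc _ ≤ _ := h1.trans h2
    _ = _ := by rw [← h3]; ring

theorem mul_choose_eq {s i : ℕ} (hs : 0 < s) (hi : 0 < i) :
    (i : ℝ) * ((2 * s).choose (s + i) : ℝ) =
      s * (((2 * s - 1).choose (s + i - 1) : ℝ) - ((2 * s - 1).choose (s + i) : ℝ)) := by
  obtain ⟨n, hn⟩ : ∃ n, 2 * s = n + 1 := ⟨2 * s - 1, by omega⟩
  obtain ⟨k, hk⟩ : ∃ k, s + i = k + 1 := ⟨s + i - 1, by omega⟩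
  have h1 := Nat.add_one_mul_choose_eq n k
  have h2 := Nat.choose_succ_succ n k
  simp only [Nat.succ_eq_add_one] at h1 h2
  rw [hn, hk, Nat.add_sub_cancel, Nat.add_sub_cancel]
  have e1 : ((n : ℝ) + 1) * (n.choose k : ℝ) = ((n + 1).choose (k + 1) : ℝ) * (k + 1) := by
    exact_mod_cast h1
  have e2 : ((n + 1).choose (k + 1) : ℝ) = n.choose k + n.choose (k + 1) := by exact_mod_cast h2
  have e3 : 2 * (s : ℝ) = n + 1 := by exact_mod_cast hn
  have e4 : (s : ℝ) + i = k + 1 := by exact_mod_cast hk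
  have e5 : (i : ℝ) = k + 1 - s := by linarith
  have e6 : (n.choose (k + 1) : ℝ) = (n + 1).choose (k + 1) - n.choose k := by linarith
  rw [e6, e5]
  linear_combination -e1 - (n.choose k : ℝ) * e3

/-- Interchanging the sums gives the first absolute moment `Σ i C(2s, s+i)`, which telescopes by
`mul_choose_eq`. In the induction, `n * binomTail s n` is the boundary term of the summation by
parts. -/
theorem sum_binomTail (s : ℕ) (hs : 0 < s) :
    ∑ j ∈ Finset.range s, binomTail s j = s / 2 * ((2 * s).choose s : ℝ) := by
  have h1 : ∀ n ≤ s, ∑ j ∈ Finset.range n, binomTail s j =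
      s * (((2 * s - 1).choose s : ℝ) - ((2 * s - 1).choose (s + n) : ℝ)) +
        n * binomTail s n := by
    intro n
    induction n with
    | zero => intro _; simp
    | succ n ih =>
      intro hn
      have h2 := mul_choose_eq hs (Nat.succ_pos n)
      rw [Finset.sum_range_succ, ih (by omega), binomTail_eq_add (by omega : n < s)]
      rw [show s + n.succ - 1 = s + n by omega] at h2
      push_cast at h2 ⊢
      linear_combination h2
  rw [h1 s le_rfl, binomTail_eq_zero le_rfl, Nat.choose_eq_zero_of_lt (by omega : 2 * s - 1 < s + s)]
  have h3 := Nat.choose_succ_succ (2 * s - 1) (s - 1)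
  rw [show (2 * s - 1).succ = 2 * s by omega, show (s - 1).succ = s by omega] at h3
  have h4 : (2 * s - 1).choose (s - 1) = (2 * s - 1).choose s := by
    rw [← Nat.choose_symm (by omega : s ≤ 2 * s - 1)]
    congr 1; omega
  rw [h3, h4]
  push_cast; ring

/-- The quotient `s C(2s,s)² / 16^s` increases with `s` and is `72/256 = 0.28125` at `s = 2`. -/
theorem central_choose_ge (s : ℕ) (hs : 2 ≤ s) :
    (28125 / 100000 : ℝ) * 16 ^ s ≤ s * ((2 * s).choose s : ℝ) ^ 2 := by
  induction s, hs using Nat.le_induction with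
  | base => norm_num [Nat.choose]
  | succ s hs ih =>
    have h := Nat.succ_mul_centralBinom_succ s
    rw [Nat.centralBinom_eq_two_mul_choose, Nat.centralBinom_eq_two_mul_choose] at h
    have h' : ((s : ℝ) + 1) * ((2 * (s + 1)).choose (s + 1) : ℝ) =
        2 * (2 * s + 1) * ((2 * s).choose s : ℝ) := by exact_mod_cast h
    have hs0 : (0 : ℝ) < s := by exact_mod_cast (by omega : 0 < s)
    set b : ℝ := ((2 * s).choose s : ℝ)
    set b' : ℝ := ((2 * (s + 1)).choose (s + 1) : ℝ)
    have hb' : b' = 2 * (2 * s + 1) * b / (s + 1) := by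
      rw [eq_div_iff (by positivity)]; linarith
    push_cast
    rw [hb', pow_succ]
    have e : ((s : ℝ) + 1) * (2 * (2 * s + 1) * b / (s + 1)) ^ 2 =
        16 * (s * b ^ 2) + 4 * b ^ 2 / (s + 1) := by
      field_simp; ring
    rw [e]
    have : 0 ≤ 4 * b ^ 2 / ((s : ℝ) + 1) := by positivity
    linarith

/-- This is `d α` before truncation. The constant comes from `2 √0.28125 > 1.06`. -/
theorem four_mul_sum_binomTail_ge (s : ℕ) (hs : 2 ≤ s) :
    106 / 100 * Real.sqrt s ≤
      4 * ∑ j ∈ Finset.range s, binomTail s j / 2 ^ (2 * s) := by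
  rw [← Finset.sum_div, sum_binomTail s (by omega)]
  have h := central_choose_ge s hs
  have hs0 : (0 : ℝ) < s := by exact_mod_cast (by omega : 0 < s)
  set b : ℝ := ((2 * s).choose s : ℝ)
  have h2 : (2 : ℝ) ^ (2 * s) = 4 ^ s := by rw [pow_mul]; norm_num
  have h3 : (16 : ℝ) ^ s = (4 ^ s) ^ 2 := by rw [← pow_mul, mul_comm, pow_mul]; norm_num
  rw [h2]
  rw [h3] at h
  set q : ℝ := 4 ^ s
  have hq : 0 < q := by positivity
  have hb : 0 ≤ b := by positivity
  set t := Real.sqrt s with ht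
  have ht0 : 0 < t := Real.sqrt_pos.2 hs0
  have hts : (s : ℝ) = t ^ 2 := (Real.sq_sqrt hs0.le).symm
  rw [hts] at h ⊢
  have h4 : 53 / 100 * q ≤ t * b := by
    refine le_of_sq_le_sq ?_ (by positivity)
    nlinarith [sq_nonneg q]
  rw [show 4 * (t ^ 2 / 2 * b / q) = 2 * t * (t * b) / q by ring, le_div_iff₀ hq]
  nlinarith

/-! ### The Chebyshev expansion of `(1 - (1 - x²)^s) / x` -/

/-- The real part of the binomial expansion of `(e^{iθ} - e^{-iθ})^{2s} = (2i sin θ)^{2s}`, with the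
terms `s ± i` combined; the common sign `(-1)^s` is cancelled at the end. -/
theorem sin_pow_expansion (s : ℕ) (θ : ℝ) :
    4 ^ s * Real.sin θ ^ (2 * s) = ((2 * s).choose s : ℝ) +
      2 * ∑ i ∈ Finset.Icc 1 s, (-1 : ℝ) ^ i * ((2 * s).choose (s + i) : ℝ) *
        Real.cos (2 * i * θ) := by
  have hsin : (2 * (Real.sin θ : ℂ)) * Complex.I =
      Complex.exp (θ * Complex.I) - Complex.exp (-θ * Complex.I) := by
    rw [Complex.ofReal_sin, Complex.sin]
    linear_combination (Complex.exp (-θ * Complex.I) - Complex.exp (θ * Complex.I)) *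
      Complex.I_mul_I
  have h1 : ((2 * (Real.sin θ : ℂ)) * Complex.I) ^ (2 * s) =
      (((-1) ^ s * (4 ^ s * Real.sin θ ^ (2 * s)) : ℝ) : ℂ) := by
    rw [mul_pow, mul_pow, pow_mul Complex.I, Complex.I_sq, pow_mul (2 : ℂ)]
    push_cast; norm_num; ring
  have h2 := add_pow (Complex.exp (θ * Complex.I)) (-Complex.exp (-θ * Complex.I)) (2 * s)
  rw [← sub_eq_add_neg, ← hsin, h1] at h2
  have h3 := congrArg Complex.re h2
  rw [Complex.ofReal_re, Complex.re_sum] at h3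
  have h4 : ∀ k ∈ Finset.range (2 * s + 1),
      (Complex.exp (θ * Complex.I) ^ k * (-Complex.exp (-θ * Complex.I)) ^ (2 * s - k) *
        ((2 * s).choose k : ℂ)).re =
      ((2 * s).choose k : ℝ) * ((-1) ^ k * Real.cos (2 * ((k : ℝ) - s) * θ)) := by
    intro k hk
    have hk' : k ≤ 2 * s := by simp at hk; omega
    have h5 : Complex.exp (θ * Complex.I) ^ k * (-Complex.exp (-θ * Complex.I)) ^ (2 * s - k) =
        (((-1) ^ k : ℝ) : ℂ) * Complex.exp (((2 * ((k : ℝ) - s) * θ : ℝ) : ℂ) * Complex.I) := by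
      have h6 : (-1 : ℂ) ^ (2 * s - k) = (-1) ^ k := by
        rcases Nat.even_or_odd k with h | h
        · rw [h.neg_one_pow, Even.neg_one_pow]
          obtain ⟨t, rfl⟩ := h; exact ⟨s - t, by omega⟩
        · rw [h.neg_one_pow, Odd.neg_one_pow]
          obtain ⟨t, rfl⟩ := h; exact ⟨s - t - 1, by omega⟩
      rw [neg_pow, h6, ← Complex.exp_nat_mul, ← Complex.exp_nat_mul, mul_left_comm,
        ← Complex.exp_add]
      push_cast [Nat.cast_sub hk']
      congr 2
      ring
    rw [h5, ← Complex.ofReal_natCast, Complex.re_mul_ofReal, Complex.re_ofReal_mul,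
      Complex.exp_ofReal_mul_I_re]
    ring
  rw [Finset.sum_congr rfl h4, sum_range_choose_split] at h3
  have h7 : ∀ i ∈ Finset.Icc 1 s, ((2 * s).choose (s + i) : ℝ) *
      ((-1) ^ (s - i) * Real.cos (2 * (((s - i : ℕ) : ℝ) - s) * θ) +
        (-1) ^ (s + i) * Real.cos (2 * (((s + i : ℕ) : ℝ) - s) * θ)) =
      (-1) ^ s * (2 * ((-1 : ℝ) ^ i * ((2 * s).choose (s + i) : ℝ) *
        Real.cos (2 * i * θ))) := by
    intro i hi
    have hi' : i ≤ s := (Finset.mem_Icc.1 hi).2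
    have h8 : (-1 : ℝ) ^ (s - i) = (-1) ^ (s + i) := by
      rw [show s + i = (s - i) + 2 * i by omega, pow_add, pow_mul]; norm_num
    have h9 : Real.cos (2 * (((s - i : ℕ) : ℝ) - s) * θ) = Real.cos (2 * i * θ) := by
      rw [Nat.cast_sub hi', ← Real.cos_neg]; ring_nf
    have h10 : Real.cos (2 * (((s + i : ℕ) : ℝ) - s) * θ) = Real.cos (2 * i * θ) := by
      push_cast; ring_nf
    rw [h8, h9, h10, pow_add]; ring
  rw [Finset.sum_congr rfl h7, ← Finset.mul_sum, ← Finset.mul_sum] at h3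
  have h11 : ((-1 : ℝ) ^ s) * (-1) ^ s = 1 := by rw [← mul_pow]; norm_num
  simp only [sub_self, mul_zero, zero_mul, Real.cos_zero, mul_one] at h3
  linear_combination (-1 : ℝ) ^ s * h3 + (((2 * s).choose s : ℝ) +
      2 * ∑ i ∈ Finset.Icc 1 s, (-1 : ℝ) ^ i * ((2 * s).choose (s + i) : ℝ) *
        Real.cos (2 * i * θ) - 4 ^ s * Real.sin θ ^ (2 * s)) * h11

/-- Summation by parts: `2 cos θ cos((2j+1)θ) = cos 2jθ + cos((2j+2)θ)`, and consecutive tails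
differ by one binomial coefficient. The boundary term vanishes at `n = s`. -/
theorem cos_mul_partial_sum (s : ℕ) (θ : ℝ) (n : ℕ) (hn : n ≤ s) :
    Real.cos θ * (4 * ∑ j ∈ Finset.range n,
      (-1 : ℝ) ^ j * binomTail s j * Real.cos ((2 * j + 1) * θ)) =
    2 * binomTail s 0 - 2 * ∑ i ∈ Finset.Icc 1 n,
      (-1 : ℝ) ^ i * ((2 * s).choose (s + i) : ℝ) * Real.cos (2 * i * θ) -
      2 * (-1) ^ n * binomTail s n * Real.cos (2 * n * θ) := by
  induction n with
  | zero => simp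
  | succ n ih =>
    rw [Finset.sum_range_succ, mul_add, mul_add, ih (by omega),
      Finset.sum_Icc_succ_top (by omega)]
    have h1 : Real.cos (2 * n * θ) = Real.cos ((2 * n + 1) * θ - θ) := by ring_nf
    have h2 : Real.cos (2 * ((n + 1 : ℕ) : ℝ) * θ) = Real.cos ((2 * n + 1) * θ + θ) := by
      push_cast; ring_nf
    rw [h1, h2, Real.cos_sub, Real.cos_add, binomTail_eq_add (by omega : n < s), pow_succ]
    ring

/-- With `x = cos θ` this is the expansion of `(1 - (1 - x²)^s) / x` in odd Chebyshev polynomials.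
-/
theorem cos_mul_chebyshev_sum (s : ℕ) (θ : ℝ) :
    Real.cos θ * (4 * ∑ j ∈ Finset.range s,
      (-1 : ℝ) ^ j * (binomTail s j / 2 ^ (2 * s)) * Real.cos ((2 * j + 1) * θ)) =
    1 - Real.sin θ ^ (2 * s) := by
  have h1 := cos_mul_partial_sum s θ s le_rfl
  have h2 := sin_pow_expansion s θ
  have h3 := two_mul_binomTail_zero s
  have h4 : (2 : ℝ) ^ (2 * s) = 4 ^ s := by rw [pow_mul]; norm_num
  have hq : (0 : ℝ) < 4 ^ s := by positivity
  rw [binomTail_eq_zero (le_refl s)] at h1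
  have h5 : Real.cos θ * (4 * ∑ j ∈ Finset.range s,
      (-1 : ℝ) ^ j * (binomTail s j / 2 ^ (2 * s)) * Real.cos ((2 * j + 1) * θ)) =
      Real.cos θ * (4 * ∑ j ∈ Finset.range s,
      (-1 : ℝ) ^ j * binomTail s j * Real.cos ((2 * j + 1) * θ)) / 4 ^ s := by
    rw [h4, mul_div_assoc, mul_div_assoc, Finset.sum_div]
    congr 2
    refine Finset.sum_congr rfl fun j _ => ?_
    ring
  rw [h5, h1, div_eq_iff hq.ne']
  linarith

/-! ### Estimates for the parameters -/

/-- Two terms of the logarithmic series. The quadratic term is essential below: `1 - b ≤ e^{-b}`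
alone loses too much when `dκ` is close to `1`. -/
theorem one_sub_le_exp_neg {b : ℝ} (h₀ : 0 ≤ b) (h₁ : b ≤ 1) :
    1 - b ≤ Real.exp (-(b + b ^ 2 / 2)) := by
  rcases h₁.eq_or_lt with rfl | h₁
  · simpa using (Real.exp_pos _).le
  rw [← Real.log_le_iff_le_exp (by linarith)]
  have h := Real.hasSum_pow_div_log_of_abs_lt_one (abs_lt.2 ⟨by linarith, h₁⟩ : |b| < 1)
  have h2 := sum_le_hasSum (Finset.range 2) (fun i _ => by positivity) h
  simp only [Finset.sum_range_succ, Finset.sum_range_zero] at h2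
  norm_num at h2
  linarith

theorem two_mul_sub_div_add_le_log {a : ℝ} (ha : 1 ≤ a) : 2 * (a - 1) / (a + 1) ≤ Real.log a := by
  have h := Real.le_log_one_add_of_nonneg (sub_nonneg.2 ha)
  rwa [add_sub_cancel, show a - 1 + 2 = a + 1 by ring] at h

theorem exp_neg_le_45 : Real.exp (-(8 / 10)) ≤ 45 / 100 := by
  rw [Real.exp_neg, inv_le_comm₀ (Real.exp_pos _) (by norm_num)]
  refine le_trans ?_ (Real.sum_le_exp_of_nonneg (by norm_num) 6)
  norm_num [Finset.sum_range_succ, Nat.factorial]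

theorem exp_neg_three_le : Real.exp (-3) ≤ 5 / 100 := by
  rw [Real.exp_neg, inv_le_comm₀ (Real.exp_pos _) (by norm_num)]
  refine le_trans ?_ (Real.sum_le_exp_of_nonneg (by norm_num) 12)
  norm_num [Finset.sum_range_succ, Nat.factorial]

theorem eq_exp_logb_two {z : ℝ} (hz : 0 < z) : z = Real.exp (Real.logb 2 z * Real.log 2) := by
  rw [Real.logb, div_mul_cancel₀ _ (Real.log_pos (by norm_num)).ne', Real.exp_log hz]

theorem le_logb_two_of_pow_le {z : ℝ} (n : ℕ) (h : 2 ^ n ≤ z) : (n : ℝ) ≤ Real.logb 2 z := by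
  have hz : 0 < z := lt_of_lt_of_le (by positivity) h
  rw [Real.le_logb_iff_rpow_le (by norm_num) hz, Real.rpow_natCast]
  exact h

theorem lt_pow_of_logb_two_lt {z : ℝ} (n : ℕ) (h : Real.logb 2 z < n) :
    z < 2 ^ n := by
  by_contra! h'
  exact absurd (le_logb_two_of_pow_le n h') (not_le.2 h)

/-- Put `Λ = log₂(a/ε)` and `q = 1/a`. The left side is at most `ε exp(-Λ (1 + q²/2 - log 2))`, so
an exponent of `0.8` suffices, as `e^{-0.8} ≤ 0.45`. The base `2` leaves the margin `1 - log 2 >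
0.3068`; the rest comes from `q²/2` when `q` is near `1` and from the size of `Λ` when `q` is small.
-/
theorem mul_one_sub_pow_le {a ε : ℝ} (s : ℕ) (ha : 1 ≤ a) (hε : 0 < ε) (hε2 : ε < 1 / 2)
    (hs : a ^ 2 * Real.logb 2 (a / ε) ≤ s) : a * (1 - 1 / a ^ 2) ^ s ≤ 45 / 100 * ε := by
  have ha0 : 0 < a := by linarith
  set Λ := Real.logb 2 (a / ε) with hΛ
  set q := 1 / a with hq
  have hq0 : 0 < q := by positivity
  have hq1 : q ≤ 1 := by rw [hq, div_le_one ha0]; exact ha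
  have hb : 1 / a ^ 2 = q ^ 2 := by rw [hq]; ring
  have hsb : Λ ≤ s * q ^ 2 := by
    rw [← hb, mul_one_div, le_div_iff₀ (by positivity)]; linarith
  have hl2 := Real.log_two_lt_d9
  have hl2' : 0 < Real.log 2 := Real.log_pos (by norm_num)
  -- From `ε < 1/2` one gets `Λ ≥ 1 + log₂ a`; then `log a ≥ 2(a-1)/(a+1)` and `1/log 2 > 1.4426`. A
  -- rational bound in `q` reduces `hE` to a polynomial inequality.
  have hΛ1 : (1 + q + 28852 / 10000 * (1 - q)) / (1 + q) ≤ Λ := by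
    have h1 : 1 + Real.logb 2 a ≤ Λ := by
      have h2 : Real.logb 2 (2 * a) = 1 + Real.logb 2 a := by
        rw [Real.logb_mul (by norm_num) ha0.ne', Real.logb_self_eq_one (by norm_num)]
      rw [← h2, hΛ]
      refine Real.logb_le_logb_of_le (by norm_num) (by positivity) ?_
      rw [le_div_iff₀ hε]; nlinarith
    have h3 := two_mul_sub_div_add_le_log ha
    have h4 : 2 * (a - 1) / (a + 1) = 2 * (1 - q) / (1 + q) := by
      rw [hq]; field_simp
    have h6 : 0 ≤ 2 * (1 - q) / (1 + q) := div_nonneg (by linarith) (by linarith)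
    have h5 : 14426 / 10000 * (2 * (1 - q) / (1 + q)) ≤ Real.logb 2 a := by
      rw [Real.logb, le_div_iff₀ hl2', ← h4]
      rw [← h4] at h6
      have : 14426 / 10000 * Real.log 2 ≤ 1 := by linarith
      nlinarith
    have h7 : (1 + q + 28852 / 10000 * (1 - q)) / (1 + q) =
        1 + 14426 / 10000 * (2 * (1 - q) / (1 + q)) := by field_simp; ring
    linarith
  have hE : 8 / 10 ≤ Λ * (3068 / 10000 + q ^ 2 / 2) := by
    have h1 : 0 ≤ 3068 / 10000 + q ^ 2 / 2 := by positivity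
    refine le_trans ?_ (mul_le_mul_of_nonneg_right hΛ1 h1)
    rw [div_mul_eq_mul_div, le_div_iff₀ (by linarith)]
    nlinarith [mul_nonneg hq0.le (sub_nonneg.2 hq1), sq_nonneg (q - 6 / 10),
      mul_nonneg (sub_nonneg.2 hq1) (sq_nonneg (q - 6 / 10)),
      mul_nonneg (sub_nonneg.2 hq1) (sq_nonneg (q - 5 / 10))]
  have hΛ0 : 0 ≤ Λ := le_trans (div_nonneg (by linarith) (by linarith)) hΛ1
  have h1 : (1 - q ^ 2) ^ s ≤ Real.exp (-(Λ * (1 + q ^ 2 / 2))) := by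
    have hq2 : q ^ 2 ≤ 1 := by nlinarith
    calc (1 - q ^ 2) ^ s ≤ Real.exp (-(q ^ 2 + (q ^ 2) ^ 2 / 2)) ^ s := by
          gcongr
          exact one_sub_le_exp_neg (by positivity) hq2
      _ = Real.exp (-(s * q ^ 2 * (1 + q ^ 2 / 2))) := by
          rw [← Real.exp_nat_mul]; congr 1; ring
      _ ≤ _ := by gcongr
  have h2 := eq_exp_logb_two (by positivity : 0 < a / ε)
  rw [← hΛ] at h2
  have h3 : a / ε * (1 - q ^ 2) ^ s ≤ 45 / 100 := by
    calc _ ≤ Real.exp (Λ * Real.log 2) * Real.exp (-(Λ * (1 + q ^ 2 / 2))) := by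
          rw [← h2]; gcongr
      _ = Real.exp (Λ * Real.log 2 + -(Λ * (1 + q ^ 2 / 2))) := by rw [Real.exp_add]
      _ ≤ Real.exp (-(8 / 10)) := by
          rw [Real.exp_le_exp]
          nlinarith
      _ ≤ _ := exp_neg_le_45
  rw [hb]
  calc a * (1 - q ^ 2) ^ s = a / ε * (1 - q ^ 2) ^ s * ε := by field_simp
    _ ≤ _ := by gcongr

/-- Let `z = 4s/ε` and `L = log₂ z`. Expanding `(j + 2)²/s ≥ L + 4 √(L/s)` bounds the left side by
`ε exp(-(1 - log 2) L - 4 √(L/s))`, and `e^{-3} ≤ 0.05`. The shift by `2` is needed when `L` is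
small. -/
theorem four_mul_exp_neg_le {s : ℕ} {ε j : ℝ} (hs : 2 ≤ s) (hε : 0 < ε) (hε2 : ε < 1 / 2)
    (hj : Real.sqrt (s * Real.logb 2 (4 / ε * s)) ≤ j) :
    4 * s * Real.exp (-(j + 2) ^ 2 / s) ≤ 5 / 100 * ε := by
  have hs0 : (0 : ℝ) < s := by exact_mod_cast (by omega : 0 < s)
  have hs2 : (2 : ℝ) ≤ s := by exact_mod_cast hs
  set z := 4 / ε * s with hz
  have hz8 : 8 * s ≤ z := by
    rw [hz, div_mul_eq_mul_div, le_div_iff₀ hε]; nlinarith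
  have hz0 : 0 < z := by positivity
  set L := Real.logb 2 z with hL
  have hL4 : 4 ≤ L := by exact_mod_cast le_logb_two_of_pow_le 4 (by norm_num; linarith)
  set t := Real.sqrt (s * L) with ht
  have ht0 : 0 ≤ t := Real.sqrt_nonneg _
  have ht2 : t ^ 2 = s * L := Real.sq_sqrt (by positivity)
  set g := t / s with hg
  have hg0 : 0 ≤ g := by positivity
  have hg2 : g ^ 2 * s = L := by
    rw [hg, div_pow, ht2]; field_simp
  have hl2 := Real.log_two_lt_d9
  -- For `L ≥ 10` the first summand suffices. A smaller `L` bounds `s` through `8 s ≤ z`, which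
  -- makes `g = √(L/s)` large enough.
  have key : 3 ≤ 3068 / 10000 * L + 4 * g := by
    have hbound : ∀ n : ℕ, L < n → 8 * (s : ℝ) < 2 ^ n := fun n h =>
      hz8.trans_lt (lt_pow_of_logb_two_lt n h)
    by_cases h6 : L < 6
    · have := hbound 6 (by exact_mod_cast h6)
      nlinarith
    by_cases h8 : L < 8
    · have := hbound 8 (by exact_mod_cast h8)
      have : 3 / 10 ≤ g := by
        by_contra! h; nlinarith
      linarith
    by_cases h10 : L < 10
    · have := hbound 10 (by exact_mod_cast h10)
      have : 2 / 10 ≤ g := by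
        by_contra! h; nlinarith
      linarith
    linarith
  have h1 : L + 4 * g ≤ (j + 2) ^ 2 / s := by
    rw [le_div_iff₀ hs0]
    have : 4 * g * s = 4 * t := by rw [hg]; field_simp
    nlinarith
  have h2 := eq_exp_logb_two hz0
  rw [← hL] at h2
  have h3 : z * Real.exp (-(j + 2) ^ 2 / s) ≤ 5 / 100 := by
    calc _ = Real.exp (L * Real.log 2 + -(j + 2) ^ 2 / s) := by rw [Real.exp_add, ← h2]
      _ ≤ Real.exp (-3) := by
        rw [Real.exp_le_exp, neg_div]
        nlinarith
      _ ≤ _ := exp_neg_three_le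
  calc _ = z * Real.exp (-(j + 2) ^ 2 / s) * ε := by rw [hz]; field_simp
    _ ≤ _ := by gcongr

section parameters

variable {d : ℕ} {κ ε : ℝ}

theorem le_sParam (d : ℕ) (κ ε : ℝ) :
    ((d : ℝ) * κ) ^ 2 * Real.logb 2 ((d : ℝ) * κ / ε) ≤ sParam d κ ε := Nat.le_ceil _

theorem two_le_sParam (ha : 1 ≤ (d : ℝ) * κ) (hε : 0 < ε) (hε2 : ε < 1 / 2) :
    2 ≤ sParam d κ ε := by
  have h : (1 : ℝ) < ((d : ℝ) * κ) ^ 2 * Real.logb 2 ((d : ℝ) * κ / ε) := by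
    have h1 : 1 < Real.logb 2 ((d : ℝ) * κ / ε) := by
      rw [Real.lt_logb_iff_rpow_lt (by norm_num) (by positivity), Real.rpow_one, lt_div_iff₀ hε]
      linarith
    have h2 : 1 ≤ ((d : ℝ) * κ) ^ 2 := one_le_pow₀ ha
    nlinarith
  exact_mod_cast Nat.lt_ceil.2 (by exact_mod_cast h : ((1 : ℕ) : ℝ) < _)

/-- The factor `5/4` gives `√s ≥ 1.118 dκ`, the room needed in `le_mul_alpha`. Near `dκ = 1` it
comes from the rounding in `s ≥ 2`, elsewhere from `log₂ 2.4 ≥ 5/4`. -/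
theorem sq_le_sParam (ha : 1 ≤ (d : ℝ) * κ) (hε : 0 < ε) (hε2 : ε < 1 / 2) :
    5 / 4 * ((d : ℝ) * κ) ^ 2 ≤ sParam d κ ε := by
  rcases le_total ((d : ℝ) * κ) (12 / 10) with h | h
  · have : (2 : ℝ) ≤ sParam d κ ε := by exact_mod_cast two_le_sParam ha hε hε2
    nlinarith
  · refine le_trans ?_ (le_sParam d κ ε)
    have h1 : 5 / 4 ≤ Real.logb 2 ((d : ℝ) * κ / ε) := by
      have h2 : (2 : ℝ) ^ 5 ≤ ((d : ℝ) * κ / ε) ^ 4 := by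
        have : 24 / 10 ≤ (d : ℝ) * κ / ε := by rw [le_div_iff₀ hε]; nlinarith
        calc (2 : ℝ) ^ 5 ≤ (24 / 10) ^ 4 := by norm_num
          _ ≤ _ := by gcongr
      have h3 := le_logb_two_of_pow_le 5 h2
      rw [Real.logb_pow] at h3
      push_cast at h3
      linarith
    nlinarith [sq_nonneg ((d : ℝ) * κ)]

theorem le_jZero (d : ℕ) (κ ε : ℝ) :
    Real.sqrt ((sParam d κ ε : ℝ) * Real.logb 2 (4 / ε * (sParam d κ ε : ℝ))) ≤ jZero d κ ε :=
  Nat.le_ceil _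

theorem jZero_pos (ha : 1 ≤ (d : ℝ) * κ) (hε : 0 < ε) (hε2 : ε < 1 / 2) : 0 < jZero d κ ε := by
  have hs : (2 : ℝ) ≤ sParam d κ ε := by exact_mod_cast two_le_sParam ha hε hε2
  refine Nat.ceil_pos.2 (Real.sqrt_pos.2 (mul_pos (by linarith) (Real.logb_pos (by norm_num) ?_)))
  rw [div_mul_eq_mul_div, lt_div_iff₀ hε]
  linarith

/-- There are at most `s` omitted terms, and each has `j + 1 ≥ j₀ + 2`, which is the shift in
`four_mul_exp_neg_le`. -/
theorem truncation_le (ha : 1 ≤ (d : ℝ) * κ) (hε : 0 < ε) (hε2 : ε < 1 / 2) :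
    4 * ∑ j ∈ Finset.Ico (jZero d κ ε + 1) (sParam d κ ε),
      binomTail (sParam d κ ε) j / 2 ^ (2 * sParam d κ ε) ≤ 5 / 100 * ε := by
  have hs := two_le_sParam ha hε hε2
  refine le_trans ?_ (four_mul_exp_neg_le hs hε hε2 (le_jZero d κ ε))
  have hs0 : (0 : ℝ) < sParam d κ ε := by exact_mod_cast (by omega : 0 < sParam d κ ε)
  rw [mul_assoc]
  gcongr
  have h1 : ∀ j ∈ Finset.Ico (jZero d κ ε + 1) (sParam d κ ε),
      binomTail (sParam d κ ε) j / 2 ^ (2 * sParam d κ ε) ≤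
        Real.exp (-((jZero d κ ε : ℝ) + 2) ^ 2 / sParam d κ ε) := by
    intro j hj
    refine (binomTail_le _ _ (by omega)).trans ?_
    have : (jZero d κ ε : ℝ) + 1 ≤ j := by exact_mod_cast (Finset.mem_Ico.1 hj).1
    rw [Real.exp_le_exp]
    gcongr ?_ / _
    nlinarith [(Nat.cast_nonneg (jZero d κ ε) : (0 : ℝ) ≤ _)]
  refine (Finset.sum_le_card_nsmul _ _ _ h1).trans ?_
  rw [nsmul_eq_mul, Nat.card_Ico]
  gcongr
  omega

/-- This also covers `n > s`, which occurs when `j₀ + 1` exceeds the degree parameter: nothing is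
cut off then, and the additional coefficients vanish. -/
theorem sum_range_eq_add_sum_Ico {f : ℕ → ℝ} {s : ℕ} (hf : ∀ j, s ≤ j → f j = 0) (n : ℕ) :
    ∑ j ∈ Finset.range s, f j = ∑ j ∈ Finset.range n, f j + ∑ j ∈ Finset.Ico n s, f j := by
  rcases le_total n s with h | h
  · rw [Finset.sum_range_add_sum_Ico _ h]
  · rw [Finset.Ico_eq_empty (by omega), Finset.sum_empty, add_zero,
      ← Finset.sum_range_add_sum_Ico _ h,
      Finset.sum_eq_zero (s := Finset.Ico s n) fun j hj => hf j (Finset.mem_Ico.1 hj).1, add_zero]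

theorem mul_alpha (hd : 0 < d) : (d : ℝ) * alpha d κ ε =
    4 * ∑ j ∈ Finset.range (jZero d κ ε + 1),
      binomTail (sParam d κ ε) j / 2 ^ (2 * sParam d κ ε) := by
  have : (0 : ℝ) < d := by exact_mod_cast hd
  rw [alpha, ← Finset.sum_div]
  field_simp

theorem alpha_eq_sum_coeff (d : ℕ) (κ ε : ℝ) :
    alpha d κ ε = ∑ j ∈ Finset.range (jZero d κ ε + 1), coeff d κ ε j := by
  rw [alpha, Finset.mul_sum]
  refine Finset.sum_congr rfl fun j hj => ?_
  rw [coeff, if_pos (by simpa [Nat.lt_succ_iff] using hj)]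
  ring

theorem coeff_nonneg (d : ℕ) (κ ε : ℝ) (j : ℕ) : 0 ≤ coeff d κ ε j := by
  unfold coeff
  have := binomTail_nonneg (sParam d κ ε) j
  split_ifs <;> positivity

/-- The product `1.06 · 1.118` exceeds `1.18`, which pays for the truncation and for the factor
`10/9`. That factor bounds all amplitudes by `9/10`. -/
theorem le_mul_alpha (ha : 1 ≤ (d : ℝ) * κ) (hd : 0 < d) (hε : 0 < ε) (hε2 : ε < 1 / 2) :
    10 / 9 * ((d : ℝ) * κ + 5 / 100 * ε) ≤ d * alpha d κ ε := by
  have hs := two_le_sParam ha hε hε2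
  have h1 := four_mul_sum_binomTail_ge _ hs
  rw [sum_range_eq_add_sum_Ico (n := jZero d κ ε + 1) (fun j hj => by
    rw [binomTail_eq_zero hj, zero_div]), mul_add, ← mul_alpha hd] at h1
  have h2 := truncation_le ha hε hε2
  have h3 : 1118 / 1000 * ((d : ℝ) * κ) ≤ Real.sqrt (sParam d κ ε) := by
    apply Real.le_sqrt_of_sq_le
    nlinarith [sq_le_sParam ha hε hε2]
  linarith

/-- The approximation of `1 / x` at `x = d cos θ`. -/
noncomputable def chebApprox (d : ℕ) (κ ε θ : ℝ) : ℝ :=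
  ∑ j ∈ Finset.range (jZero d κ ε + 1), coeff d κ ε j * ((-1) ^ j * Real.cos ((2 * j + 1) * θ))

theorem abs_mul_chebApprox_sub_le (ha : 1 ≤ (d : ℝ) * κ) (hd : 0 < d) (hε : 0 < ε)
    (hε2 : ε < 1 / 2) {θ : ℝ} (hθ : Real.cos θ ≠ 0) :
    |d * chebApprox d κ ε θ - (1 - Real.sin θ ^ (2 * sParam d κ ε)) / Real.cos θ| ≤
      5 / 100 * ε := by
  have hd0 : (0 : ℝ) < d := by exact_mod_cast hd
  have h1 := cos_mul_chebyshev_sum (sParam d κ ε) θ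
  rw [sum_range_eq_add_sum_Ico (n := jZero d κ ε + 1) (fun j hj => by
    rw [binomTail_eq_zero hj, zero_div, mul_zero, zero_mul])] at h1
  have h2 : d * chebApprox d κ ε θ = 4 * ∑ j ∈ Finset.range (jZero d κ ε + 1),
      (-1 : ℝ) ^ j * (binomTail (sParam d κ ε) j / 2 ^ (2 * sParam d κ ε)) *
        Real.cos ((2 * j + 1) * θ) := by
    rw [chebApprox, Finset.mul_sum, Finset.mul_sum]
    refine Finset.sum_congr rfl fun j hj => ?_
    rw [coeff, if_pos (by simpa [Nat.lt_succ_iff] using hj)]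
    field_simp
  rw [← h1, mul_div_cancel_left₀ _ hθ, h2, mul_add, sub_add_cancel_left, abs_neg, abs_mul,
    abs_of_pos (by norm_num : (0 : ℝ) < 4)]
  refine le_trans ?_ (truncation_le ha hε hε2)
  gcongr
  refine (Finset.abs_sum_le_sum_abs _ _).trans (Finset.sum_le_sum fun j _ => ?_)
  have h3 : 0 ≤ binomTail (sParam d κ ε) j / 2 ^ (2 * sParam d κ ε) :=
    div_nonneg (binomTail_nonneg _ _) (by positivity)
  rw [abs_mul, abs_mul, abs_pow, abs_neg, abs_one, one_pow, one_mul, abs_of_nonneg h3]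
  exact mul_le_of_le_one_right h3 (Real.abs_cos_le_one _)

theorem sin_pow_mem (s : ℕ) (θ : ℝ) : 0 ≤ Real.sin θ ^ (2 * s) ∧ Real.sin θ ^ (2 * s) ≤ 1 := by
  rw [pow_mul]
  exact ⟨by positivity, pow_le_one₀ (by positivity) (Real.sin_sq_le_one θ)⟩

theorem abs_mul_chebApprox_le (ha : 1 ≤ (d : ℝ) * κ) (hd : 0 < d) (hε : 0 < ε)
    (hε2 : ε < 1 / 2) {θ : ℝ} (hθ : 1 / ((d : ℝ) * κ) ≤ |Real.cos θ|) :
    |d * chebApprox d κ ε θ| ≤ (d : ℝ) * κ + 5 / 100 * ε := by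
  have ha0 : 0 < (d : ℝ) * κ := by linarith
  have hc : 0 < |Real.cos θ| := lt_of_lt_of_le (by positivity) hθ
  have h1 := abs_mul_chebApprox_sub_le ha hd hε hε2 (abs_pos.1 hc)
  have h2 : |(1 - Real.sin θ ^ (2 * sParam d κ ε)) / Real.cos θ| ≤ (d : ℝ) * κ := by
    have h3 := sin_pow_mem (sParam d κ ε) θ
    rw [abs_div, abs_of_nonneg (by linarith), div_le_iff₀ hc]
    rw [div_le_iff₀' ha0] at hθ
    linarith
  have h4 := abs_sub_abs_le_abs_sub (d * chebApprox d κ ε θ)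
    ((1 - Real.sin θ ^ (2 * sParam d κ ε)) / Real.cos θ)
  linarith

/-- The budget `ε/2` is split into `0.05 ε` for the truncation and `0.45 ε` for `sin^{2s} θ / cos
θ`, where division by `|cos θ|` costs at most the factor `dκ`. -/
theorem abs_mul_chebApprox_sub_inv_le (ha : 1 ≤ (d : ℝ) * κ) (hd : 0 < d) (hε : 0 < ε)
    (hε2 : ε < 1 / 2) {θ : ℝ} (hθ : 1 / ((d : ℝ) * κ) ≤ |Real.cos θ|) :
    |d * chebApprox d κ ε θ - 1 / Real.cos θ| ≤ ε / 2 := by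
  have ha0 : 0 < (d : ℝ) * κ := by linarith
  have hc : 0 < |Real.cos θ| := lt_of_lt_of_le (by positivity) hθ
  have h1 := abs_mul_chebApprox_sub_le ha hd hε hε2 (abs_pos.1 hc)
  have h2 : |(1 - Real.sin θ ^ (2 * sParam d κ ε)) / Real.cos θ - 1 / Real.cos θ| ≤
      45 / 100 * ε := by
    refine le_trans ?_ (mul_one_sub_pow_le _ ha hε hε2 (le_sParam d κ ε))
    have h3 := sin_pow_mem (sParam d κ ε) θ
    rw [← sub_div, sub_sub_cancel_left, abs_div, abs_neg, abs_of_nonneg h3.1, div_le_iff₀ hc]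
    have h4 : 1 / ((d : ℝ) * κ) ^ 2 ≤ Real.cos θ ^ 2 := by
      rw [← sq_abs (Real.cos θ), ← one_div_pow]; gcongr
    have h5 : Real.sin θ ^ (2 * sParam d κ ε) ≤ (1 - 1 / ((d : ℝ) * κ) ^ 2) ^ sParam d κ ε := by
      rw [pow_mul, Real.sin_sq]
      have := Real.cos_sq_le_one θ
      gcongr
    have h6 : 1 ≤ (d : ℝ) * κ * |Real.cos θ| := by rwa [div_le_iff₀' ha0] at hθ
    nlinarith [h3.1.trans h5]
  have h4 := abs_add_le (d * chebApprox d κ ε θ - (1 - Real.sin θ ^ (2 * sParam d κ ε)) /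
    Real.cos θ) ((1 - Real.sin θ ^ (2 * sParam d κ ε)) / Real.cos θ - 1 / Real.cos θ)
  rw [sub_add_sub_cancel] at h4
  linarith

end parameters

/-! ### Matrices that act on one factor, and monomial matrices -/

/-- The matrix that, under the identification `e`, acts as `M k` on the fibre over `k`. -/
def fiberMatrix {ι K F : Type} [DecidableEq K] (e : ι ≃ K × F) (M : K → Matrix F F ℂ) :
    Matrix ι ι ℂ :=
  Matrix.of fun r r' => if (e r).1 = (e r').1 then M (e r).1 (e r).2 (e r').2 else 0

theorem fiberMatrix_conjTranspose {ι K F : Type} [DecidableEq K] (e : ι ≃ K × F)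
    (M : K → Matrix F F ℂ) : (fiberMatrix e M)ᴴ = fiberMatrix e fun k => (M k)ᴴ := by
  ext r r'
  simp only [fiberMatrix, Matrix.conjTranspose_apply, Matrix.of_apply]
  by_cases h : (e r).1 = (e r').1
  · simp [h]
  · simp [h, Ne.symm h]

theorem fiberMatrix_mulVec {ι K F : Type} [DecidableEq K] [Fintype ι] [Fintype K] [Fintype F]
    (e : ι ≃ K × F) (M : K → Matrix F F ℂ) (v : ι → ℂ) (r : ι) :
    (fiberMatrix e M *ᵥ v) r = ∑ y, M (e r).1 (e r).2 y * v (e.symm ((e r).1, y)) := by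
  rw [Matrix.mulVec, dotProduct, ← e.symm.sum_comp, Fintype.sum_prod_type, Finset.sum_comm]
  refine Finset.sum_congr rfl fun y _ => ?_
  simp [fiberMatrix]

theorem fiberMatrix_mul {ι K F : Type} [DecidableEq K] [Fintype ι] [Fintype K] [Fintype F]
    (e : ι ≃ K × F) (M M' : K → Matrix F F ℂ) :
    fiberMatrix e M * fiberMatrix e M' = fiberMatrix e fun k => M k * M' k := by
  ext r r'
  have := fiberMatrix_mulVec e M (fun q => fiberMatrix e M' q r') r
  rw [Matrix.mulVec, dotProduct] at this
  rw [Matrix.mul_apply, this]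
  by_cases h : (e r).1 = (e r').1
  · simp [fiberMatrix, h, Matrix.mul_apply]
  · simp [fiberMatrix, h]

theorem fiberMatrix_one {ι K F : Type} [DecidableEq ι] [DecidableEq K] [DecidableEq F]
    (e : ι ≃ K × F) : fiberMatrix e (fun _ => 1) = 1 := by
  ext r r'
  simp only [fiberMatrix, Matrix.of_apply, Matrix.one_apply]
  by_cases h : r = r'
  · simp [h]
  · have : ¬ ((e r).1 = (e r').1 ∧ (e r).2 = (e r').2) := fun h' =>
      h (e.injective (Prod.ext h'.1 h'.2))
    rw [if_neg h]
    split_ifs <;> tauto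

theorem fiberMatrix_mem_unitaryGroup {ι K F : Type} [DecidableEq ι] [DecidableEq K]
    [DecidableEq F] [Fintype ι] [Fintype K] [Fintype F] (e : ι ≃ K × F) (M : K → Matrix F F ℂ)
    (h : ∀ k, M k ∈ Matrix.unitaryGroup F ℂ) : fiberMatrix e M ∈ Matrix.unitaryGroup ι ℂ := by
  rw [Matrix.mem_unitaryGroup_iff, Matrix.star_eq_conjTranspose, fiberMatrix_conjTranspose,
    fiberMatrix_mul, ← fiberMatrix_one e]
  congr 1
  funext k
  exact Matrix.mem_unitaryGroup_iff.1 (h k)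

/-- The matrix `|r⟩ ↦ φ(r) |σ(r)⟩`. -/
def labelMatrix {ι : Type} [DecidableEq ι] (σ : ι → ι) (φ : ι → ℂ) : Matrix ι ι ℂ :=
  Matrix.of fun r r' => if r = σ r' then φ r' else 0

theorem labelMatrix_mem_unitaryGroup {ι : Type} [DecidableEq ι] [Fintype ι] {σ : ι → ι}
    {φ : ι → ℂ} (hσ : Function.Injective σ) (hφ : ∀ r, ‖φ r‖ = 1) :
    labelMatrix σ φ ∈ Matrix.unitaryGroup ι ℂ := by
  rw [Matrix.mem_unitaryGroup_iff', Matrix.star_eq_conjTranspose]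
  ext r r'
  simp only [Matrix.mul_apply, labelMatrix, Matrix.conjTranspose_apply, Matrix.of_apply,
    Matrix.one_apply, mul_ite, mul_zero, Finset.sum_ite_eq', Finset.mem_univ,
    if_true]
  by_cases h : r = r'
  · subst h
    simp [← Complex.normSq_eq_conj_mul_self, Complex.normSq_eq_norm_sq, hφ]
  · have : ¬ σ r' = σ r := fun h' => h (hσ h').symm
    simp [h, this]

theorem labelMatrix_mulVec {ι : Type} [DecidableEq ι] [Fintype ι] {σ τ : ι → ι} (φ : ι → ℂ)
    (h₁ : ∀ r, σ (τ r) = r) (h₂ : ∀ r, τ (σ r) = r) (v : ι → ℂ) (r : ι) :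
    (labelMatrix σ φ *ᵥ v) r = φ (τ r) * v (τ r) := by
  have : ∀ r', r = σ r' ↔ r' = τ r := fun r' =>
    ⟨fun h => by rw [h, h₂], fun h => by rw [h, h₁]⟩
  simp [Matrix.mulVec, dotProduct, labelMatrix, this]

theorem labelMatrix_conjTranspose_of_involutive {ι : Type} [DecidableEq ι] {σ : ι → ι}
    (h : Function.Involutive σ) : (labelMatrix σ fun _ => 1)ᴴ = labelMatrix σ fun _ => 1 := by
  ext r r'
  have : r' = σ r ↔ r = σ r' :=
    ⟨fun h' => by rw [h', h], fun h' => by rw [h', h]⟩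
  simp only [labelMatrix, Matrix.conjTranspose_apply, Matrix.of_apply, this]
  split_ifs <;> simp

theorem labelMatrix_mul_self {ι : Type} [DecidableEq ι] [Fintype ι] {σ : ι → ι} {φ : ι → ℂ}
    (h : Function.Involutive σ) (hφ : ∀ r, φ (σ r) * φ r = 1) :
    labelMatrix σ φ * labelMatrix σ φ = 1 := by
  ext r r'
  simp only [Matrix.mul_apply, labelMatrix, Matrix.of_apply, ite_mul, zero_mul, mul_ite, mul_zero,
    Matrix.one_apply]
  rw [Finset.sum_eq_single (σ r')]
  · by_cases hr : r = r'
    · simp [hr, h r', hφ]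
    · simp [hr, h r']
  · intro q _ hq
    simp [hq]
  · simp

/-- The real reflection exchanging `i₀` and `v` is unitary. -/
theorem prepReal_mem_unitaryGroup {ι : Type} [Fintype ι] [DecidableEq ι] (i₀ : ι) (v : ι → ℝ) :
    prepReal i₀ v ∈ Matrix.unitaryGroup ι ℂ := by
  set u : ι → ℝ := fun i => (if i = i₀ then 1 else 0) - v i with hu
  set q : ℝ := ∑ l, u l ^ 2 with hq
  have hP : prepReal i₀ v = (Matrix.of fun i j =>
      ((if i = j then 1 else 0) - 2 * u i * u j / q : ℝ) : Matrix ι ι ℝ).map Complex.ofReal := by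
    ext i j; simp [prepReal, hu, hq]
  have hR : ∀ i j, ∑ k, ((if i = k then 1 else 0) - 2 * u i * u k / q : ℝ) *
      ((if j = k then 1 else 0) - 2 * u j * u k / q) = if i = j then 1 else 0 := by
    intro i j
    have e : ∀ k, ((if i = k then 1 else 0) - 2 * u i * u k / q : ℝ) *
        ((if j = k then 1 else 0) - 2 * u j * u k / q) =
        (if i = k then (if j = k then 1 else 0) else 0) - (if i = k then 2 * u j * u k / q else 0)
        - (if j = k then 2 * u i * u k / q else 0) + 4 * u i * u j / q ^ 2 * u k ^ 2 := by
      intro k; split_ifs <;> ring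
    simp only [e, Finset.sum_add_distrib, Finset.sum_sub_distrib, Finset.sum_ite_eq,
      Finset.mem_univ, if_true, ← Finset.mul_sum, ← hq]
    have : 4 * u i * u j / q ^ 2 * q = 4 * u i * u j / q := by
      -- If `v` is the basis vector `i₀`, then `u = 0` and division by zero turns the reflection
      -- into the identity.
      rcases eq_or_ne q 0 with h | h
      · simp [h]
      · field_simp
    rw [this]
    simp only [eq_comm (a := j) (b := i)]
    ring
  rw [Matrix.mem_unitaryGroup_iff, Matrix.star_eq_conjTranspose, hP]
  ext i j
  simp only [Matrix.mul_apply, Matrix.conjTranspose_apply, Matrix.map_apply, Matrix.of_apply,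
    RCLike.star_def, Complex.conj_ofReal, Matrix.one_apply]
  have h := congrArg (Complex.ofReal) (hR i j)
  rw [Complex.ofReal_sum] at h
  simp only [Complex.ofReal_mul] at h
  rw [h]
  split_ifs <;> simp

/-- The real reflection exchanging `i₀` and the unit vector `v` maps `i₀` to `v`. -/
theorem prepReal_apply {ι : Type} [Fintype ι] [DecidableEq ι] (i₀ : ι) (v : ι → ℝ)
    (hv : ∑ i, v i ^ 2 = 1) (i : ι) : prepReal i₀ v i i₀ = v i := by
  have hq : ∑ l, ((if l = i₀ then 1 else 0) - v l) ^ 2 = 2 * (1 - v i₀) := by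
    have e : ∀ l, ((if l = i₀ then 1 else 0) - v l) ^ 2 =
        (if l = i₀ then 1 - 2 * v l else 0) + v l ^ 2 := by
      intro l; split_ifs <;> ring
    simp only [e, Finset.sum_add_distrib, hv, Finset.sum_ite_eq', Finset.mem_univ, if_true]
    ring
  simp only [prepReal, Matrix.of_apply, hq, if_true]
  congr 1
  rcases eq_or_ne (1 - v i₀) 0 with h | h
  · have hv0 : v i₀ = 1 := by linarith
    have h0 : ∑ l, ((if l = i₀ then 1 else 0) - v l) ^ 2 = 0 := by rw [hq, h, mul_zero]
    have h1 := (Finset.sum_eq_zero_iff_of_nonneg fun l _ => sq_nonneg _).1 h0 i (Finset.mem_univ _)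
    have h2 := pow_eq_zero_iff (two_ne_zero) |>.1 h1
    rw [hv0, sub_self, mul_zero, zero_div, sub_zero]
    linarith
  · have : 2 * ((if i = i₀ then 1 else 0) - v i) * (1 - v i₀) / (2 * (1 - v i₀)) =
        (if i = i₀ then 1 else 0) - v i := by field_simp
    rw [this]; ring

theorem entryRotation_mem_unitaryGroup (a : ℂ) :
    entryRotation a ∈ Matrix.unitaryGroup Bool ℂ := by
  unfold entryRotation
  split_ifs with h
  · set z := (conj a) ^ (1 / 2 : ℂ) with hz
    have h1 : z * conj z = (‖a‖ : ℂ) := by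
      rw [Complex.mul_conj, Complex.normSq_eq_norm_sq]
      have : z ^ 2 = conj a := by
        rw [hz, one_div]; exact Complex.cpow_nat_inv_pow _ two_ne_zero
      rw [← norm_pow, this, RCLike.norm_conj]
    have h2 : ((Real.sqrt (1 - ‖a‖) : ℝ) : ℂ) * (Real.sqrt (1 - ‖a‖) : ℝ) = 1 - ‖a‖ := by
      rw [← Complex.ofReal_mul, Real.mul_self_sqrt (by linarith)]; push_cast; ring
    rw [Matrix.mem_unitaryGroup_iff, Matrix.star_eq_conjTranspose]
    ext x y
    cases x <;> cases y <;>
      simp only [Matrix.mul_apply, Matrix.conjTranspose_apply, Matrix.of_apply, Fintype.sum_bool,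
        RCLike.star_def, map_neg, Complex.conj_ofReal, Complex.conj_conj, Matrix.one_apply] <;>
      norm_num
    · linear_combination h1 + h2
    · ring
    · ring
    · linear_combination h1 + h2
  · exact one_mem _

theorem entryRotation_apply {a : ℂ} (h : ‖a‖ ≤ 1) :
    entryRotation a false false = (conj a) ^ (1 / 2 : ℂ) := by
  rw [entryRotation, if_pos h]; rfl

/-! ### Circuits -/

section circuits

variable {m N w : ℕ} (O : Oracles N w)

theorem Circuit.eval_append (𝒞 𝒟 : Circuit m N w) :
    Circuit.eval O (𝒞 ++ 𝒟) = Circuit.eval O 𝒟 * Circuit.eval O 𝒞 := by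
  induction 𝒞 with
  | nil => simp [Circuit.eval]
  | cons g 𝒞 ih =>
    rw [List.cons_append, Circuit.eval, ih, Circuit.eval, Matrix.mul_assoc]

theorem Circuit.eval_singleton (g : Instr m N w) : Circuit.eval O [g] = g.eval O := by
  simp [Circuit.eval]

theorem Circuit.eval_flatten_replicate (𝒞 : Circuit m N w) (n : ℕ) :
    Circuit.eval O (List.replicate n 𝒞).flatten = Circuit.eval O 𝒞 ^ n := by
  induction n with
  | zero => simp [Circuit.eval]
  | succ n ih => rw [List.replicate_succ, List.flatten_cons, Circuit.eval_append, ih, pow_succ]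

theorem oracleAOp_conjTranspose : (oracleAOp O : Op m N w)ᴴ = oracleAOp O := by
  refine labelMatrix_conjTranspose_of_involutive fun r => ?_
  simp

theorem Instr.eval_inv (g : Instr m N w) : g.inv.eval O = (g.eval O)ᴴ := by
  cases g with
  | gate U => rfl
  | oracleF i => cases i <;> simp [Instr.inv, Instr.eval]
  | oracleA => exact (oracleAOp_conjTranspose O).symm
  | prepB i => cases i <;> simp [Instr.inv, Instr.eval]

theorem Circuit.eval_inv (𝒞 : Circuit m N w) :
    Circuit.eval O 𝒞.inv = (Circuit.eval O 𝒞)ᴴ := by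
  induction 𝒞 with
  | nil => simp [Circuit.inv, Circuit.eval]
  | cons g 𝒞 ih =>
    have : Circuit.inv (g :: 𝒞) = Circuit.inv 𝒞 ++ [g.inv] := by simp [Circuit.inv]
    rw [this, Circuit.eval_append, ih, Circuit.eval_singleton, Instr.eval_inv, Circuit.eval,
      Matrix.conjTranspose_mul]

theorem Circuit.isUnitary_append {𝒞 𝒟 : Circuit m N w} (h₁ : 𝒞.IsUnitary) (h₂ : 𝒟.IsUnitary) :
    Circuit.IsUnitary (𝒞 ++ 𝒟) := by
  intro U hU
  rcases List.mem_append.1 hU with h | h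
  · exact h₁ U h
  · exact h₂ U h

theorem Circuit.isUnitary_gate {U : Op m N w} (h : U ∈ Matrix.unitaryGroup (Reg m N w) ℂ) :
    Circuit.IsUnitary [Instr.gate U] := by
  intro U' hU'
  simp only [List.mem_singleton, Instr.gate.injEq] at hU'
  rwa [hU']

theorem Circuit.isUnitary_inv {𝒞 : Circuit m N w} (h : 𝒞.IsUnitary) : 𝒞.inv.IsUnitary := by
  intro U hU
  simp only [Circuit.inv, List.mem_reverse, List.mem_map] at hU
  obtain ⟨g, hg, hgU⟩ := hU
  cases g with
  | gate V =>
    simp only [Instr.inv, Instr.gate.injEq] at hgU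
    rw [← hgU]
    exact Unitary.star_mem (h V hg)
  | oracleF i => simp [Instr.inv] at hgU
  | oracleA => simp [Instr.inv] at hgU
  | prepB i => simp [Instr.inv] at hgU

theorem Circuit.isUnitary_flatten {L : List (Circuit m N w)} (h : ∀ 𝒞 ∈ L, 𝒞.IsUnitary) :
    Circuit.IsUnitary L.flatten := by
  intro U hU
  obtain ⟨𝒞, h1, h2⟩ := List.mem_flatten.1 hU
  exact h 𝒞 h1 U h2

/-- If all instructions are unitary, so is the circuit. -/
theorem Circuit.eval_mem_unitaryGroup {𝒞 : Circuit m N w}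
    (h : ∀ g ∈ 𝒞, g.eval O ∈ Matrix.unitaryGroup (Reg m N w) ℂ) :
    Circuit.eval O 𝒞 ∈ Matrix.unitaryGroup (Reg m N w) ℂ := by
  induction 𝒞 with
  | nil => exact one_mem _
  | cons g 𝒞 ih =>
    exact mul_mem (ih fun g' hg' => h g' (List.mem_cons_of_mem _ hg')) (h g List.mem_cons_self)

/-- Number of instructions of a given kind. -/
theorem Circuit.countP_inv (p : Instr m N w → Bool) (hp : ∀ g, p g.inv = p g)
    (𝒞 : Circuit m N w) : 𝒞.inv.countP p = 𝒞.countP p := by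
  rw [Circuit.inv, List.countP_reverse, List.countP_map]
  congr 1
  funext g
  exact hp g

theorem countP_flatten_replicate {α : Type} (p : α → Bool) (l : List α) (n : ℕ) :
    (List.replicate n l).flatten.countP p = n * l.countP p := by
  induction n with
  | zero => simp
  | succ n ih => rw [List.replicate_succ, List.flatten_cons, List.countP_append, ih]; ring

end circuits

/-! ### Operators on the walk registers -/

/-- Labels of the walk registers, without the control register. -/
abbrev WalkReg (N w : ℕ) := (Fin N × Bool) × (Fin N × Bool) × Bits w

/-- The operator acting as `M c` if the control register is in the state `c`. -/
noncomputable def ctrlDiag {m N w : ℕ} (M : Fin (2 ^ m) → Matrix (WalkReg N w) (WalkReg N w) ℂ) : Op m N w :=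
  fiberMatrix (Equiv.refl _) M

theorem ctrlDiag_mulVec {m N w : ℕ} (M : Fin (2 ^ m) → Matrix (WalkReg N w) (WalkReg N w) ℂ)
    (v : Reg m N w → ℂ) (r : Reg m N w) :
    (ctrlDiag M *ᵥ v) r = (M r.1 *ᵥ fun q => v (r.1, q)) r.2 :=
  fiberMatrix_mulVec _ _ _ _

theorem ctrlDiag_mul {m N w : ℕ} (M M' : Fin (2 ^ m) → Matrix (WalkReg N w) (WalkReg N w) ℂ) :
    ctrlDiag M * ctrlDiag M' = ctrlDiag fun c => M c * M' c := fiberMatrix_mul _ _ _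

theorem ctrlDiag_one {m N w : ℕ} :
    ctrlDiag (m := m) (fun _ => (1 : Matrix (WalkReg N w) (WalkReg N w) ℂ)) = 1 :=
  fiberMatrix_one _

theorem ctrlDiag_conjTranspose {m N w : ℕ}
    (M : Fin (2 ^ m) → Matrix (WalkReg N w) (WalkReg N w) ℂ) :
    (ctrlDiag M)ᴴ = ctrlDiag fun c => (M c)ᴴ := fiberMatrix_conjTranspose _ _

theorem ctrlDiag_pow {m N w : ℕ} (M : Fin (2 ^ m) → Matrix (WalkReg N w) (WalkReg N w) ℂ) (n : ℕ) :
    ctrlDiag M ^ n = ctrlDiag fun c => M c ^ n := by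
  induction n with
  | zero => simp [ctrlDiag_one]
  | succ n ih => simp only [pow_succ, ih, ctrlDiag_mul]

theorem ctrlDiag_mem_unitaryGroup {m N w : ℕ}
    (M : Fin (2 ^ m) → Matrix (WalkReg N w) (WalkReg N w) ℂ)
    (h : ∀ c, M c ∈ Matrix.unitaryGroup (WalkReg N w) ℂ) :
    ctrlDiag M ∈ Matrix.unitaryGroup (Reg m N w) ℂ := fiberMatrix_mem_unitaryGroup _ _ h

/-- Separates the index of the first walk register. -/
def systemEquiv (N w : ℕ) : WalkReg N w ≃ (Bool × (Fin N × Bool) × Bits w) × Fin N where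
  toFun r := ((r.1.2, r.2), r.1.1)
  invFun q := ((q.2, q.1.1), q.1.2)
  left_inv _ := rfl
  right_inv _ := rfl

/-- Separates the index of the second walk register. -/
def indexEquiv (N w : ℕ) : WalkReg N w ≃ ((Fin N × Bool) × Bool × Bits w) × Fin N where
  toFun r := ((r.1, r.2.1.2, r.2.2), r.2.1.1)
  invFun q := (q.1.1, (q.2, q.1.2.1), q.1.2.2)
  left_inv _ := rfl
  right_inv _ := rfl

/-- Separates the flag of the second walk register. -/
def flagEquiv (N w : ℕ) : WalkReg N w ≃ ((Fin N × Bool) × Fin N × Bits w) × Bool where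
  toFun r := ((r.1, r.2.1.1, r.2.2), r.2.1.2)
  invFun q := (q.1.1, (q.1.2.1, q.2), q.1.2.2)
  left_inv _ := rfl
  right_inv _ := rfl

theorem onCtrl_eq {m N w : ℕ} (U : Matrix (Fin (2 ^ m)) (Fin (2 ^ m)) ℂ) :
    (onCtrl U : Op m N w) = fiberMatrix (Equiv.prodComm _ _) fun _ => U := by
  ext r r'; rfl

theorem onSystem_eq {m N w : ℕ} (U : Matrix (Fin N) (Fin N) ℂ) :
    (onSystem U : Op m N w) = ctrlDiag fun _ => fiberMatrix (systemEquiv N w) fun _ => U := by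
  ext r r'
  simp only [onSystem, ctrlDiag, fiberMatrix, systemEquiv, Matrix.of_apply, Equiv.coe_fn_mk,
    Equiv.refl_apply, Prod.mk.injEq, ite_and]

theorem onIndex_eq {m N w : ℕ} (U : Matrix (Fin N) (Fin N) ℂ) :
    (onIndex U : Op m N w) = ctrlDiag fun _ => fiberMatrix (indexEquiv N w) fun _ => U := by
  ext r r'
  simp only [onIndex, ctrlDiag, fiberMatrix, indexEquiv, Matrix.of_apply, Equiv.coe_fn_mk,
    Equiv.refl_apply, Prod.mk.injEq, ite_and]

theorem onFlag_eq {m N w : ℕ} (U : Bits w → Matrix Bool Bool ℂ) :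
    (onFlag U : Op m N w) = ctrlDiag fun _ => fiberMatrix (flagEquiv N w) fun k => U k.2.2 := by
  ext r r'
  simp only [onFlag, ctrlDiag, fiberMatrix, flagEquiv, Matrix.of_apply, Equiv.coe_fn_mk,
    Equiv.refl_apply, Prod.mk.injEq, ite_and]
  split_ifs with h1 h2 h3 h4 <;> first | rfl | rw [h4]

theorem labelOp_eq {m N w : ℕ} (σ : Fin (2 ^ m) → WalkReg N w → WalkReg N w)
    (φ : Fin (2 ^ m) → WalkReg N w → ℂ) :
    (labelOp (fun r => (r.1, σ r.1 r.2)) fun r => φ r.1 r.2 : Op m N w) =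
      ctrlDiag fun c => labelMatrix (σ c) (φ c) := by
  ext r r'
  have h : r = (r'.1, σ r'.1 r'.2) ↔ r.1 = r'.1 ∧ r.2 = σ r'.1 r'.2 := Prod.ext_iff
  simp only [labelOp, ctrlDiag, fiberMatrix, labelMatrix, Matrix.of_apply, Equiv.refl_apply, h,
    ite_and]
  split_ifs with h1 h2 <;> simp_all

/-- `O_F` on the walk registers. -/
noncomputable def walkOracleF {N w : ℕ} (O : Oracles N w) : Matrix (WalkReg N w) (WalkReg N w) ℂ :=
  labelMatrix (fun r => (r.1, (O.f r.1.1 r.2.1.1, r.2.1.2), r.2.2)) fun _ => 1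

/-- `O_A` on the walk registers. -/
noncomputable def walkOracleA {N w : ℕ} (O : Oracles N w) : Matrix (WalkReg N w) (WalkReg N w) ℂ :=
  labelMatrix (fun r => (r.1, r.2.1, fun i => xor (r.2.2 i) (O.bits r.1.1 r.2.1.1 i)))
    fun _ => 1

/-- The circuit `T_U` on the walk registers. -/
noncomputable def walkT {N w : ℕ} [NeZero N] (O : Oracles N w) (d : ℕ) (decode : Bits w → ℂ) :
    Matrix (WalkReg N w) (WalkReg N w) ℂ :=
  fiberMatrix (flagEquiv N w) (fun k => entryRotation (decode k.2.2)) * walkOracleA O *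
    walkOracleF O * fiberMatrix (indexEquiv N w) fun _ => uniformPrep N d

/-- The sign of the swap. -/
noncomputable def swapSign {N w : ℕ} (decode : Bits w → ℂ) (r : WalkReg N w) : ℂ :=
  if r.1.2 = false ∧ r.2.1.2 = false ∧ (decode r.2.2).im = 0 ∧ (decode r.2.2).re < 0 then -1 else 1

/-- The swap on the walk registers. -/
noncomputable def walkS {N w : ℕ} (decode : Bits w → ℂ) : Matrix (WalkReg N w) (WalkReg N w) ℂ :=
  labelMatrix (fun r => (r.2.1, r.1, conjBits decode r.2.2)) (swapSign decode)

/-- The label of `|j⟩|0⟩` in the walk registers. -/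
def walkStart {N w : ℕ} [NeZero N] (j : Fin N) : WalkReg N w :=
  ((j, false), (0, false), fun _ => false)

/-- The inclusion `|j⟩ ↦ |j⟩|0⟩`. -/
noncomputable def walkInit (N w : ℕ) [NeZero N] : Matrix (WalkReg N w) (Fin N) ℂ :=
  Matrix.of fun r j => if r = walkStart j then 1 else 0

/-- The walk operator `W = S (2 T T† - 1)`, written with the circuit `T_U`. -/
noncomputable def walkW {N w : ℕ} [NeZero N] (O : Oracles N w) (d : ℕ) (decode : Bits w → ℂ) :
    Matrix (WalkReg N w) (WalkReg N w) ℂ :=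
  walkS decode * (walkT O d decode *
    ((2 : ℂ) • (walkInit N w * (walkInit N w)ᴴ) - 1) * (walkT O d decode)ᴴ)

theorem walkInit_conjTranspose_mul {N w : ℕ} [NeZero N] :
    (walkInit N w)ᴴ * walkInit N w = 1 := by
  ext i j
  have h : (walkStart j : WalkReg N w) = walkStart i ↔ i = j := by
    simp [walkStart, eq_comm]
  simp [Matrix.mul_apply, walkInit, Matrix.one_apply, h]

/-- A string whose conjugate is encoded has a unique partner by injectivity, and all other strings
are fixed. This makes the swap unitary with square one. -/
theorem conjBits_involutive {w : ℕ} {decode : Bits w → ℂ} (h : Function.Injective decode) :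
    Function.Involutive (conjBits decode) := by
  intro z
  by_cases hz : ∃ z', decode z' = conj (decode z)
  · have h1 : decode (conjBits decode z) = conj (decode z) := by
      rw [conjBits, dif_pos hz]; exact hz.choose_spec
    have h2 : ∃ z', decode z' = conj (decode (conjBits decode z)) := ⟨z, by rw [h1]; simp⟩
    have h3 : decode (conjBits decode (conjBits decode z)) =
        conj (decode (conjBits decode z)) := by
      rw [conjBits, dif_pos h2]; exact h2.choose_spec
    apply h
    rw [h3, h1]; simp
  · have h1 : conjBits decode z = z := by rw [conjBits, dif_neg hz]
    rw [h1, h1]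

theorem conjBits_eq {w : ℕ} {decode : Bits w → ℂ} (h : Function.Injective decode) {z z' : Bits w}
    (hz : decode z' = conj (decode z)) : conjBits decode z = z' := by
  have hz' : ∃ z', decode z' = conj (decode z) := ⟨z', hz⟩
  apply h
  rw [conjBits, dif_pos hz', hz'.choose_spec, hz]

theorem decode_conjBits {w : ℕ} (decode : Bits w → ℂ) (z : Bits w) :
    decode (conjBits decode z) = conj (decode z) ∨ conjBits decode z = z := by
  by_cases hz : ∃ z', decode z' = conj (decode z)
  · left; rw [conjBits, dif_pos hz]; exact hz.choose_spec
  · right; rw [conjBits, dif_neg hz]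

theorem swapLabel_involutive {N w : ℕ} {decode : Bits w → ℂ} (h : Function.Injective decode) :
    Function.Involutive fun r : WalkReg N w => (r.2.1, r.1, conjBits decode r.2.2) := by
  intro r
  simp [conjBits_involutive h r.2.2]

theorem swapSign_swap {N w : ℕ} (decode : Bits w → ℂ) (r : WalkReg N w) :
    swapSign decode (r.2.1, r.1, conjBits decode r.2.2) = swapSign decode r := by
  have h : ((decode (conjBits decode r.2.2)).im = 0 ↔ (decode r.2.2).im = 0) ∧
      (decode (conjBits decode r.2.2)).re = (decode r.2.2).re := by
    rcases decode_conjBits decode r.2.2 with h | h <;> simp [h]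
  simp only [swapSign, h.1, h.2]
  congr 1
  exact propext ⟨fun h => ⟨h.2.1, h.1, h.2.2⟩, fun h => ⟨h.2.1, h.1, h.2.2⟩⟩

theorem walkS_mul_self {N w : ℕ} {decode : Bits w → ℂ} (h : Function.Injective decode) :
    (walkS decode : Matrix (WalkReg N w) (WalkReg N w) ℂ) * walkS decode = 1 := by
  refine labelMatrix_mul_self (swapLabel_involutive h) fun r => ?_
  rw [swapSign_swap, swapSign]
  split_ifs <;> simp

theorem norm_swapSign {N w : ℕ} (decode : Bits w → ℂ) (r : WalkReg N w) :
    ‖swapSign decode r‖ = 1 := by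
  unfold swapSign; split_ifs <;> simp

theorem walkS_mem_unitaryGroup {N w : ℕ} {decode : Bits w → ℂ} (h : Function.Injective decode) :
    walkS decode ∈ Matrix.unitaryGroup (WalkReg N w) ℂ :=
  labelMatrix_mem_unitaryGroup (swapLabel_involutive h).injective (norm_swapSign decode)

theorem walkOracleF_mem_unitaryGroup {N w : ℕ} (O : Oracles N w) :
    walkOracleF O ∈ Matrix.unitaryGroup (WalkReg N w) ℂ := by
  refine labelMatrix_mem_unitaryGroup (fun r r' h => ?_) fun _ => by simp
  simp only [Prod.mk.injEq] at h
  obtain ⟨h1, ⟨h2, h3⟩, h4⟩ := h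
  rw [h1] at h2
  exact Prod.ext h1 (Prod.ext (Prod.ext ((O.f _).injective h2) h3) h4)

theorem walkOracleA_involutive {N w : ℕ} (O : Oracles N w) :
    Function.Involutive fun r : WalkReg N w =>
      (r.1, r.2.1, fun i => xor (r.2.2 i) (O.bits r.1.1 r.2.1.1 i)) := by
  intro r; simp

theorem walkOracleA_mem_unitaryGroup {N w : ℕ} (O : Oracles N w) :
    walkOracleA O ∈ Matrix.unitaryGroup (WalkReg N w) ℂ :=
  labelMatrix_mem_unitaryGroup (walkOracleA_involutive O).injective fun _ => by simp

theorem walkT_mem_unitaryGroup {N w : ℕ} [NeZero N] (O : Oracles N w) (d : ℕ)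
    (decode : Bits w → ℂ) : walkT O d decode ∈ Matrix.unitaryGroup (WalkReg N w) ℂ := by
  refine mul_mem (mul_mem (mul_mem ?_ (walkOracleA_mem_unitaryGroup O))
    (walkOracleF_mem_unitaryGroup O)) ?_
  · exact fiberMatrix_mem_unitaryGroup _ _ fun k => entryRotation_mem_unitaryGroup _
  · exact fiberMatrix_mem_unitaryGroup _ _ fun _ => prepReal_mem_unitaryGroup _ _

/-! ### The circuits as block diagonal operators -/

section circuits

variable {m N w : ℕ} (O : Oracles N w) (d : ℕ) (decode : Bits w → ℂ)

theorem oracleFOp_eq : (oracleFOp O : Op m N w) = ctrlDiag fun _ => walkOracleF O :=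
  labelOp_eq (fun _ r => (r.1, (O.f r.1.1 r.2.1.1, r.2.1.2), r.2.2)) fun _ _ => 1

theorem oracleAOp_eq : (oracleAOp O : Op m N w) = ctrlDiag fun _ => walkOracleA O :=
  labelOp_eq (fun _ r => (r.1, r.2.1, fun i => xor (r.2.2 i) (O.bits r.1.1 r.2.1.1 i)))
    fun _ _ => 1

theorem labelMatrix_id_one {ι : Type} [DecidableEq ι] : labelMatrix (id : ι → ι) (fun _ => 1) = 1 := by
  ext r r'; simp [labelMatrix, Matrix.one_apply]

theorem swapOp_eq (active : Fin (2 ^ m) → Bool) : (swapOp decode active : Op m N w) =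
    ctrlDiag fun c => if active c then walkS decode else 1 := by
  have h : (swapOp decode active : Op m N w) = labelOp
      (fun r => (r.1, if active r.1 then (r.2.2.1, r.2.1, conjBits decode r.2.2.2) else r.2))
      fun r => if active r.1 then swapSign decode r.2 else 1 := by
    unfold swapOp
    congr 1
    · funext r; split_ifs <;> rfl
    · funext r; unfold swapSign; by_cases ha : active r.1 <;> simp [ha]
  rw [h]
  refine (labelOp_eq (fun c r => if active c then (r.2.1, r.1, conjBits decode r.2.2) else r)
    fun c r => if active c then swapSign decode r else 1).trans ?_
  congr 1
  funext c
  by_cases ha : active c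
  · simp only [ha, if_true]; rfl
  · simp only [ha]; exact labelMatrix_id_one

variable [NeZero N]

theorem eq_walkStart_iff (r : WalkReg N w) (j : Fin N) :
    r = walkStart j ↔ r.1.1 = j ∧ r.1.2 = false ∧ r.2 = ((0, false), fun _ => false) := by
  simp [walkStart, Prod.ext_iff, and_assoc]

open Classical in
theorem two_smul_walkInit_sub_one :
    (2 : ℂ) • (walkInit N w * (walkInit N w)ᴴ) - 1 = labelMatrix id fun r =>
      if ¬ (r.1.2 = false ∧ r.2 = ((0, false), fun _ => false)) then -1 else 1 := by
  ext r r'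
  simp only [Matrix.sub_apply, Matrix.smul_apply, Matrix.mul_apply, Matrix.conjTranspose_apply,
    walkInit, Matrix.of_apply, labelMatrix, id, Matrix.one_apply, eq_walkStart_iff]
  have hsum : ∑ j : Fin N, (if r.1.1 = j ∧ r.1.2 = false ∧ r.2 = ((0, false), fun _ => false)
      then (1 : ℂ) else 0) * star (if r'.1.1 = j ∧ r'.1.2 = false ∧
        r'.2 = ((0, false), fun _ => false) then (1 : ℂ) else 0) =
      if r = r' ∧ (r'.1.2 = false ∧ r'.2 = ((0, false), fun _ => false)) then 1 else 0 := by
    rw [Finset.sum_eq_single r.1.1]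
    · by_cases h : r = r'
      · subst h; simp
      · have : ¬ ((r.1.2 = false ∧ r.2 = ((0, false), fun _ => false)) ∧ (r'.1.1 = r.1.1 ∧
            r'.1.2 = false ∧ r'.2 = ((0, false), fun _ => false))) := by
          rintro ⟨⟨h1, h2⟩, h3, h4, h5⟩
          exact h (Prod.ext (Prod.ext h3.symm (h1.trans h4.symm)) (h2.trans h5.symm))
        simp only [h, false_and, if_false, true_and]
        by_cases h1 : r.1.2 = false ∧ r.2 = ((0, false), fun _ => false)
        · have h2 : ¬ (r'.1.1 = r.1.1 ∧ r'.1.2 = false ∧ r'.2 = ((0, false), fun _ => false)) :=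
            fun h' => this ⟨h1, h'⟩
          simp [h2]
        · simp [h1]
    · intro j _ hj
      simp [Ne.symm hj]
    · simp
  rw [hsum]
  by_cases h : r = r'
  · by_cases h2 : r'.1.2 = false ∧ r'.2 = ((0, false), fun _ => false)
    · simp only [h, h2]; norm_num
    · simp only [h, h2]; norm_num
  · simp [h]

theorem reflectOp_eq (active : Fin (2 ^ m) → Bool) : (reflectOp active : Op m N w) =
    ctrlDiag fun c => if active c then (2 : ℂ) • (walkInit N w * (walkInit N w)ᴴ) - 1 else 1 := by
  classical
  have h : (reflectOp active : Op m N w) = labelOp (fun r => (r.1, r.2)) fun r => if active r.1 ∧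
      ¬ (r.2.1.2 = false ∧ r.2.2 = ((0, false), fun _ => false)) then -1 else 1 := by
    unfold reflectOp
    congr 1
    funext r
    exact if_congr Iff.rfl rfl rfl
  rw [h]
  refine (labelOp_eq (fun _ r => r) fun c (r : WalkReg N w) => if active c ∧
    ¬ (r.1.2 = false ∧ r.2 = ((0, false), fun _ => false)) then -1 else 1).trans ?_
  congr 1
  funext c
  by_cases ha : active c
  · simp only [ha, true_and, if_true, two_smul_walkInit_sub_one]; rfl
  · simp only [ha, false_and, if_false, Bool.false_eq_true]; exact labelMatrix_id_one

theorem eval_isometryCircuit : Circuit.eval O (isometryCircuit m N w d decode) =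
    ctrlDiag fun _ => walkT O d decode := by
  simp only [isometryCircuit, Circuit.eval, Instr.eval, one_mul, onIndex_eq, onFlag_eq,
    oracleFOp_eq, oracleAOp_eq, ctrlDiag_mul, walkT]

/-- Only the reflection and the swap carry a control: for inactive values the uncontrolled `T_U†`
and `T_U` cancel. -/
theorem eval_walkCircuit (active : Fin (2 ^ m) → Bool) :
    Circuit.eval O (walkCircuit m N w d decode active) =
      ctrlDiag fun c => if active c then walkW O d decode else 1 := by
  have hT := Matrix.mem_unitaryGroup_iff.1 (walkT_mem_unitaryGroup O d decode)
  rw [Matrix.star_eq_conjTranspose] at hT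
  simp only [walkCircuit, Circuit.eval_append, Circuit.eval_singleton, Circuit.eval_inv,
    eval_isometryCircuit, Instr.eval, swapOp_eq, reflectOp_eq, ctrlDiag_mul,
    ctrlDiag_conjTranspose]
  congr 1
  funext c
  by_cases ha : active c
  · simp only [ha, if_true, walkW, Matrix.mul_assoc]
  · simp [ha, hT]

/-- The first `n` bits produce the exponent `2 (c mod 2^n)`, and `m` bits exhaust `c`. -/
theorem eval_controlledPowers : Circuit.eval O (controlledPowers m N w d decode) =
    ctrlDiag fun c => walkW O d decode ^ (2 * (c : ℕ)) := by
  have h : ∀ n, Circuit.eval O ((List.range n).flatMap fun i =>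
      (List.replicate (2 ^ (i + 1))
        (walkCircuit m N w d decode fun j => (j : ℕ).testBit i)).flatten) =
      ctrlDiag fun c => walkW O d decode ^ (2 * ((c : ℕ) % 2 ^ n)) := by
    intro n
    induction n with
    | zero => simp [Circuit.eval, Nat.mod_one, ctrlDiag_one]
    | succ n ih =>
      rw [List.range_succ, List.flatMap_append, Circuit.eval_append, ih, List.flatMap_singleton,
        Circuit.eval_flatten_replicate, eval_walkCircuit, ctrlDiag_pow, ctrlDiag_mul]
      congr 1
      funext c
      rw [Nat.mod_pow_succ, ← Nat.toNat_testBit]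
      cases hb : (c : ℕ).testBit n
      · simp
      · simp only [if_true, ← pow_add]
        congr 1
        simp only [Bool.toNat_true]
        ring
  rw [controlledPowers, h]
  congr 1
  funext c
  rw [Nat.mod_eq_of_lt c.2]

end circuits

/-! ### The isometry `T` and the compression of the swap -/

/-- Off the negative axis the principal root commutes with conjugation, so the product is the square
of a root of `a`. On the negative axis `conj a = a`, the product of the roots is `|√a|² = -a`, and
the sign repairs it. -/
theorem conj_cpow_half_mul (a : ℂ) :
    conj ((conj a) ^ (1 / 2 : ℂ)) * a ^ (1 / 2 : ℂ) *
      (if a.im = 0 ∧ a.re < 0 then -1 else 1) = a := by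
  have hsq : ∀ z : ℂ, z ^ (1 / 2 : ℂ) * z ^ (1 / 2 : ℂ) = z := by
    intro z
    rw [← pow_two, one_div]; exact Complex.cpow_nat_inv_pow _ two_ne_zero
  by_cases h : a.arg = Real.pi
  · have h' := Complex.arg_eq_pi_iff.1 h
    have hc : conj a = a := Complex.conj_eq_iff_im.2 h'.2
    rw [if_pos ⟨h'.2, h'.1⟩, hc, ← Complex.normSq_eq_conj_mul_self, Complex.normSq_eq_norm_sq,
      ← norm_pow, pow_two, hsq]
    have hre : a = (a.re : ℂ) := Complex.ext rfl (by simpa using h'.2)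
    rw [hre, Complex.norm_real, Real.norm_of_nonpos h'.1.le]
    push_cast; ring
  · have h' : ¬ (a.im = 0 ∧ a.re < 0) := fun h' => h (Complex.arg_eq_pi_iff.2 ⟨h'.2, h'.1⟩)
    have h2 := Complex.cpow_conj a (1 / 2) h
    have h3 : conj (1 / 2 : ℂ) = 1 / 2 := by
      rw [map_div₀, map_one, Complex.conj_ofNat]
    rw [h3] at h2
    rw [if_neg h', mul_one, ← h2, hsq]

theorem sum_uniform_sq {N d : ℕ} (hd : 0 < d) (hdN : d ≤ N) :
    ∑ l : Fin N, (if (l : ℕ) < d then 1 / Real.sqrt d else 0) ^ 2 = 1 := by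
  have h : ∀ l : Fin N, (if (l : ℕ) < d then 1 / Real.sqrt d else 0) ^ 2 =
      if (l : ℕ) < d then 1 / (d : ℝ) else 0 := by
    intro l
    split_ifs
    · rw [div_pow, Real.sq_sqrt (by positivity), one_pow]
    · simp
  have hd0 : (d : ℝ) ≠ 0 := by positivity
  simp only [h]
  rw [Fin.sum_univ_eq_sum_range (fun l => if l < d then 1 / (d : ℝ) else 0),
    ← Finset.sum_filter]
  have : Finset.filter (fun l => l < d) (Finset.range N) = Finset.range d := by
    ext l; simp; omega
  rw [this, Finset.sum_const, Finset.card_range, nsmul_eq_mul]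
  field_simp

/-- The isometry `T |j⟩ = |ψ_j⟩`. -/
noncomputable def walkIso {N w : ℕ} [NeZero N] (O : Oracles N w) (d : ℕ) (decode : Bits w → ℂ) :
    Matrix (WalkReg N w) (Fin N) ℂ :=
  walkT O d decode * walkInit N w

/-- The basis vector is followed through the four gates of `T_U`. Since `O_F` sends the position `l`
to a column, the condition `l < d` becomes one on `(O.f j).symm`. -/
theorem walkIso_apply {N w : ℕ} [NeZero N] (O : Oracles N w) {d : ℕ} (hd : 0 < d)
    (hdN : d ≤ N) (decode : Bits w → ℂ) (r : WalkReg N w) (j : Fin N) :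
    walkIso O d decode r j =
      if r.1 = (j, false) ∧ ((O.f j).symm r.2.1.1 : ℕ) < d ∧ r.2.2 = O.bits j r.2.1.1 then
        (1 / Real.sqrt d : ℝ) * entryRotation (decode r.2.2) r.2.1.2 false else 0 := by
  have h0 : walkIso O d decode r j =
      (walkT O d decode *ᵥ fun q => walkInit N w q j) r := rfl
  have h1 : ∀ q : WalkReg N w, ((fiberMatrix (indexEquiv N w) fun _ => uniformPrep N d) *ᵥ
      fun q => walkInit N w q j) q = if q.1 = (j, false) ∧ q.2.1.2 = false ∧
        q.2.2 = (fun _ => false) ∧ (q.2.1.1 : ℕ) < d then ((1 / Real.sqrt d : ℝ) : ℂ) else 0 := by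
    intro q
    rw [fiberMatrix_mulVec, Finset.sum_eq_single 0]
    · rw [indexEquiv, Equiv.coe_fn_mk, uniformPrep, prepReal_apply _ _ (sum_uniform_sq hd hdN)]
      simp only [walkInit, walkStart, Matrix.of_apply, Equiv.coe_fn_symm_mk, Prod.mk.injEq,
        true_and]
      by_cases h1 : q.1 = (j, false) <;> by_cases h2 : q.2.1.2 = false <;>
        by_cases h3 : q.2.2 = (fun _ => false) <;> by_cases h4 : (q.2.1.1 : ℕ) < d <;>
        simp [h1, h2, h3, h4]
    · intro y _ hy
      simp [walkInit, walkStart, indexEquiv, hy]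
    · simp
  have h2 : ∀ q : WalkReg N w, (walkOracleF O *ᵥ
      ((fiberMatrix (indexEquiv N w) fun _ => uniformPrep N d) *ᵥ
        fun q => walkInit N w q j)) q = if q.1 = (j, false) ∧ q.2.1.2 = false ∧
        q.2.2 = (fun _ => false) ∧ ((O.f j).symm q.2.1.1 : ℕ) < d
        then ((1 / Real.sqrt d : ℝ) : ℂ) else 0 := by
    intro q
    rw [walkOracleF, labelMatrix_mulVec
      (τ := fun r => (r.1, ((O.f r.1.1).symm r.2.1.1, r.2.1.2), r.2.2))
      _ (fun r => by simp) (fun r => by simp), h1, one_mul]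
    refine if_congr ?_ rfl rfl
    constructor
    · rintro ⟨a, b⟩; rw [a] at b; exact ⟨a, b⟩
    · rintro ⟨a, b⟩; rw [a]; exact ⟨rfl, b⟩
  have h3 : ∀ q : WalkReg N w, (walkOracleA O *ᵥ (walkOracleF O *ᵥ
      ((fiberMatrix (indexEquiv N w) fun _ => uniformPrep N d) *ᵥ
        fun q => walkInit N w q j))) q = if q.1 = (j, false) ∧ q.2.1.2 = false ∧
        q.2.2 = O.bits j q.2.1.1 ∧ ((O.f j).symm q.2.1.1 : ℕ) < d
        then ((1 / Real.sqrt d : ℝ) : ℂ) else 0 := by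
    intro q
    rw [walkOracleA, labelMatrix_mulVec _ (fun r => walkOracleA_involutive O r)
      (fun r => walkOracleA_involutive O r),
      h2, one_mul]
    refine if_congr ?_ rfl rfl
    have hx : ∀ a b : Bits w, (fun i => xor (a i) (b i)) = (fun _ => false) ↔ a = b := by
      intro a b
      simp [funext_iff]
    constructor
    · rintro ⟨a, b, c, e⟩; rw [hx, a] at c; exact ⟨a, b, c, e⟩
    · rintro ⟨a, b, c, e⟩; refine ⟨a, b, ?_, e⟩; rw [hx, a, c]
  rw [h0, walkT, ← Matrix.mulVec_mulVec, ← Matrix.mulVec_mulVec, ← Matrix.mulVec_mulVec,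
    fiberMatrix_mulVec, Finset.sum_eq_single false]
  · rw [h3]
    simp only [flagEquiv, Equiv.coe_fn_mk, Equiv.coe_fn_symm_mk, true_and, mul_ite, mul_zero]
    by_cases a : r.1 = (j, false) <;> by_cases b : r.2.2 = O.bits j r.2.1.1 <;>
      by_cases e : ((O.f j).symm r.2.1.1 : ℕ) < d <;> simp [a, b, e, mul_comm]
  · intro y _ hy
    rw [h3]
    simp [flagEquiv, hy]
  · simp

/-- In `⟨ψ_i|S|ψ_j⟩` the first register must be `i` on the left and, through the swap, the second
must be `j`, both without flag; a single label survives. Its two roots multiply to `A i j` by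
`conj_cpow_half_mul`, and the amplitudes `1/√d` give `1/d`. If `j` is not listed for `i`, or `i` not
for `j`, the entry is zero because `A` is Hermitian. -/
theorem compression_apply {N w d : ℕ} [NeZero N] {O : Oracles N w} {decode : Bits w → ℂ}
    {A : Matrix (Fin N) (Fin N) ℂ} {b : EuclideanSpace ℂ (Fin N)} (hA : A.IsHermitian)
    (hA1 : ∀ i j, ‖A i j‖ ≤ 1) (hd : 0 < d) (hdN : d ≤ N) (hdec : Function.Injective decode)
    (hO : O.Specifies decode d A b) :
    (walkIso O d decode)ᴴ * walkS (N := N) decode * walkIso O d decode =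
      ((d : ℂ)⁻¹) • A := by
  have hAc : ∀ i j, A j i = conj (A i j) := fun i j => (hA.apply j i).symm
  have hinv := swapLabel_involutive (N := N) hdec
  ext i j
  have h0 : ((walkIso O d decode)ᴴ * walkS (N := N) decode *
      walkIso O d decode) i j =
      ∑ r, conj (walkIso O d decode r i) *
        (walkS decode *ᵥ fun q => walkIso O d decode q j) r := by
    rw [Matrix.mul_assoc, Matrix.mul_apply]
    rfl
  have hcb : conjBits decode (O.bits i j) = O.bits j i :=
    conjBits_eq hdec (by rw [hO.entries, hO.entries, hAc])
  rw [h0, Finset.sum_eq_single ((i, false), (j, false), O.bits i j)]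
  · rw [walkS, labelMatrix_mulVec _ (fun r => hinv r) (fun r => hinv r), walkIso_apply O hd hdN,
      walkIso_apply O hd hdN]
    simp only [hcb, true_and, and_true, hO.entries, entryRotation_apply (hA1 _ _), swapSign]
    simp only [hAc i j, Complex.conj_conj, Complex.conj_re, Complex.conj_im, neg_eq_zero,
      Matrix.smul_apply, smul_eq_mul]
    by_cases h1 : ((O.f i).symm j : ℕ) < d
    · by_cases h2 : ((O.f j).symm i : ℕ) < d
      · rw [if_pos h1, if_pos h2, map_mul, Complex.conj_ofReal]
        have h3 : ((1 / Real.sqrt d : ℝ) : ℂ) * (1 / Real.sqrt d : ℝ) = (d : ℂ)⁻¹ := by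
          rw [← Complex.ofReal_mul, div_mul_div_comm, Real.mul_self_sqrt (by positivity)]
          push_cast; ring
        have h4 := conj_cpow_half_mul (A i j)
        set q := ((1 / Real.sqrt d : ℝ) : ℂ)
        calc _ = (q * q) * (conj ((conj (A i j)) ^ (1 / 2 : ℂ)) * (A i j) ^ (1 / 2 : ℂ) *
              (if (A i j).im = 0 ∧ (A i j).re < 0 then -1 else 1)) := by ring
          _ = _ := by rw [h3, h4]
      · have : A i j = 0 := by
          by_contra h
          refine h2 (hO.columns j i ?_)
          rw [hAc i j]; simpa using h
        rw [if_neg h2, this]; simp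
    · have : A i j = 0 := by
        by_contra h
        exact h1 (hO.columns i j h)
      rw [if_neg h1, this]; simp
  · rintro ⟨r1, r2, z⟩ _ hr
    rw [walkS, labelMatrix_mulVec _ (fun r => hinv r) (fun r => hinv r), walkIso_apply O hd hdN,
      walkIso_apply O hd hdN]
    dsimp only
    by_cases h1 : r1 = (i, false) ∧ ((O.f i).symm r2.1 : ℕ) < d ∧ z = O.bits i r2.1
    · by_cases h2 : r2 = (j, false)
      · exfalso; apply hr
        obtain ⟨a, _, c⟩ := h1
        rw [a, c, h2]
      · simp [h2]
    · simp [h1]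
  · simp

/-! ### The walk and the Chebyshev recursion -/

/-- From `T†T = 1` follows `WT = ST`, and then `S² = 1` gives `W²T = 2 WT(T†ST) - T`. No spectral
analysis of `W` is needed. -/
theorem compression_pow_add_two {ι κ : Type} [Fintype ι] [DecidableEq ι] [Fintype κ]
    [DecidableEq κ] {S W : Matrix ι ι ℂ} {T : Matrix ι κ ℂ} (hS : S * S = 1) (hT : Tᴴ * T = 1)
    (hW : W = S * ((2 : ℂ) • (T * Tᴴ) - 1)) (n : ℕ) :
    Tᴴ * W ^ (n + 2) * T =
      (2 : ℂ) • (Tᴴ * W ^ (n + 1) * T * (Tᴴ * S * T)) - Tᴴ * W ^ n * T := by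
  have h1 : W * T = S * T := by
    rw [hW, Matrix.mul_assoc, Matrix.sub_mul, Matrix.smul_mul, Matrix.mul_assoc T, hT,
      Matrix.mul_one, Matrix.one_mul, two_smul, add_sub_cancel_right]
  have h2 : W ^ 2 * T = (2 : ℂ) • (W * T * (Tᴴ * S * T)) - T := by
    rw [pow_two, Matrix.mul_assoc, h1, hW, Matrix.mul_assoc, Matrix.sub_mul, Matrix.smul_mul,
      Matrix.mul_sub, Matrix.one_mul, ← Matrix.mul_assoc S S, hS, Matrix.one_mul,
      Matrix.mul_smul]
    simp only [Matrix.mul_assoc]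
  calc Tᴴ * W ^ (n + 2) * T = Tᴴ * (W ^ n * (W ^ 2 * T)) := by
        rw [pow_add]; simp only [Matrix.mul_assoc]
    _ = _ := by
        rw [h2, Matrix.mul_sub, Matrix.mul_sub, Matrix.mul_smul, Matrix.mul_smul, pow_succ]
        simp only [Matrix.mul_assoc]

/-! ### Coefficients with respect to an eigenbasis -/

section spectral

variable {N : ℕ} {A : Matrix (Fin N) (Fin N) ℂ} (hA : A.IsHermitian)

/-- The coefficient of a vector with respect to the `i`-th eigenvector. -/
noncomputable def specCoeff (i : Fin N) : (Fin N → ℂ) →ₗ[ℂ] ℂ where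
  toFun x := inner ℂ (hA.eigenvectorBasis i) (WithLp.toLp 2 x)
  map_add' x y := by rw [WithLp.toLp_add, inner_add_right]
  map_smul' c x := by rw [WithLp.toLp_smul, inner_smul_right]; rfl

theorem specCoeff_mulVec (i : Fin N) (x : Fin N → ℂ) :
    specCoeff hA i (A *ᵥ x) = hA.eigenvalues i * specCoeff hA i x := by
  have h1 := (Matrix.isSymmetric_toEuclideanLin_iff.2 hA) (hA.eigenvectorBasis i) (WithLp.toLp 2 x)
  have h2 : Matrix.toEuclideanLin A (hA.eigenvectorBasis i) =
      (hA.eigenvalues i : ℂ) • hA.eigenvectorBasis i := by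
    have := hA.mulVec_eigenvectorBasis i
    apply (WithLp.ofLp_injective 2)
    refine this.trans ?_
    ext k; simp
  rw [h2, inner_smul_left, Complex.conj_ofReal] at h1
  exact h1.symm

theorem sum_norm_specCoeff_sq (x : Fin N → ℂ) :
    ∑ i, ‖specCoeff hA i x‖ ^ 2 = ‖(WithLp.toLp 2 x : EuclideanSpace ℂ (Fin N))‖ ^ 2 :=
  hA.eigenvectorBasis.sum_sq_norm_inner_right _

theorem norm_le_of_specCoeff_le {x y : Fin N → ℂ} {B : ℝ} (hB : 0 ≤ B)
    (h : ∀ i, ‖specCoeff hA i y‖ ≤ B * ‖specCoeff hA i x‖) :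
    ‖(WithLp.toLp 2 y : EuclideanSpace ℂ (Fin N))‖ ≤
      B * ‖(WithLp.toLp 2 x : EuclideanSpace ℂ (Fin N))‖ := by
  refine le_of_sq_le_sq ?_ (by positivity)
  rw [mul_pow, ← sum_norm_specCoeff_sq hA, ← sum_norm_specCoeff_sq hA, Finset.mul_sum]
  refine Finset.sum_le_sum fun i _ => ?_
  rw [← mul_pow]
  gcongr
  exact h i

theorem abs_eigenvalues_le (i : Fin N) :
    |hA.eigenvalues i| ≤ ‖Matrix.toEuclideanCLM (n := Fin N) (𝕜 := ℂ) A‖ := by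
  have h := (Matrix.toEuclideanCLM (n := Fin N) (𝕜 := ℂ) A).le_opNorm (hA.eigenvectorBasis i)
  have h2 : Matrix.toEuclideanCLM (n := Fin N) (𝕜 := ℂ) A (hA.eigenvectorBasis i) =
      (hA.eigenvalues i : ℂ) • hA.eigenvectorBasis i := by
    apply (WithLp.ofLp_injective 2)
    refine (hA.mulVec_eigenvectorBasis i).trans ?_
    ext k; simp
  rw [h2, norm_smul, hA.eigenvectorBasis.norm_eq_one, mul_one, mul_one, Complex.norm_real] at h
  exact h

theorem opNorm_le_of_eigenvalues {B : ℝ} (hB : 0 ≤ B) (h : ∀ i, |hA.eigenvalues i| ≤ B) :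
    ‖Matrix.toEuclideanCLM (n := Fin N) (𝕜 := ℂ) A‖ ≤ B := by
  refine ContinuousLinearMap.opNorm_le_bound _ hB fun x => ?_
  refine norm_le_of_specCoeff_le hA (x := x.ofLp) (y := A *ᵥ x.ofLp) hB fun i => ?_
  rw [specCoeff_mulVec, norm_mul, Complex.norm_real]
  gcongr
  exact h i

theorem norm_entry_le (A : Matrix (Fin N) (Fin N) ℂ) (i j : Fin N) :
    ‖A i j‖ ≤ ‖Matrix.toEuclideanCLM (n := Fin N) (𝕜 := ℂ) A‖ := by
  have h := (Matrix.toEuclideanCLM (n := Fin N) (𝕜 := ℂ) A).le_opNorm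
    (EuclideanSpace.single j 1)
  rw [PiLp.norm_single, norm_one, mul_one] at h
  refine le_trans ?_ h
  have h2 := PiLp.norm_apply_le (Matrix.toEuclideanCLM (n := Fin N) (𝕜 := ℂ) A
    (EuclideanSpace.single j 1)) i
  refine le_trans (le_of_eq ?_) h2
  rw [Matrix.ofLp_toEuclideanCLM]
  simp

/-- For `‖A‖ = 1`, all eigenvalues have modulus between `1 / κ` and `1`. -/
theorem eigenvalue_bounds [NeZero N] {κ : ℝ} (hdet : IsUnit A.det)
    (hnorm : ‖Matrix.toEuclideanCLM (n := Fin N) (𝕜 := ℂ) A‖ = 1) (hκ : condNumber hA ≤ κ) :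
    1 ≤ κ ∧ ∀ i, 1 / κ ≤ |hA.eigenvalues i| ∧ |hA.eigenvalues i| ≤ 1 := by
  have hle : ∀ i, |hA.eigenvalues i| ≤ 1 := fun i => hnorm ▸ abs_eigenvalues_le hA i
  have hne : ∀ i, hA.eigenvalues i ≠ 0 := by
    intro i h
    apply hdet.ne_zero
    rw [hA.det_eq_prod_eigenvalues]
    exact Finset.prod_eq_zero (Finset.mem_univ i) (by simp [h])
  have hbdd : BddAbove (Set.range fun i => |hA.eigenvalues i|) := Set.finite_range _ |>.bddAbove
  have hbddb : BddBelow (Set.range fun i => |hA.eigenvalues i|) := Set.finite_range _ |>.bddBelow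
  -- Because `‖A‖ = 1` the largest modulus of an eigenvalue is at least one, so the bound on the
  -- condition number controls the smallest one.
  have hsup : 1 ≤ ⨆ i, |hA.eigenvalues i| := by
    rw [← hnorm]
    exact opNorm_le_of_eigenvalues hA (Real.iSup_nonneg fun i => abs_nonneg _)
      fun i => le_ciSup hbdd i
  obtain ⟨i₀, hi₀⟩ := exists_eq_ciInf_of_finite (f := fun i => |hA.eigenvalues i|)
  have hinf0 : 0 < ⨅ i, |hA.eigenvalues i| := hi₀ ▸ abs_pos.2 (hne i₀)
  have hinf1 : ⨅ i, |hA.eigenvalues i| ≤ 1 := hi₀ ▸ hle i₀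
  have h1 : 1 ≤ κ * ⨅ i, |hA.eigenvalues i| := by
    rw [condNumber, div_le_iff₀ hinf0] at hκ
    linarith
  have hκ1 : 1 ≤ κ := by
    by_contra! h
    rcases le_total κ 0 with h0 | h0
    · nlinarith
    · nlinarith
  refine ⟨hκ1, fun i => ⟨?_, hle i⟩⟩
  rw [div_le_iff₀' (by linarith)]
  exact h1.trans (by gcongr; exact ciInf_le hbddb i)

/-- The matrix recursion becomes `cos((n+2)θ) = 2 cos((n+1)θ) cos θ - cos nθ` in each
eigencoordinate. -/
theorem specCoeff_compression_pow {ι : Type} [Fintype ι] [DecidableEq ι] {S W : Matrix ι ι ℂ}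
    {T : Matrix ι (Fin N) ℂ} {d : ℕ} (hS : S * S = 1) (hT : Tᴴ * T = 1)
    (hW : W = S * ((2 : ℂ) • (T * Tᴴ) - 1)) (hH : Tᴴ * S * T = ((d : ℂ)⁻¹) • A) (i : Fin N)
    {θ : ℝ} (hθ : Real.cos θ = hA.eigenvalues i / d) (n : ℕ) (x : Fin N → ℂ) :
    specCoeff hA i ((Tᴴ * W ^ n * T) *ᵥ x) = Real.cos (n * θ) * specCoeff hA i x := by
  have hHx : ∀ x, specCoeff hA i ((Tᴴ * S * T) *ᵥ x) = Real.cos θ * specCoeff hA i x := by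
    intro x
    rw [hH, Matrix.smul_mulVec, map_smul, specCoeff_mulVec, hθ, smul_eq_mul]
    push_cast; ring
  induction n using Nat.twoStepInduction generalizing x with
  | zero => simp [hT]
  | one =>
    have h1 : W * T = S * T := by
      rw [hW, Matrix.mul_assoc, Matrix.sub_mul, Matrix.smul_mul, Matrix.mul_assoc T, hT,
        Matrix.mul_one, Matrix.one_mul, two_smul, add_sub_cancel_right]
    rw [pow_one, Matrix.mul_assoc, h1, ← Matrix.mul_assoc, hHx]
    simp
  | more n ih1 ih2 =>
    rw [compression_pow_add_two hS hT hW, Matrix.sub_mulVec, Matrix.smul_mulVec,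
      ← Matrix.mulVec_mulVec, map_sub, map_smul, ih1, ih2, hHx, smul_eq_mul]
    have h2 : Real.cos (((n + 2 : ℕ) : ℝ) * θ) =
        2 * Real.cos (((n + 1 : ℕ) : ℝ) * θ) * Real.cos θ - Real.cos (n * θ) := by
      have e1 : ((n + 2 : ℕ) : ℝ) * θ = ((n + 1 : ℕ) : ℝ) * θ + θ := by push_cast; ring
      have e2 : (n : ℝ) * θ = ((n + 1 : ℕ) : ℝ) * θ - θ := by push_cast; ring
      rw [e1, e2, Real.cos_add, Real.cos_sub]
      ring
    rw [h2]
    push_cast; ring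

end spectral

/-! ### The state produced by one run of the circuit -/

section step

variable {N d w : ℕ} [NeZero N] {κ ε : ℝ} (O : Oracles N w) (decode : Bits w → ℂ)

theorem walkInit_mulVec_walkStart_apply (v : WalkReg N w → ℂ) (i : Fin N) :
    ((walkInit N w)ᴴ *ᵥ v) i = v (walkStart i) := by
  simp [Matrix.mulVec, dotProduct, walkInit]

theorem walkW_eq : walkW O d decode = walkS decode *
    ((2 : ℂ) • (walkIso O d decode * (walkIso O d decode)ᴴ) - 1) := by
  have hT := Matrix.mem_unitaryGroup_iff.1 (walkT_mem_unitaryGroup O d decode)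
  rw [Matrix.star_eq_conjTranspose] at hT
  rw [walkW, walkIso, Matrix.conjTranspose_mul, Matrix.mul_sub, Matrix.sub_mul, Matrix.mul_one, hT]
  simp only [Matrix.mul_assoc, Matrix.smul_mul, Matrix.mul_smul]

theorem walkIso_conjTranspose_mul :
    (walkIso O d decode)ᴴ * walkIso O d decode = 1 := by
  have hT := Matrix.mem_unitaryGroup_iff'.1 (walkT_mem_unitaryGroup O d decode)
  rw [Matrix.star_eq_conjTranspose] at hT
  rw [walkIso, Matrix.conjTranspose_mul, Matrix.mul_assoc, ← Matrix.mul_assoc _ (walkT O d decode),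
    hT, Matrix.one_mul, walkInit_conjTranspose_mul]

/-- The part of the circuit between the preparations of the control register. -/
theorem eval_stepCircuit : Circuit.eval O (stepCircuit N w d κ ε decode) =
    onCtrl (ctrlPrep (ctrlQubits d κ ε) d κ ε)ᴴ *
      (ctrlDiag (fun c => (-1 : ℂ) ^ (c : ℕ) •
        ((walkT O d decode)ᴴ * walkW O d decode ^ (2 * (c : ℕ) + 1) * walkT O d decode)) *
      (onCtrl (ctrlPrep (ctrlQubits d κ ε) d κ ε) * onSystem O.prep)) := by
  have hphase : (labelOp id fun r => (-1) ^ (r.1 : ℕ) : Op (ctrlQubits d κ ε) N w) =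
      ctrlDiag fun c => (-1 : ℂ) ^ (c : ℕ) • (1 : Matrix (WalkReg N w) (WalkReg N w) ℂ) := by
    refine (labelOp_eq (fun _ r => r) fun c _ => (-1) ^ (c : ℕ)).trans ?_
    congr 1
    funext c
    ext r r'
    simp [labelMatrix, Matrix.one_apply]
  have htrue : Circuit.eval O (walkCircuit (ctrlQubits d κ ε) N w d decode fun _ => true) =
      ctrlDiag fun _ => walkW O d decode := by
    rw [eval_walkCircuit]; simp
  rw [stepCircuit]
  simp only [Circuit.eval_append, eval_isometryCircuit, Circuit.eval_inv, eval_controlledPowers,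
    htrue, Circuit.eval, Instr.eval, hphase, ctrlDiag_conjTranspose, Matrix.one_mul,
    Matrix.mul_assoc]
  congr 1
  simp only [← Matrix.mul_assoc, ctrlDiag_mul]
  congr 2
  congr 1
  funext c
  rw [Matrix.smul_mul, Matrix.smul_mul, Matrix.smul_mul, Matrix.smul_mul, Matrix.one_mul,
    pow_succ']
  simp only [Matrix.mul_assoc]

theorem jZero_lt_two_pow (d : ℕ) (κ ε : ℝ) : jZero d κ ε < 2 ^ ctrlQubits d κ ε :=
  Nat.lt_pow_succ_log_self (by norm_num) _

theorem coeff_eq_zero {j : ℕ} (h : jZero d κ ε < j) : coeff d κ ε j = 0 := by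
  rw [coeff, if_neg (by omega)]

theorem sum_ctrl_eq {M : Type} [AddCommMonoid M] (f : ℕ → M)
    (hf : ∀ j, jZero d κ ε < j → f j = 0) :
    ∑ c : Fin (2 ^ ctrlQubits d κ ε), f c = ∑ j ∈ Finset.range (jZero d κ ε + 1), f j := by
  rw [Fin.sum_univ_eq_sum_range f]
  refine (Finset.sum_subset ?_ fun j _ hj => hf j ?_).symm
  · exact Finset.range_subset_range.2 (jZero_lt_two_pow d κ ε)
  · simpa using hj

theorem sum_coeff_div_alpha (hα : 0 < alpha d κ ε) :
    ∑ c : Fin (2 ^ ctrlQubits d κ ε), Real.sqrt (coeff d κ ε c / alpha d κ ε) ^ 2 = 1 := by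
  have h : ∀ c : Fin (2 ^ ctrlQubits d κ ε), Real.sqrt (coeff d κ ε c / alpha d κ ε) ^ 2 =
      coeff d κ ε c / alpha d κ ε := fun c =>
    Real.sq_sqrt (div_nonneg (coeff_nonneg _ _ _ _) hα.le)
  simp only [h]
  rw [sum_ctrl_eq (fun j => coeff d κ ε j / alpha d κ ε) fun j hj => by
    rw [coeff_eq_zero hj, zero_div], ← Finset.sum_div, ← alpha_eq_sum_coeff, div_self hα.ne']

/-- The branch `c` enters with the amplitude `V c 0` and is projected back with its conjugate, so
its weight is the square `α_c/α`. Projecting the walk ancillas to zero at both ends turns `T_U` into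
`T`. -/
theorem goodPart_zero_apply (hα : 0 < alpha d κ ε) {b : EuclideanSpace ℂ (Fin N)}
    (hprep : ∀ j, O.prep j 0 = b j) :
    (goodPart O (stepCircuit N w d κ ε decode) 0).ofLp =
      ∑ c : Fin (2 ^ ctrlQubits d κ ε), ((coeff d κ ε c / alpha d κ ε : ℝ) : ℂ) •
        (-1 : ℂ) ^ (c : ℕ) • (((walkIso O d decode)ᴴ * walkW O d decode ^ (2 * (c : ℕ) + 1) *
          walkIso O d decode) *ᵥ b.ofLp) := by
  set V := ctrlPrep (ctrlQubits d κ ε) d κ ε with hV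
  have hV0 : ∀ c, V c 0 = (Real.sqrt (coeff d κ ε c / alpha d κ ε) : ℂ) := fun c =>
    prepReal_apply _ _ (sum_coeff_div_alpha hα) c
  set M : Fin (2 ^ ctrlQubits d κ ε) → Matrix (WalkReg N w) (WalkReg N w) ℂ := fun c =>
    (-1 : ℂ) ^ (c : ℕ) •
      ((walkT O d decode)ᴴ * walkW O d decode ^ (2 * (c : ℕ) + 1) * walkT O d decode) with hM
  have hcol : ∀ r : Reg (ctrlQubits d κ ε) N w,
      (onSystem O.prep : Op (ctrlQubits d κ ε) N w) r (start _ N w) =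
      if r.1 = 0 then (walkInit N w *ᵥ b.ofLp) r.2 else 0 := by
    intro r
    have h1 : (walkInit N w *ᵥ b.ofLp) r.2 = if r.2.1.2 = false ∧
        r.2.2 = ((0, false), fun _ => false) then b r.2.1.1 else 0 := by
      rw [Matrix.mulVec, dotProduct, Finset.sum_eq_single r.2.1.1]
      · simp [walkInit, walkStart, Prod.ext_iff]
      · intro j _ hj
        simp [walkInit, eq_walkStart_iff, Ne.symm hj]
      · simp
    rw [h1]
    simp only [onSystem, start, Matrix.of_apply, hprep, ite_and]
  have hentry : ∀ r, Circuit.eval O (stepCircuit N w d κ ε decode) r (start _ N w) =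
      ((onCtrl Vᴴ : Op (ctrlQubits d κ ε) N w) *ᵥ (ctrlDiag M *ᵥ ((onCtrl V :
        Op (ctrlQubits d κ ε) N w) *ᵥ fun q => onSystem O.prep q (start _ N w)))) r := by
    intro r
    rw [eval_stepCircuit]
    rfl
  have hV1 : ∀ r : Reg (ctrlQubits d κ ε) N w, ((onCtrl V : Op (ctrlQubits d κ ε) N w) *ᵥ
      fun q => onSystem O.prep q (start _ N w)) r = V r.1 0 * (walkInit N w *ᵥ b.ofLp) r.2 := by
    intro r
    rw [onCtrl_eq, fiberMatrix_mulVec, Finset.sum_eq_single 0]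
    · rw [hcol]; simp
    · intro y _ hy
      rw [hcol]; simp [hy]
    · simp
  have hM1 : ∀ r : Reg (ctrlQubits d κ ε) N w, (ctrlDiag M *ᵥ
      ((onCtrl V : Op (ctrlQubits d κ ε) N w) *ᵥ
      fun q => onSystem O.prep q (start _ N w))) r =
      V r.1 0 * ((M r.1 * walkInit N w) *ᵥ b.ofLp) r.2 := by
    intro r
    rw [ctrlDiag_mulVec]
    simp only [hV1]
    have : (fun q => V r.1 0 * (walkInit N w *ᵥ b.ofLp) q) = V r.1 0 • (walkInit N w *ᵥ b.ofLp) :=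
      rfl
    rw [this, Matrix.mulVec_smul, Matrix.mulVec_mulVec]
    rfl
  ext i
  have h0 : (goodPart O (stepCircuit N w d κ ε decode) 0).ofLp i =
      Circuit.eval O (stepCircuit N w d κ ε decode) (0, walkStart i) (start _ N w) := by
    simp [goodPart, amplifierPow, walkStart]
  rw [h0, hentry, onCtrl_eq, fiberMatrix_mulVec, Finset.sum_apply]
  refine Finset.sum_congr rfl fun c _ => ?_
  rw [hM1]
  have h1 : ((M c * walkInit N w) *ᵥ b.ofLp) (walkStart i) =
      ((-1 : ℂ) ^ (c : ℕ) • (((walkIso O d decode)ᴴ * walkW O d decode ^ (2 * (c : ℕ) + 1) *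
          walkIso O d decode) *ᵥ b.ofLp)) i := by
    rw [← walkInit_mulVec_walkStart_apply ((M c * walkInit N w) *ᵥ b.ofLp), Matrix.mulVec_mulVec,
      ← Matrix.smul_mulVec]
    congr 2
    rw [hM, Matrix.smul_mul, Matrix.mul_smul, walkIso, Matrix.conjTranspose_mul]
    simp only [Matrix.mul_assoc]
  have h2 : Vᴴ 0 c * V c 0 = ((coeff d κ ε c / alpha d κ ε : ℝ) : ℂ) := by
    rw [Matrix.conjTranspose_apply, hV0, RCLike.star_def, Complex.conj_ofReal, ← Complex.ofReal_mul,
      Real.mul_self_sqrt (div_nonneg (coeff_nonneg _ _ _ _) hα.le)]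
  simp only [Equiv.prodComm_apply, Prod.swap_prod_mk, Equiv.prodComm_symm, h1]
  rw [← mul_assoc, h2]
  rfl

/-- The coefficients of the state produced by one run of the circuit. -/
theorem specCoeff_goodPart_zero {A : Matrix (Fin N) (Fin N) ℂ} {b : EuclideanSpace ℂ (Fin N)}
    (hA : A.IsHermitian) (hnorm : ‖Matrix.toEuclideanCLM (n := Fin N) (𝕜 := ℂ) A‖ = 1)
    (hα : 0 < alpha d κ ε) (hd : 0 < d) (hdN : d ≤ N) (hdec : Function.Injective decode)
    (hO : O.Specifies decode d A b) (i : Fin N) {θ : ℝ}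
    (hθ : Real.cos θ = hA.eigenvalues i / d) :
    specCoeff hA i (goodPart O (stepCircuit N w d κ ε decode) 0).ofLp =
      ((chebApprox d κ ε θ / alpha d κ ε : ℝ) : ℂ) * specCoeff hA i b.ofLp := by
  have hH := compression_apply hA (fun i j => hnorm ▸ norm_entry_le A i j) hd hdN hdec hO
  rw [goodPart_zero_apply O decode hα hO.prep_zero, map_sum]
  simp only [map_smul, smul_eq_mul, specCoeff_compression_pow hA (walkS_mul_self hdec)
    (walkIso_conjTranspose_mul O decode) (walkW_eq O decode) hH i hθ]
  rw [sum_ctrl_eq (fun j => ((coeff d κ ε j / alpha d κ ε : ℝ) : ℂ) * ((-1) ^ j *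
    (Real.cos ((2 * j + 1 : ℕ) * θ) * specCoeff hA i b.ofLp))) fun j hj => by
      rw [coeff_eq_zero hj]; simp]
  rw [chebApprox, Finset.sum_div, Complex.ofReal_sum, Finset.sum_mul]
  refine Finset.sum_congr rfl fun j _ => ?_
  push_cast
  ring

end step

/-! ### Unitarity of the circuit and its number of queries -/

section unitarity

variable {m N d w : ℕ} {κ ε : ℝ} {decode : Bits w → ℂ}

theorem onCtrl_mem_unitaryGroup {U : Matrix (Fin (2 ^ m)) (Fin (2 ^ m)) ℂ}
    (h : U ∈ Matrix.unitaryGroup (Fin (2 ^ m)) ℂ) :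
    (onCtrl U : Op m N w) ∈ Matrix.unitaryGroup (Reg m N w) ℂ := by
  rw [onCtrl_eq]; exact fiberMatrix_mem_unitaryGroup _ _ fun _ => h

theorem onSystem_mem_unitaryGroup {U : Matrix (Fin N) (Fin N) ℂ}
    (h : U ∈ Matrix.unitaryGroup (Fin N) ℂ) :
    (onSystem U : Op m N w) ∈ Matrix.unitaryGroup (Reg m N w) ℂ := by
  rw [onSystem_eq]
  exact ctrlDiag_mem_unitaryGroup _ fun _ => fiberMatrix_mem_unitaryGroup _ _ fun _ => h

theorem phase_mem_unitaryGroup {φ : Reg m N w → ℂ} (h : ∀ r, ‖φ r‖ = 1) :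
    (labelOp id φ : Op m N w) ∈ Matrix.unitaryGroup (Reg m N w) ℂ :=
  labelMatrix_mem_unitaryGroup Function.injective_id h

variable [NeZero N]

theorem isUnitary_isometryCircuit (decode : Bits w → ℂ) :
    (isometryCircuit m N w d decode).IsUnitary := by
  intro U hU
  simp only [isometryCircuit, List.mem_cons, Instr.gate.injEq, reduceCtorEq, List.not_mem_nil,
    or_false, false_or] at hU
  rcases hU with rfl | rfl
  · rw [onIndex_eq]
    exact ctrlDiag_mem_unitaryGroup _ fun _ =>
      fiberMatrix_mem_unitaryGroup _ _ fun _ => prepReal_mem_unitaryGroup _ _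
  · rw [onFlag_eq]
    exact ctrlDiag_mem_unitaryGroup _ fun _ =>
      fiberMatrix_mem_unitaryGroup _ _ fun _ => entryRotation_mem_unitaryGroup _

theorem isUnitary_walkCircuit (hdec : Function.Injective decode) (active : Fin (2 ^ m) → Bool) :
    (walkCircuit m N w d decode active).IsUnitary := by
  refine Circuit.isUnitary_append (Circuit.isUnitary_append (Circuit.isUnitary_append
    (Circuit.isUnitary_inv (isUnitary_isometryCircuit decode)) (Circuit.isUnitary_gate ?_))
    (isUnitary_isometryCircuit decode)) (Circuit.isUnitary_gate ?_)
  · refine phase_mem_unitaryGroup fun r => ?_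
    split_ifs <;> simp
  · rw [swapOp_eq]
    refine ctrlDiag_mem_unitaryGroup _ fun c => ?_
    split_ifs
    · exact walkS_mem_unitaryGroup hdec
    · exact one_mem _

theorem isUnitary_stepCircuit (hdec : Function.Injective decode) :
    (stepCircuit N w d κ ε decode).IsUnitary := by
  have hV : ctrlPrep (ctrlQubits d κ ε) d κ ε ∈ Matrix.unitaryGroup _ ℂ :=
    prepReal_mem_unitaryGroup _ _
  refine Circuit.isUnitary_append (Circuit.isUnitary_append (Circuit.isUnitary_append
    (Circuit.isUnitary_append (Circuit.isUnitary_append ?_ (isUnitary_isometryCircuit decode)) ?_)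
    (isUnitary_walkCircuit hdec _)) (Circuit.isUnitary_inv (isUnitary_isometryCircuit decode))) ?_
  · intro U hU
    simp only [List.mem_cons, Instr.gate.injEq, reduceCtorEq, List.not_mem_nil, or_false,
      false_or] at hU
    rw [hU]
    exact onCtrl_mem_unitaryGroup hV
  · intro U hU
    obtain ⟨i, _, hi⟩ := List.mem_flatMap.1 hU
    refine Circuit.isUnitary_flatten (fun 𝒞 h𝒞 => ?_) U hi
    rw [List.eq_of_mem_replicate h𝒞]
    exact isUnitary_walkCircuit hdec _
  · intro U hU
    simp only [List.mem_cons, Instr.gate.injEq, List.not_mem_nil, or_false] at hU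
    rcases hU with rfl | rfl
    · exact phase_mem_unitaryGroup fun r => by simp
    · exact onCtrl_mem_unitaryGroup (Unitary.star_mem hV)

theorem eval_stepCircuit_mem_unitaryGroup (hdec : Function.Injective decode) {O : Oracles N w}
    (hprep : O.prep ∈ Matrix.unitaryGroup (Fin N) ℂ) :
    Circuit.eval O (stepCircuit N w d κ ε decode) ∈ Matrix.unitaryGroup _ ℂ := by
  refine Circuit.eval_mem_unitaryGroup O fun g hg => ?_
  have hF : (oracleFOp O : Op (ctrlQubits d κ ε) N w) ∈ Matrix.unitaryGroup _ ℂ := by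
    rw [oracleFOp_eq]; exact ctrlDiag_mem_unitaryGroup _ fun _ => walkOracleF_mem_unitaryGroup O
  cases g with
  | gate U => exact isUnitary_stepCircuit hdec U hg
  | oracleF i =>
    cases i
    · exact hF
    · exact Unitary.star_mem hF
  | oracleA =>
    rw [Instr.eval, oracleAOp_eq]
    exact ctrlDiag_mem_unitaryGroup _ fun _ => walkOracleA_mem_unitaryGroup O
  | prepB i =>
    cases i
    · exact onSystem_mem_unitaryGroup hprep
    · exact Unitary.star_mem (onSystem_mem_unitaryGroup hprep)

theorem countP_walkCircuit (p : Instr m N w → Bool) (hp : ∀ g, p g.inv = p g)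
    (hgate : ∀ U, p (.gate U) = false) (h1 : (isometryCircuit m N w d decode).countP p = 1)
    (active : Fin (2 ^ m) → Bool) : (walkCircuit m N w d decode active).countP p = 2 := by
  simp [walkCircuit, List.countP_append, Circuit.countP_inv p hp, h1, hgate]

/-- The bit `i` costs `2 · 2^{i+1}` queries, in total `4 (2^m - 1)`. The missing `4` is the rest of
the circuit in `countP_stepCircuit`: the last walk step uses two queries, `T_U` and `T_U†` one each.
-/
theorem countP_controlledPowers (p : Instr m N w → Bool) (hp : ∀ g, p g.inv = p g)
    (hgate : ∀ U, p (.gate U) = false) (h1 : (isometryCircuit m N w d decode).countP p = 1) :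
    (controlledPowers m N w d decode).countP p + 4 = 4 * 2 ^ m := by
  have h : ∀ n, ((List.range n).flatMap fun i => (List.replicate (2 ^ (i + 1))
      (walkCircuit m N w d decode fun j => (j : ℕ).testBit i)).flatten).countP p + 4 =
      4 * 2 ^ n := by
    intro n
    induction n with
    | zero => simp
    | succ n ih =>
      rw [List.range_succ, List.flatMap_append, List.countP_append, List.flatMap_singleton,
        countP_flatten_replicate, countP_walkCircuit p hp hgate h1, pow_succ]
      omega
  exact h m

theorem countP_stepCircuit (p : Instr (ctrlQubits d κ ε) N w → Bool) (hp : ∀ g, p g.inv = p g)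
    (hgate : ∀ U, p (.gate U) = false) (hprep : ∀ i, p (.prepB i) = false)
    (h1 : (isometryCircuit (ctrlQubits d κ ε) N w d decode).countP p = 1) :
    (stepCircuit N w d κ ε decode).countP p = 8 * 2 ^ Nat.log 2 (jZero d κ ε) := by
  have h2 := countP_controlledPowers (decode := decode) p hp hgate h1
  have h3 : 2 ^ ctrlQubits d κ ε = 2 * 2 ^ Nat.log 2 (jZero d κ ε) := by
    rw [ctrlQubits, pow_succ, mul_comm]
  simp only [stepCircuit, List.countP_append, List.countP_cons, List.countP_nil, hgate, hprep, h1,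
    countP_walkCircuit p hp hgate h1, Circuit.countP_inv p hp]
  simp only [Bool.false_eq_true, if_false]
  omega

theorem queriesF_stepCircuit : (stepCircuit N w d κ ε decode).queriesF =
    8 * 2 ^ Nat.log 2 (jZero d κ ε) :=
  countP_stepCircuit _ (fun g => by cases g <;> rfl) (fun _ => rfl) (fun _ => rfl)
    rfl

theorem queriesA_stepCircuit : (stepCircuit N w d κ ε decode).queriesA =
    8 * 2 ^ Nat.log 2 (jZero d κ ε) :=
  countP_stepCircuit _ (fun g => by cases g <;> rfl) (fun _ => rfl) (fun _ => rfl)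
    rfl

theorem countP_amplifierPow (p : Instr m N w → Bool) (hp : ∀ g, p g.inv = p g)
    (hgate : ∀ U, p (.gate U) = false) (𝒜 : Circuit m N w) (j : ℕ) :
    (amplifierPow 𝒜 j).countP p = j * (2 * 𝒜.countP p) := by
  rw [amplifierPow, countP_flatten_replicate]
  congr 1
  simp only [amplifier, List.countP_append, List.countP_cons, List.countP_nil, hgate,
    Circuit.countP_inv p hp]
  simp only [Bool.false_eq_true, if_false]
  omega

end unitarity

/-! ### Amplitude amplification -/

section amplification

variable {m N w : ℕ} [NeZero N] (O : Oracles N w) (𝒜 : Circuit m N w)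

/-- The state `𝒜 |0⟩`. -/
noncomputable def outState (r : Reg m N w) : ℂ := Circuit.eval O 𝒜 r (start m N w)

open Classical in
/-- The projection of `𝒜 |0⟩` to the good subspace. -/
noncomputable def goodState (r : Reg m N w) : ℂ := if ancZero r then outState O 𝒜 r else 0

theorem sum_ancZero {M : Type} [AddCommMonoid M] (F : Reg m N w → M)
    (h : ∀ r, ¬ ancZero r → F r = 0) : ∑ r, F r = ∑ i : Fin N, F (0, walkStart i) := by
  refine (Fintype.sum_of_injective (fun i : Fin N => ((0, walkStart i) : Reg m N w)) ?_ _ _ ?_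
    fun _ => rfl).symm
  · intro i j hij
    simpa [walkStart] using hij
  · intro r hr
    refine h r fun h' => hr ⟨r.2.1.1, ?_⟩
    obtain ⟨h1, h2, h3⟩ := h'
    exact Prod.ext h1.symm (((eq_walkStart_iff r.2 r.2.1.1).2 ⟨rfl, h2, h3⟩).symm)

theorem ancZero_walkStart (i : Fin N) : ancZero ((0, walkStart i) : Reg m N w) :=
  ⟨rfl, rfl, rfl⟩

theorem goodPart_zero_eq (i : Fin N) : goodPart O 𝒜 0 i = outState O 𝒜 (0, walkStart i) := by
  simp [goodPart, amplifierPow, outState, walkStart]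

theorem goodPart_apply (j : ℕ) (i : Fin N) : goodPart O 𝒜 j i =
    (Circuit.eval O (amplifier 𝒜) ^ j *ᵥ outState O 𝒜) (0, walkStart i) := by
  change Circuit.eval O (𝒜 ++ amplifierPow 𝒜 j) (0, walkStart i) (start m N w) = _
  rw [Circuit.eval_append, amplifierPow, Circuit.eval_flatten_replicate]
  rfl

theorem star_outState_dotProduct_goodState :
    star (outState O 𝒜) ⬝ᵥ goodState O 𝒜 = (successProb O 𝒜 0 : ℂ) := by
  rw [dotProduct, sum_ancZero _ fun r hr => by simp [goodState, hr], successProb,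
    EuclideanSpace.norm_sq_eq, Complex.ofReal_sum]
  refine Finset.sum_congr rfl fun i _ => ?_
  rw [goodState, if_pos (ancZero_walkStart i), Pi.star_apply, RCLike.star_def,
    ← Complex.normSq_eq_conj_mul_self, Complex.normSq_eq_norm_sq, goodPart_zero_eq]

variable {O 𝒜}

theorem star_outState_dotProduct_self
    (hU : Circuit.eval O 𝒜 ∈ Matrix.unitaryGroup (Reg m N w) ℂ) :
    star (outState O 𝒜) ⬝ᵥ outState O 𝒜 = 1 := by
  have h := congrFun (congrFun (Matrix.mem_unitaryGroup_iff'.1 hU) (start m N w)) (start m N w)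
  rw [Matrix.one_apply_eq] at h
  exact h

/-- The amplification step on the span of the state and its good part. -/
theorem eval_amplifier_mulVec (hU : Circuit.eval O 𝒜 ∈ Matrix.unitaryGroup (Reg m N w) ℂ)
    (a b : ℂ) :
    Circuit.eval O (amplifier 𝒜) *ᵥ (a • outState O 𝒜 + b • goodState O 𝒜) =
      ((4 * successProb O 𝒜 0 - 1) * a + 2 * successProb O 𝒜 0 * b) • outState O 𝒜 +
        (-2 * a - b) • goodState O 𝒜 := by
  classical
  set ψ := outState O 𝒜
  set g := goodState O 𝒜
  set q : ℂ := ((successProb O 𝒜 0 : ℝ) : ℂ)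
  set G := Circuit.eval O 𝒜
  set s := start m N w
  have hGG : G * Gᴴ = 1 := by
    rw [← Matrix.star_eq_conjTranspose]; exact Matrix.mem_unitaryGroup_iff.1 hU
  have hSf : ∀ (φ : Reg m N w → ℂ) (v : Reg m N w → ℂ),
      (labelOp id φ : Op m N w) *ᵥ v = fun r => φ r * v r := by
    intro φ v
    funext r
    exact labelMatrix_mulVec (τ := id) φ (fun _ => rfl) (fun _ => rfl) v r
  -- Conjugated by `𝒜`, the sign flip of the start label is the reflection `1 - 2|ψ⟩⟨ψ|`.
  have hR : ∀ v, G *ᵥ ((labelOp id fun r => if r = s then -1 else 1 : Op m N w) *ᵥ (Gᴴ *ᵥ v)) =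
      v - (2 * (star ψ ⬝ᵥ v)) • ψ := by
    intro v
    have h1 : (labelOp id fun r => if r = s then -1 else 1 : Op m N w) *ᵥ (Gᴴ *ᵥ v) =
        Gᴴ *ᵥ v - (2 * (star ψ ⬝ᵥ v)) • Pi.single s 1 := by
      rw [hSf]
      funext r
      by_cases hr : r = s
      · have : (Gᴴ *ᵥ v) s = star ψ ⬝ᵥ v := rfl
        simp [hr, this]; ring
      · simp [hr]
    have h2 : G *ᵥ Pi.single s 1 = ψ := by
      funext r
      rw [Matrix.mulVec_single_one]; rfl
    rw [h1, Matrix.mulVec_sub, Matrix.mulVec_smul, h2, Matrix.mulVec_mulVec, hGG,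
      Matrix.one_mulVec]
  have hQ : Circuit.eval O (amplifier 𝒜) = G * ((labelOp id fun r => if r = s then -1 else 1) *
      (Gᴴ * labelOp id fun r => if ancZero r then -1 else 1)) := by
    simp only [amplifier, Circuit.eval_append, Circuit.eval_singleton, Circuit.eval_inv,
      Instr.eval]
    congr 3
  have hv : (fun r => (if ancZero r then (-1 : ℂ) else 1) * (a • ψ + b • g) r) =
      a • ψ - (2 * a + b) • g := by
    funext r
    by_cases hr : ancZero r
    · have : g r = ψ r := by simp only [g, goodState, if_pos hr]; rfl
      simp [hr, this]; ring
    · have : g r = 0 := by simp only [g, goodState, if_neg hr]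
      simp [hr, this]
  have hd : star ψ ⬝ᵥ (a • ψ - (2 * a + b) • g) = a - (2 * a + b) * q := by
    rw [dotProduct_sub, dotProduct_smul, dotProduct_smul, star_outState_dotProduct_self hU,
      star_outState_dotProduct_goodState]
    simp [q]
  rw [hQ, ← Matrix.mulVec_mulVec, ← Matrix.mulVec_mulVec, ← Matrix.mulVec_mulVec, hR, hSf, hv, hd]
  funext r
  simp only [Pi.sub_apply, Pi.add_apply, Pi.smul_apply, smul_eq_mul]
  ring

/-- Amplitude amplification is a rotation. -/
theorem goodPart_eq_smul (hU : Circuit.eval O 𝒜 ∈ Matrix.unitaryGroup (Reg m N w) ℂ) {θ : ℝ}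
    (hq : Real.sin θ ^ 2 = successProb O 𝒜 0) (hs : Real.sin θ ≠ 0) (hc : Real.cos θ ≠ 0) (j : ℕ) :
    goodPart O 𝒜 j =
      (((-1) ^ j * (Real.sin ((2 * j + 1) * θ) / Real.sin θ) : ℝ) : ℂ) • goodPart O 𝒜 0 := by
  -- The good component is multiplied by `sin((2j+1)θ)/sin θ` and the complementary one by
  -- `cos((2j+1)θ)/cos θ`. The sign `(-1)^j` appears because `Q` is defined without an overall minus
  -- sign.
  have key : ∀ j : ℕ, Circuit.eval O (amplifier 𝒜) ^ j *ᵥ outState O 𝒜 =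
      (((-1) ^ j * (Real.cos ((2 * j + 1) * θ) / Real.cos θ) : ℝ) : ℂ) • outState O 𝒜 +
      (((-1) ^ j * (Real.sin ((2 * j + 1) * θ) / Real.sin θ) -
        (-1) ^ j * (Real.cos ((2 * j + 1) * θ) / Real.cos θ) : ℝ) : ℂ) • goodState O 𝒜 := by
    intro j
    induction j with
    | zero => simp [div_self hs, div_self hc]
    | succ j ih =>
      rw [pow_succ', ← Matrix.mulVec_mulVec, ih, eval_amplifier_mulVec hU, ← hq]
      set φ := (2 * (j : ℝ) + 1) * θ with hφ
      have e : (2 * ((j + 1 : ℕ) : ℝ) + 1) * θ = φ + 2 * θ := by rw [hφ]; push_cast; ring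
      have hsc := Real.sin_sq_add_cos_sq θ
      have hc2 : Real.cos θ ^ 2 = 1 - Real.sin θ ^ 2 := by linarith
      have h1 : (-1) ^ (j + 1) * (Real.cos (φ + 2 * θ) / Real.cos θ) =
          (4 * Real.sin θ ^ 2 - 1) * ((-1) ^ j * (Real.cos φ / Real.cos θ)) +
          2 * Real.sin θ ^ 2 * ((-1) ^ j * (Real.sin φ / Real.sin θ) -
            (-1) ^ j * (Real.cos φ / Real.cos θ)) := by
        rw [Real.cos_add, Real.sin_two_mul, Real.cos_two_mul, pow_succ, hc2]
        field_simp
        ring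
      have h2 : (-1) ^ (j + 1) * (Real.sin (φ + 2 * θ) / Real.sin θ) -
          (-1) ^ (j + 1) * (Real.cos (φ + 2 * θ) / Real.cos θ) =
          -2 * ((-1) ^ j * (Real.cos φ / Real.cos θ)) -
          ((-1) ^ j * (Real.sin φ / Real.sin θ) - (-1) ^ j * (Real.cos φ / Real.cos θ)) := by
        rw [Real.cos_add, Real.sin_add, Real.sin_two_mul, Real.cos_two_mul, pow_succ]
        field_simp
        linear_combination (-2 * Real.cos θ * Real.sin φ) * hsc
      rw [e, h2, h1]
      push_cast
      rfl
  ext i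
  rw [goodPart_apply, key, PiLp.smul_apply, goodPart_zero_eq]
  simp only [Pi.add_apply, Pi.smul_apply, goodState, if_pos (ancZero_walkStart i), smul_eq_mul]
  push_cast
  ring

theorem successProb_eq (hU : Circuit.eval O 𝒜 ∈ Matrix.unitaryGroup (Reg m N w) ℂ) {θ : ℝ}
    (hq : Real.sin θ ^ 2 = successProb O 𝒜 0) (hs : Real.sin θ ≠ 0) (hc : Real.cos θ ≠ 0) (j : ℕ) :
    successProb O 𝒜 j = Real.sin ((2 * j + 1) * θ) ^ 2 := by
  rw [successProb, goodPart_eq_smul hU hq hs hc, norm_smul, mul_pow,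
    show ‖goodPart O 𝒜 0‖ ^ 2 = successProb O 𝒜 0 from rfl, ← hq, Complex.norm_real,
    Real.norm_eq_abs, sq_abs, mul_pow, ← pow_mul, mul_comm j, pow_mul]
  field_simp
  norm_num

/-- This identifies the failure probability of an actual round with the trigonometric factor in the
series. -/
theorem one_sub_uniformMean_successProb
    (hU : Circuit.eval O 𝒜 ∈ Matrix.unitaryGroup (Reg m N w) ℂ) (h0 : 0 < successProb O 𝒜 0)
    (h1 : successProb O 𝒜 0 < 1) (M : ℕ) :
    1 - uniformMean M (successProb O 𝒜) = 1 - avgProb (successProb O 𝒜 0) M := by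
  set q := successProb O 𝒜 0 with hqdef
  set θ := Real.arcsin (Real.sqrt q) with hθ
  have hsq0 : 0 < Real.sqrt q := Real.sqrt_pos.2 h0
  have hsq1 : Real.sqrt q < 1 := by rw [Real.sqrt_lt' one_pos]; simpa using h1
  have hsin : Real.sin θ = Real.sqrt q := Real.sin_arcsin (by linarith) hsq1.le
  have hcos : 0 < Real.cos θ := by
    rw [hθ, Real.cos_arcsin, Real.sq_sqrt h0.le]
    exact Real.sqrt_pos.2 (by linarith)
  have hs2 : Real.sin (2 * θ) ≠ 0 := by
    rw [Real.sin_two_mul, hsin]; positivity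
  have hq : Real.sin θ ^ 2 = successProb O 𝒜 0 := by rw [hsin, Real.sq_sqrt h0.le]
  rw [one_sub_avgProb, failRate_eq_mean hs2, uniformMean]
  have h2 : ∀ j ∈ Finset.range (M + 1), successProb O 𝒜 j =
      1 - Real.cos ((2 * (j : ℝ) + 1) * θ) ^ 2 := by
    intro j _
    rw [successProb_eq hU hq (hsin ▸ hsq0.ne') hcos.ne', Real.sin_sq]
  rw [Finset.sum_congr rfl h2, Finset.sum_sub_distrib]
  have hM : (M : ℝ) + 1 ≠ 0 := by positivity
  simp only [Finset.sum_const, Finset.card_range, nsmul_eq_mul, mul_one]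
  generalize ∑ j ∈ Finset.range (M + 1), Real.cos ((2 * (j : ℝ) + 1) * θ) ^ 2 = S
  push_cast
  field_simp
  ring

theorem nQAATerm_eq_mul_reachProb
    (hU : Circuit.eval O 𝒜 ∈ Matrix.unitaryGroup (Reg m N w) ℂ) (h0 : 0 < successProb O 𝒜 0)
    (h1 : successProb O 𝒜 0 < 1) (c p₀ : ℝ) (k : ℕ) :
    nQAATerm c (successProb O 𝒜 0) p₀ k = mSeq c p₀ (k + 1) * reachProb O 𝒜 c p₀ k := by
  simp only [nQAATerm, reachProb, one_sub_uniformMean_successProb hU h0 h1]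

theorem reachProb_nonneg (hU : Circuit.eval O 𝒜 ∈ Matrix.unitaryGroup (Reg m N w) ℂ)
    (h0 : 0 < successProb O 𝒜 0) (h1 : successProb O 𝒜 0 < 1) (c p₀ : ℝ) (k : ℕ) :
    0 ≤ reachProb O 𝒜 c p₀ k := by
  refine Finset.prod_nonneg fun l _ => ?_
  rw [one_sub_uniformMean_successProb hU h0 h1, one_sub_avgProb]
  refine failRate_nonneg ?_ _
  have hsq0 : 0 < Real.sqrt (successProb O 𝒜 0) := Real.sqrt_pos.2 h0
  have hsq1 : Real.sqrt (successProb O 𝒜 0) < 1 := by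
    rw [Real.sqrt_lt' one_pos]; simpa using h1
  rw [Real.sin_two_mul, Real.sin_arcsin (by linarith) hsq1.le, Real.cos_arcsin,
    Real.sq_sqrt h0.le]
  have : 0 < Real.sqrt (1 - successProb O 𝒜 0) := Real.sqrt_pos.2 (by linarith)
  positivity

/-- The mean `M/2` of `j` cancels the two runs of `𝒜` in each `Q`, which is why `m_k` enters the
series without a factor. -/
theorem uniformMean_linear (M : ℕ) (u v : ℝ) :
    uniformMean M (fun j => u + j * (2 * v)) = u + v * M := by
  have h : ∀ n : ℕ, ∑ j ∈ Finset.range n, (u + (j : ℝ) * (2 * v)) = n * u + v * (n * (n - 1)) := by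
    intro n
    induction n with
    | zero => simp
    | succ n ih => rw [Finset.sum_range_succ, ih]; push_cast; ring
  rw [uniformMean, h]
  have hM : (M : ℝ) + 1 ≠ 0 := by positivity
  push_cast
  field_simp
  ring

/-- Expected numbers of queries, for queries of one kind. -/
theorem expectedSum_bounds (hU : Circuit.eval O 𝒜 ∈ Matrix.unitaryGroup (Reg m N w) ℂ)
    (h0 : 0 < successProb O 𝒜 0) (h1 : successProb O 𝒜 0 < 1) {c p₀ : ℝ}
    (hm : ∀ k, 1 ≤ mSeq c p₀ k) (hsum : Summable (nQAATerm c (successProb O 𝒜 0) p₀))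
    (p : Instr m N w → Bool) (hp : ∀ g, p g.inv = p g) (hgate : ∀ U, p (.gate U) = false) :
    expectedSum O 𝒜 c p₀ (fun j => (amplifierPow 𝒜 j).countP p) =
      ENNReal.ofReal (𝒜.countP p * nQAA c (successProb O 𝒜 0) p₀) ∧
    expectedSum O 𝒜 c p₀ (fun j => (𝒜 ++ amplifierPow 𝒜 j).countP p) ≤
      ENNReal.ofReal (2 * 𝒜.countP p * nQAA c (successProb O 𝒜 0) p₀) := by
  have hr := reachProb_nonneg hU h0 h1 c p₀
  have hT := nQAATerm_eq_mul_reachProb hU h0 h1 c p₀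
  have hT0 : ∀ k, 0 ≤ nQAATerm c (successProb O 𝒜 0) p₀ k := fun k => by
    rw [hT]; exact mul_nonneg (Nat.cast_nonneg _) (hr k)
  have hcount := countP_amplifierPow p hp hgate 𝒜
  constructor
  · rw [expectedSum, nQAA, ← tsum_mul_left, ENNReal.ofReal_tsum_of_nonneg
      (fun k => mul_nonneg (Nat.cast_nonneg _) (hT0 k)) (hsum.mul_left _)]
    refine tsum_congr fun k => ?_
    rw [← ENNReal.ofReal_mul (hr k), hT]
    congr 1
    have := uniformMean_linear (mSeq c p₀ (k + 1)) 0 (𝒜.countP p)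
    simp only [zero_add] at this
    simp only [hcount]
    push_cast
    rw [this]
    ring
  · rw [expectedSum, nQAA, ← tsum_mul_left, ENNReal.ofReal_tsum_of_nonneg
      (fun k => mul_nonneg (by positivity) (hT0 k)) (hsum.mul_left _)]
    refine ENNReal.tsum_le_tsum fun k => ?_
    rw [← ENNReal.ofReal_mul (hr k), hT]
    refine ENNReal.ofReal_le_ofReal ?_
    have := uniformMean_linear (mSeq c p₀ (k + 1)) (𝒜.countP p) (𝒜.countP p)
    simp only [List.countP_append, hcount]
    push_cast
    rw [this]
    -- As every round has `m_k ≥ 1`, its initial run at most doubles the cost.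
    have hm1 : (1 : ℝ) ≤ mSeq c p₀ (k + 1) := by exact_mod_cast hm (k + 1)
    have hn : (0 : ℝ) ≤ 𝒜.countP p := Nat.cast_nonneg _
    have h3 : (𝒜.countP p : ℝ) ≤ 𝒜.countP p * mSeq c p₀ (k + 1) := le_mul_of_one_le_right hn hm1
    have h4 := mul_le_mul_of_nonneg_left h3 (hr k)
    linarith

/-- Because `m_k ≥ 1`, these probabilities are dominated by the terms of a convergent series. -/
theorem tendsto_reachProb (hU : Circuit.eval O 𝒜 ∈ Matrix.unitaryGroup (Reg m N w) ℂ)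
    (h0 : 0 < successProb O 𝒜 0) (h1 : successProb O 𝒜 0 < 1) {c p₀ : ℝ}
    (hm : ∀ k, 1 ≤ mSeq c p₀ k) (hsum : Summable (nQAATerm c (successProb O 𝒜 0) p₀)) :
    Filter.Tendsto (reachProb O 𝒜 c p₀) Filter.atTop (nhds 0) := by
  refine squeeze_zero (reachProb_nonneg hU h0 h1 c p₀) (fun k => ?_) hsum.tendsto_atTop_zero
  rw [nQAATerm_eq_mul_reachProb hU h0 h1]
  exact le_mul_of_one_le_left (reachProb_nonneg hU h0 h1 c p₀ k) (by exact_mod_cast hm (k + 1))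

end amplification

/-! ### Normalized vectors -/

theorem normalized_smul {N : ℕ} {f : ℝ} (hf : 0 < f) (v : EuclideanSpace ℂ (Fin N)) :
    normalized ((f : ℂ) • v) = normalized v := by
  rw [normalized, normalized, norm_smul, Complex.norm_real, Real.norm_of_nonneg hf.le, smul_smul,
    ← Complex.ofReal_mul]
  congr 2
  field_simp

theorem exists_phase_normalized_smul {N : ℕ} {f : ℝ} (hf : f ≠ 0)
    (v : EuclideanSpace ℂ (Fin N)) :
    ∃ u : ℂ, ‖u‖ = 1 ∧ u • normalized ((f : ℂ) • v) = normalized v := by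
  rcases lt_or_gt_of_ne hf with h | h
  · refine ⟨-1, by simp, ?_⟩
    rw [← normalized_smul (neg_pos.2 h) v, normalized, normalized, Complex.ofReal_neg]
    simp only [neg_smul, norm_neg, smul_neg, one_smul]
  · exact ⟨1, by simp, by rw [one_smul, normalized_smul h]⟩

/-- Passing from `y/‖x‖` to `y/‖y‖` costs as much as the distance itself, hence the factor `2`,
which uses up the accuracy `ε/2` of one run. -/
theorem norm_normalized_sub_le {N : ℕ} {x y : EuclideanSpace ℂ (Fin N)} (hx : 1 ≤ ‖x‖)
    (hy : 0 < ‖y‖) : ‖normalized y - normalized x‖ ≤ 2 * ‖y - x‖ := by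
  have hx0 : 0 < ‖x‖ := by linarith
  have e : normalized y - normalized x =
      ((‖y‖⁻¹ - ‖x‖⁻¹ : ℝ) : ℂ) • y + ((‖x‖⁻¹ : ℝ) : ℂ) • (y - x) := by
    rw [normalized, normalized, smul_sub]; push_cast; rw [sub_smul]; abel
  have h1 : |‖y‖⁻¹ - ‖x‖⁻¹| * ‖y‖ ≤ ‖x‖⁻¹ * ‖y - x‖ := by
    have : ‖y‖⁻¹ - ‖x‖⁻¹ = (‖x‖ - ‖y‖) * (‖x‖⁻¹ * ‖y‖⁻¹) := by field_simp
    rw [this, abs_mul, abs_of_pos (a := ‖x‖⁻¹ * ‖y‖⁻¹) (by positivity)]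
    have h2 := abs_norm_sub_norm_le x y
    rw [norm_sub_rev] at h2
    calc |‖x‖ - ‖y‖| * (‖x‖⁻¹ * ‖y‖⁻¹) * ‖y‖ = ‖x‖⁻¹ * |‖x‖ - ‖y‖| := by field_simp
      _ ≤ _ := by gcongr
  have h3 : ‖x‖⁻¹ ≤ 1 := inv_le_one_of_one_le₀ hx
  rw [e]
  refine (norm_add_le _ _).trans ?_
  rw [norm_smul, norm_smul, Complex.norm_real, Complex.norm_real, Real.norm_eq_abs,
    Real.norm_of_nonneg (by positivity)]
  have h4 : ‖x‖⁻¹ * ‖y - x‖ ≤ 1 * ‖y - x‖ := by gcongr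
  linarith

/-! ### Accuracy of one run -/

section accuracy

variable {N d w : ℕ} [NeZero N] {A : Matrix (Fin N) (Fin N) ℂ} {b : EuclideanSpace ℂ (Fin N)}
  {κ ε : ℝ} {decode : Bits w → ℂ} {O : Oracles N w}

theorem sparsity_pos (hnorm : ‖Matrix.toEuclideanCLM (n := Fin N) (𝕜 := ℂ) A‖ = 1)
    (hO : O.Specifies decode d A b) : 0 < d := by
  by_contra h
  have hA0 : A = 0 := by
    ext i j
    by_contra hij
    exact h (lt_of_le_of_lt (Nat.zero_le _) (hO.columns i j hij))
  rw [hA0, map_zero, norm_zero] at hnorm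
  exact zero_ne_one hnorm

/-- The norms of the solution and of the state produced by one run, and their distance. -/
theorem run_accuracy (hA : A.IsHermitian) (hdet : IsUnit A.det)
    (hnorm : ‖Matrix.toEuclideanCLM (n := Fin N) (𝕜 := ℂ) A‖ = 1) (hb : ‖b‖ = 1) (hdN : d ≤ N)
    (hκ : condNumber hA ≤ κ) (hε : 0 < ε) (hε2 : ε < 1 / 2) (hdec : Function.Injective decode)
    (hO : O.Specifies decode d A b) {x y : EuclideanSpace ℂ (Fin N)}
    (hx : x = WithLp.toLp 2 (A⁻¹ *ᵥ b.ofLp))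
    (hy : y = goodPart O (stepCircuit N w d κ ε decode) 0) :
    1 ≤ (d : ℝ) * κ ∧ 1 ≤ alpha d κ ε ∧ 1 ≤ ‖x‖ ∧ ‖x‖ / alpha d κ ε ≤ 9 / 10 ∧ ‖y‖ ≤ 9 / 10 ∧
      ‖((alpha d κ ε : ℝ) : ℂ) • y - x‖ ≤ ε / 2 := by
  obtain ⟨hκ1, hev⟩ := eigenvalue_bounds hA hdet hnorm hκ
  have hd := sparsity_pos hnorm hO
  have hd1 : (1 : ℝ) ≤ d := by exact_mod_cast hd
  have hd0 : (0 : ℝ) < d := by linarith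
  have ha : 1 ≤ (d : ℝ) * κ := by nlinarith
  have hαd := le_mul_alpha ha hd hε hε2
  set α := alpha d κ ε with hα
  have hα1 : 1 ≤ α := by
    by_contra! h
    nlinarith
  have hα0 : 0 < α := by linarith
  have hAx : A *ᵥ x.ofLp = b.ofLp := by
    rw [hx]
    simp only [Matrix.mulVec_mulVec, Matrix.mul_nonsing_inv _ hdet, Matrix.one_mulVec]
  have hxc : ∀ i, specCoeff hA i b.ofLp = hA.eigenvalues i * specCoeff hA i x.ofLp := fun i => by
    rw [← specCoeff_mulVec, hAx]
  have hcos : ∀ i, Real.cos (Real.arccos (hA.eigenvalues i / d)) = hA.eigenvalues i / d := by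
    intro i
    have h := abs_le.1 (hev i).2
    refine Real.cos_arccos ?_ ?_
    · rw [le_div_iff₀ hd0]; linarith
    · rw [div_le_iff₀ hd0]; linarith
  have hcosb : ∀ i, 1 / ((d : ℝ) * κ) ≤ |Real.cos (Real.arccos (hA.eigenvalues i / d))| := by
    intro i
    rw [hcos, abs_div, abs_of_pos hd0, mul_comm, ← div_div]
    gcongr
    exact (hev i).1
  have hyc : ∀ i, specCoeff hA i y.ofLp =
      ((chebApprox d κ ε (Real.arccos (hA.eigenvalues i / d)) / α : ℝ) : ℂ) *
        specCoeff hA i b.ofLp := fun i => by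
    rw [hy]
    exact specCoeff_goodPart_zero O decode hA hnorm hα0 hd hdN hdec hO i (hcos i)
  have hne : ∀ i, hA.eigenvalues i ≠ 0 := fun i =>
    abs_pos.1 (lt_of_lt_of_le (by positivity) (hev i).1)
  have hb' : ‖(WithLp.toLp 2 b.ofLp : EuclideanSpace ℂ (Fin N))‖ = 1 := hb
  refine ⟨ha, hα1, ?_, ?_, ?_, ?_⟩
  · have h := (Matrix.toEuclideanCLM (n := Fin N) (𝕜 := ℂ) A).le_opNorm x
    have h2 : Matrix.toEuclideanCLM (n := Fin N) (𝕜 := ℂ) A x = b :=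
      WithLp.ofLp_injective 2 hAx
    rwa [h2, hb, hnorm, one_mul] at h
  · have h : ‖x‖ ≤ κ * ‖(WithLp.toLp 2 b.ofLp : EuclideanSpace ℂ (Fin N))‖ := by
      refine norm_le_of_specCoeff_le hA (x := b.ofLp) (y := x.ofLp) (by linarith) fun i => ?_
      rw [hxc, norm_mul, Complex.norm_real, Real.norm_eq_abs, ← mul_assoc]
      refine le_mul_of_one_le_left (norm_nonneg _) ?_
      have := (hev i).1
      rwa [div_le_iff₀' (by linarith)] at this
    rw [hb', mul_one] at h
    rw [div_le_iff₀ hα0]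
    refine h.trans ?_
    -- Here `α ≥ (10/9) κ` enters, through `le_mul_alpha`.
    have : (d : ℝ) * κ ≤ d * (9 / 10 * α) := by linarith
    exact le_of_mul_le_mul_left this hd0
  · have h : ‖y‖ ≤ 9 / 10 * ‖(WithLp.toLp 2 b.ofLp : EuclideanSpace ℂ (Fin N))‖ := by
      refine norm_le_of_specCoeff_le hA (x := b.ofLp) (y := y.ofLp) (by norm_num) fun i => ?_
      rw [hyc, norm_mul, Complex.norm_real, Real.norm_eq_abs]
      gcongr
      have h1 := abs_mul_chebApprox_le ha hd hε hε2 (hcosb i)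
      rw [abs_mul, abs_of_pos hd0] at h1
      rw [abs_div, abs_of_pos hα0, div_le_iff₀ hα0]
      refine le_of_mul_le_mul_left ?_ hd0
      linarith
    rwa [hb', mul_one] at h
  · have h : ‖(WithLp.toLp 2 ((α : ℂ) • y.ofLp - x.ofLp) : EuclideanSpace ℂ (Fin N))‖ ≤
        ε / 2 * ‖(WithLp.toLp 2 b.ofLp : EuclideanSpace ℂ (Fin N))‖ := by
      refine norm_le_of_specCoeff_le hA (by linarith) fun i => ?_
      set θ := Real.arccos (hA.eigenvalues i / d)
      have e : specCoeff hA i ((α : ℂ) • y.ofLp - x.ofLp) =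
          ((chebApprox d κ ε θ - 1 / hA.eigenvalues i : ℝ) : ℂ) * specCoeff hA i b.ofLp := by
        have hne' : (hA.eigenvalues i : ℂ) ≠ 0 := by exact_mod_cast hne i
        have hα' : (α : ℂ) ≠ 0 := by exact_mod_cast hα0.ne'
        rw [map_sub, map_smul, hyc, hxc, smul_eq_mul]
        change _ * (((chebApprox d κ ε θ / α : ℝ) : ℂ) * _) - _ = _
        push_cast
        field_simp
      rw [e, norm_mul, Complex.norm_real, Real.norm_eq_abs]
      gcongr
      have h1 := abs_mul_chebApprox_sub_inv_le ha hd hε hε2 (hcosb i)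
      rw [hcos] at h1
      have e2 : d * chebApprox d κ ε θ - 1 / (hA.eigenvalues i / d) =
          d * (chebApprox d κ ε θ - 1 / hA.eigenvalues i) := by
        have := hne i
        field_simp
      rw [e2, abs_mul, abs_of_pos hd0] at h1
      exact (le_mul_of_one_le_left (abs_nonneg _) hd1).trans h1
    rwa [hb', mul_one] at h

end accuracy

end QLSChebyshev

/-! ### The main theorem -/

theorem mainTheorem4 (c : ℝ) (hc₁ : 1 < c) (hc₂ : c < 2) :
    ∃ C : ℝ, ∀ (N d w : ℕ) [NeZero N] (A : Matrix (Fin N) (Fin N) ℂ)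
      (b : EuclideanSpace ℂ (Fin N)) (κ ε : ℝ) (decode : QLSChebyshev.Bits w → ℂ)
      (O : QLSChebyshev.Oracles N w) (hA : A.IsHermitian),
      IsUnit A.det → ‖Matrix.toEuclideanCLM (n := Fin N) (𝕜 := ℂ) A‖ = 1 → ‖b‖ = 1 →
      d ≤ N → QLSChebyshev.IsSparse A d → QLSChebyshev.condNumber hA ≤ κ →
      0 < ε → ε < 1 / 2 →
      Function.Injective decode → O.Specifies decode d A b →
      let j₀ : ℕ := QLSChebyshev.jZero d κ ε
      let α : ℝ := QLSChebyshev.alpha d κ ε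
      let x : EuclideanSpace ℂ (Fin N) := WithLp.toLp 2 (A⁻¹ *ᵥ b.ofLp)
      let p₀ : ℝ := 1 / α ^ 2
      let p : ℝ := ‖x‖ ^ 2 / α ^ 2
      let 𝒜 := QLSChebyshev.stepCircuit N w d κ ε decode
      let p' : ℝ := QLSChebyshev.successProb O 𝒜 0
      -- the circuit, and its number of queries
      𝒜.IsUnitary ∧
      𝒜.queriesF = 8 * 2 ^ Nat.log 2 j₀ ∧ 𝒜.queriesA = 8 * 2 ^ Nat.log 2 j₀ ∧
      8 * 2 ^ Nat.log 2 j₀ ≤ 8 * j₀ ∧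
      -- the success probability of one run of the circuit, its estimate and its lower bound
      0 < p₀ ∧ p₀ ≤ p ∧ p < 1 ∧ 0 < p' ∧ p' < 1 ∧
      |Real.sqrt p' - Real.sqrt p| ≤ ε / α ∧
      -- amplification ends with probability one, in a state that is accurate up to `ε`
      Filter.Tendsto (QLSChebyshev.reachProb O 𝒜 c p₀) Filter.atTop (nhds 0) ∧
      (∀ j : ℕ, QLSChebyshev.successProb O 𝒜 j ≠ 0 → ∃ u : ℂ, ‖u‖ = 1 ∧
        ‖u • QLSChebyshev.normalized (QLSChebyshev.goodPart O 𝒜 j) -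
          QLSChebyshev.normalized x‖ ≤ ε) ∧
      -- the overhead of amplification
      Summable (QLSChebyshev.nQAATerm c p' p₀) ∧ Summable (QLSChebyshev.nQAATerm c p p₀) ∧
      |QLSChebyshev.nQAA c p' p₀ - QLSChebyshev.nQAA c p p₀| ≤
        C * ε * QLSChebyshev.nQAA c p p₀ ∧
      -- expected number of queries in the amplification iterates
      (∀ queries ∈ [QLSChebyshev.Circuit.queriesF, QLSChebyshev.Circuit.queriesA],
        QLSChebyshev.expectedSum O 𝒜 c p₀
            (fun j => queries (QLSChebyshev.amplifierPow 𝒜 j)) =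
          ENNReal.ofReal (queries 𝒜 * QLSChebyshev.nQAA c p' p₀) ∧
        QLSChebyshev.expectedSum O 𝒜 c p₀
            (fun j => queries (QLSChebyshev.amplifierPow 𝒜 j)) ≤
          ENNReal.ofReal (8 * j₀ * QLSChebyshev.nQAA c p' p₀) ∧
        QLSChebyshev.expectedSum O 𝒜 c p₀
            (fun j => queries (QLSChebyshev.amplifierPow 𝒜 j)) ≤
          ENNReal.ofReal (8 * j₀ * ((1 + C * ε) * QLSChebyshev.nQAA c p p₀)) ∧
      -- expected number of all queries, with the initial run of the circuit in each round
        QLSChebyshev.expectedSum O 𝒜 c p₀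
            (fun j => queries (𝒜 ++ QLSChebyshev.amplifierPow 𝒜 j)) ≤
          ENNReal.ofReal (16 * j₀ * QLSChebyshev.nQAA c p' p₀)) := by
  obtain ⟨C, hC0, hC⟩ := QLSChebyshev.nQAA_perturbation c hc₁ hc₂
  refine ⟨C, ?_⟩
  intro N d w _ A b κ ε decode O hA hdet hnorm hb hdN hsparse hκ hε hε2 hdec hO j₀ α x p₀ p 𝒜 p'
  set y := QLSChebyshev.goodPart O 𝒜 0 with hy
  obtain ⟨ha, hα1, hx1, hxα, hy9, hyx⟩ :=
    QLSChebyshev.run_accuracy hA hdet hnorm hb hdN hκ hε hε2 hdec hO (x := x) (y := y) rfl rfl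
  have hα0 : 0 < α := lt_of_lt_of_le one_pos hα1
  have hU : QLSChebyshev.Circuit.eval O 𝒜 ∈ Matrix.unitaryGroup _ ℂ :=
    QLSChebyshev.eval_stepCircuit_mem_unitaryGroup hdec hO.prep_unitary
  have hj₀ : 0 < j₀ := QLSChebyshev.jZero_pos ha hε hε2
  have hlog : 8 * 2 ^ Nat.log 2 j₀ ≤ 8 * j₀ :=
    Nat.mul_le_mul_left 8 (Nat.pow_log_le_self 2 hj₀.ne')
  have hp' : p' = ‖y‖ ^ 2 := rfl
  have hp : p = (‖x‖ / α) ^ 2 := by rw [div_pow]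
  have hσ0 : 0 ≤ ‖x‖ / α := by positivity
  -- With `‖x‖ ≥ 1` this also yields `y ≠ 0`, that is, a positive success probability.
  have hαy : |α * ‖y‖ - ‖x‖| ≤ ε / 2 := by
    have h := abs_norm_sub_norm_le ((α : ℂ) • y) x
    rw [norm_smul, Complex.norm_real, Real.norm_of_nonneg hα0.le] at h
    exact h.trans hyx
  have hy0 : 0 < ‖y‖ := by
    have := (abs_le.1 hαy).1
    exact pos_of_mul_pos_right (by linarith : 0 < α * ‖y‖) hα0.le
  have hdiff : |‖y‖ - ‖x‖ / α| ≤ ε / 2 / α := by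
    have e : ‖y‖ - ‖x‖ / α = (α * ‖y‖ - ‖x‖) / α := by field_simp
    rw [e, abs_div, abs_of_pos hα0]
    gcongr
  have hp'0 : 0 < p' := by rw [hp']; positivity
  have hp'1 : p' < 1 := by rw [hp']; nlinarith
  have hασ : 1 ≤ α * (‖x‖ / α) := by rw [mul_div_cancel₀ _ hα0.ne']; exact hx1
  obtain ⟨hs', hs, hn⟩ := hC α (‖x‖ / α) ‖y‖ ε hα1 hε hε2 hασ hxα hy9 hdiff
  rw [← hp', ← hp] at hn
  rw [← hp'] at hs'
  rw [← hp] at hs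
  have hm : ∀ k, 1 ≤ QLSChebyshev.mSeq c p₀ k := QLSChebyshev.one_le_mSeq hc₁.le hα1
  have hF : 𝒜.queriesF = 8 * 2 ^ Nat.log 2 j₀ := QLSChebyshev.queriesF_stepCircuit
  have hQA : 𝒜.queriesA = 8 * 2 ^ Nat.log 2 j₀ := QLSChebyshev.queriesA_stepCircuit
  have hnQ0 : 0 ≤ QLSChebyshev.nQAA c p' p₀ := tsum_nonneg fun k => by
    rw [QLSChebyshev.nQAATerm_eq_mul_reachProb hU hp'0 hp'1]
    exact mul_nonneg (Nat.cast_nonneg _) (QLSChebyshev.reachProb_nonneg hU hp'0 hp'1 _ _ _)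
  have hnle : QLSChebyshev.nQAA c p' p₀ ≤ (1 + C * ε) * QLSChebyshev.nQAA c p p₀ := by
    have := (abs_le.1 hn).2
    linarith
  refine ⟨QLSChebyshev.isUnitary_stepCircuit hdec, hF, hQA, hlog, by positivity, ?_, ?_, hp'0, hp'1,
    ?_, QLSChebyshev.tendsto_reachProb hU hp'0 hp'1 hm hs', ?_, hs', hs, hn, ?_⟩
  · change 1 / α ^ 2 ≤ ‖x‖ ^ 2 / α ^ 2
    gcongr
    exact one_le_pow₀ hx1
  · rw [hp]; nlinarith
  · rw [hp', hp, Real.sqrt_sq hy0.le, Real.sqrt_sq hσ0]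
    refine hdiff.trans ?_
    gcongr
    linarith
  · intro j hj
    set θ := Real.arcsin ‖y‖
    have hsin : Real.sin θ = ‖y‖ := Real.sin_arcsin (by linarith) (by linarith)
    have hcos : 0 < Real.cos θ :=
      lt_of_lt_of_le (by norm_num) (QLSChebyshev.cos_arcsin_ge hy0.le hy9)
    have hg := QLSChebyshev.goodPart_eq_smul hU (θ := θ) (by rw [hsin]; rfl)
      (by rw [hsin]; exact hy0.ne') hcos.ne' j
    set f : ℝ := (-1) ^ j * (Real.sin ((2 * j + 1) * θ) / Real.sin θ)
    have hf : f ≠ 0 := by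
      intro hf
      apply hj
      rw [QLSChebyshev.successProb, hg, hf]
      simp
    obtain ⟨u, hu, hu2⟩ := QLSChebyshev.exists_phase_normalized_smul hf y
    refine ⟨u, hu, ?_⟩
    -- Normalization forgets the real factor of `Q^j` up to a sign, absorbed in `u`, and also the
    -- factor `α`; so `α y`, which is within `ε/2` of `x`, may be compared with `x`.
    rw [hg, hu2, ← QLSChebyshev.normalized_smul hα0 y]
    refine (QLSChebyshev.norm_normalized_sub_le hx1 ?_).trans (by linarith)
    rw [norm_smul, Complex.norm_real, Real.norm_of_nonneg hα0.le]
    exact mul_pos hα0 hy0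
  · have main : ∀ q : QLSChebyshev.Instr (QLSChebyshev.ctrlQubits d κ ε) N w → Bool,
        (∀ g, q g.inv = q g) → (∀ U, q (.gate U) = false) →
        𝒜.countP q = 8 * 2 ^ Nat.log 2 j₀ →
        QLSChebyshev.expectedSum O 𝒜 c p₀
            (fun j => (QLSChebyshev.amplifierPow 𝒜 j).countP q) =
          ENNReal.ofReal (𝒜.countP q * QLSChebyshev.nQAA c p' p₀) ∧
        QLSChebyshev.expectedSum O 𝒜 c p₀
            (fun j => (QLSChebyshev.amplifierPow 𝒜 j).countP q) ≤
          ENNReal.ofReal (8 * j₀ * QLSChebyshev.nQAA c p' p₀) ∧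
        QLSChebyshev.expectedSum O 𝒜 c p₀
            (fun j => (QLSChebyshev.amplifierPow 𝒜 j).countP q) ≤
          ENNReal.ofReal (8 * j₀ * ((1 + C * ε) * QLSChebyshev.nQAA c p p₀)) ∧
        QLSChebyshev.expectedSum O 𝒜 c p₀
            (fun j => (𝒜 ++ QLSChebyshev.amplifierPow 𝒜 j).countP q) ≤
          ENNReal.ofReal (16 * j₀ * QLSChebyshev.nQAA c p' p₀) := by
      intro q hq hgate hcount
      obtain ⟨h1, h2⟩ := QLSChebyshev.expectedSum_bounds hU hp'0 hp'1 hm hs' q hq hgate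
      have hle : (𝒜.countP q : ℝ) ≤ 8 * j₀ := by rw [hcount]; exact_mod_cast hlog
      have h3 : (𝒜.countP q : ℝ) * QLSChebyshev.nQAA c p' p₀ ≤
          8 * j₀ * QLSChebyshev.nQAA c p' p₀ := mul_le_mul_of_nonneg_right hle hnQ0
      refine ⟨h1, ?_, ?_, h2.trans (ENNReal.ofReal_le_ofReal ?_)⟩
      · rw [h1]; exact ENNReal.ofReal_le_ofReal h3
      · rw [h1]
        refine ENNReal.ofReal_le_ofReal (h3.trans ?_)
        gcongr
      · change 2 * (𝒜.countP q : ℝ) * QLSChebyshev.nQAA c p' p₀ ≤ _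
        linarith
    intro queries hqueries
    simp only [List.mem_cons, List.not_mem_nil, or_false] at hqueries
    rcases hqueries with rfl | rfl
    · exact main QLSChebyshev.Instr.isOracleF (fun g => by cases g <;> rfl) (fun _ => rfl) hF
    · exact main QLSChebyshev.Instr.isOracleA (fun g => by cases g <;> rfl) (fun _ => rfl) hQA
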